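/- Let $M_0, M_1$ be smooth $3$-manifolds (Hausdorff, second countable, without boundary) with coorientable contact structures $\xi_i=\ker\alpha_i$, where $\alpha_i$ is a smooth $1$-form with $\alpha_i\wedge d\alpha_i\neq 0$ everywhere. Let $S_i\subset M_i$ be non-empty closed surfaces, i.e. compact smoothly embedded surfaces without boundary (not necessarily connected or orientable), and let $\phi\colon S_0\to S_1$ be a diffeomorphism. If $U\subset S_i$ is open and oriented by a smooth area form $\Omega$ on $U$, the oriented characteristic foliation $S_{i,\xi_i}$ over $U$ is the class, up to multiplication by positive smooth functions, of the vector field $X$ on $U$ determined by $i_X\Omega=\alpha_i|_{TU}$. Suppose that $\phi(S_{0,\xi_0})=S_{1,\xi_1}$ as oriented characteristic foliations, in the following sense: every point of $S_0$ has an open neighbourhood $U\subset S_0$ such that, for suitable smooth area forms on $U$ and on $\phi(U)$, the corresponding vector fields $X_0$ on $U$ and $X_1$ on $\phi(U)$ satisfy $T\phi(X_0)=f\cdot (X_1\circ\phi)$ for some smooth function $f\colon U\to\mathbb{R}^+$. (If $S_0$ and $S_1$ are oriented and $\phi$ maps the globally oriented characteristic foliation of $S_0$ to that of $S_1$, this holds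 with $U=S_0$.) Then there are open neighbourhoods $\mathcal{N}(S_i)$ of $S_i$ in $M_i$ and a contactomorphism $\psi\colon\mathcal{N}(S_0)\to\mathcal{N}(S_1)$, i.e. a diffeomorphism with $T\psi(\xi_0)=\xi_1$, such that $\psi|_{S_0}=\phi$. -/

import Mathlib

open Set Topology Bundle Manifold
open scoped ContDiff

noncomputable section

/-- A (not necessarily smooth) differential 1-form on a 3-manifold. -/
abbrev OneForm (M : Type*) [TopologicalSpace M] [ChartedSpace (EuclideanSpace ℝ (Fin 3)) M] :=
  ∀ x : M, TangentSpace (𝓡 3) x →L[ℝ] ℝ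

/-- A (not necessarily smooth) field of bilinear forms on the tangent planes of a surface. -/
abbrev BilinField (S : Type*) [TopologicalSpace S] [ChartedSpace (EuclideanSpace ℝ (Fin 2)) S] :=
  ∀ q : S, TangentSpace (𝓡 2) q →L[ℝ] TangentSpace (𝓡 2) q →L[ℝ] ℝ

section Contact

variable {M : Type*} [TopologicalSpace M] [ChartedSpace (EuclideanSpace ℝ (Fin 3)) M]

/-- Smoothness of a 1-form, as a section of the cotangent bundle. -/
def OneForm.Smooth [IsManifold (𝓡 3) ∞ M] (α : OneForm M) : Prop :=
  ContMDiff (𝓡 3) ((𝓡 3).prod 𝓘(ℝ, EuclideanSpace ℝ (Fin 3) →L[ℝ] ℝ)) ∞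
    (fun x ↦ TotalSpace.mk' (EuclideanSpace ℝ (Fin 3) →L[ℝ] ℝ)
      (E := fun x : M ↦ TangentSpace (𝓡 3) x →L[ℝ] ℝ) x (α x))

/-- The 1-form `α` in the preferred chart at `p`: its pull-back under the inverse of the chart. -/
def OneForm.inChart (α : OneForm M) (p : M) (y : EuclideanSpace ℝ (Fin 3)) :
    EuclideanSpace ℝ (Fin 3) →L[ℝ] ℝ :=
  (α ((extChartAt (𝓡 3) p).symm y)).comp
    (mfderiv 𝓘(ℝ, EuclideanSpace ℝ (Fin 3)) (𝓡 3) (extChartAt (𝓡 3) p).symm y)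

/-- The exterior derivative `dA(v, w)` at `y` of a 1-form `A` on `ℝ³`. -/
def extDerivOneForm (A : EuclideanSpace ℝ (Fin 3) → EuclideanSpace ℝ (Fin 3) →L[ℝ] ℝ)
    (y v w : EuclideanSpace ℝ (Fin 3)) : ℝ :=
  extDeriv (fun z ↦ ContinuousAlternatingMap.ofSubsingleton ℝ
    (EuclideanSpace ℝ (Fin 3)) ℝ (0 : Fin 1) (A z)) y ![v, w]

/-- The 3-form `A ∧ dA` on `ℝ³`, evaluated at `y` on the vectors `u, v, w`. -/
def wedgeExtDeriv (A : EuclideanSpace ℝ (Fin 3) → EuclideanSpace ℝ (Fin 3) →L[ℝ] ℝ)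
    (y u v w : EuclideanSpace ℝ (Fin 3)) : ℝ :=
  A y u * extDerivOneForm A y v w + A y v * extDerivOneForm A y w u
    + A y w * extDerivOneForm A y u v

/-- `α` is a contact form on the 3-manifold `M`: it is smooth and `α ∧ dα` vanishes nowhere
(the non-vanishing at `p` is expressed in the preferred chart at `p`). -/
def IsContactForm [IsManifold (𝓡 3) ∞ M] (α : OneForm M) : Prop :=
  α.Smooth ∧ ∀ p : M, ∃ u v w : EuclideanSpace ℝ (Fin 3),
    wedgeExtDeriv (α.inChart p) (extChartAt (𝓡 3) p p) u v w ≠ 0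

/-- The coorientable plane field `ξ = ker α`. -/
def contactPlane (α : OneForm M) (x : M) : Submodule ℝ (TangentSpace (𝓡 3) x) :=
  LinearMap.ker (α x : TangentSpace (𝓡 3) x →ₗ[ℝ] ℝ)

/-- `ψ`, a homeomorphism from the open set `ψ.source` onto the open set `ψ.target`, is a
contactomorphism from `(ψ.source, ker α₀)` to `(ψ.target, ker α₁)`: a diffeomorphism whose
differential maps contact planes onto contact planes. -/
structure IsContactomorphism {M' : Type*} [TopologicalSpace M']
    [ChartedSpace (EuclideanSpace ℝ (Fin 3)) M']
    (α₀ : OneForm M) (α₁ : OneForm M') (ψ : OpenPartialHomeomorph M M') : Prop where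
  contMDiffOn : ContMDiffOn (𝓡 3) (𝓡 3) ∞ ψ ψ.source
  contMDiffOn_symm : ContMDiffOn (𝓡 3) (𝓡 3) ∞ ψ.symm ψ.target
  map_contactPlane : ∀ x ∈ ψ.source,
    (contactPlane α₀ x).map
      (mfderiv (𝓡 3) (𝓡 3) ψ x : TangentSpace (𝓡 3) x →ₗ[ℝ] TangentSpace (𝓡 3) (ψ x))
      = contactPlane α₁ (ψ x)

end Contact

section CharacteristicFoliation

variable {S : Type*} [TopologicalSpace S] [ChartedSpace (EuclideanSpace ℝ (Fin 2)) S]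

/-- `Ω` restricts to a smooth area form (nowhere vanishing alternating 2-form) on the open
subset `U` of the surface `S`; thereby it orients `U`. -/
structure IsAreaFormOn [IsManifold (𝓡 2) ∞ S] (Ω : BilinField S) (U : Set S) : Prop where
  smooth : ContMDiffOn (𝓡 2)
    ((𝓡 2).prod 𝓘(ℝ, EuclideanSpace ℝ (Fin 2) →L[ℝ] EuclideanSpace ℝ (Fin 2) →L[ℝ] ℝ)) ∞
    (fun q ↦ TotalSpace.mk' (EuclideanSpace ℝ (Fin 2) →L[ℝ] EuclideanSpace ℝ (Fin 2) →L[ℝ] ℝ)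
      (E := fun q : S ↦ TangentSpace (𝓡 2) q →L[ℝ] TangentSpace (𝓡 2) q →L[ℝ] ℝ) q (Ω q)) U
  alternating : ∀ q ∈ U, ∀ v : TangentSpace (𝓡 2) q, Ω q v v = 0
  ne_zero : ∀ q ∈ U, Ω q ≠ 0

variable {M : Type*} [TopologicalSpace M] [ChartedSpace (EuclideanSpace ℝ (Fin 3)) M]

/-- The vector field `X` on `U ⊆ S` defines the characteristic foliation of the surface
`ι : S → (M, ker α)` over `U`, with the orientation determined by the orientation `Ω` of `U` and
the coorientation `α`: it satisfies `i_X Ω = ι^* α` on `U`. -/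
def DirectsCharFoliation (α : OneForm M) (ι : S → M) (U : Set S) (Ω : BilinField S)
    (X : ∀ q : S, TangentSpace (𝓡 2) q) : Prop :=
  ∀ q ∈ U, ∀ v : TangentSpace (𝓡 2) q,
    Ω q (X q) v = α (ι q) (mfderiv (𝓡 2) (𝓡 3) ι q v)

/-- The diffeomorphism `φ` maps the oriented characteristic foliation of `ι₀ : S₀ → (M₀, ker α₀)`
to that of `ι₁ : S₁ → (M₁, ker α₁)`. As oriented singular foliations are vector fields up to
multiplication by positive smooth functions, this means that `φ` carries a vector field `X₀`
defining the first to a positive multiple of a vector field `X₁` defining the second.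
The orientations of the surfaces are chosen locally, so that non-orientable surfaces are allowed;
if `S₀` and `S₁` are globally oriented, with area forms `Ω₀` and `Ω₁`, then matching the
oriented foliations is the case `U = univ`. -/
def PreservesOrientedCharFoliation [IsManifold (𝓡 2) ∞ S] {S' : Type*} [TopologicalSpace S']
    [ChartedSpace (EuclideanSpace ℝ (Fin 2)) S'] [IsManifold (𝓡 2) ∞ S'] {M' : Type*} [TopologicalSpace M']
    [ChartedSpace (EuclideanSpace ℝ (Fin 3)) M']
    (α₀ : OneForm M) (ι₀ : S → M) (α₁ : OneForm M') (ι₁ : S' → M')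
    (φ : S ≃ₘ^∞⟮𝓡 2, 𝓡 2⟯ S') : Prop :=
  ∀ p : S, ∃ U : Set S, IsOpen U ∧ p ∈ U ∧
    ∃ (Ω₀ : BilinField S) (Ω₁ : BilinField S')
      (X₀ : ∀ q : S, TangentSpace (𝓡 2) q) (X₁ : ∀ q : S', TangentSpace (𝓡 2) q) (f : S → ℝ),
      IsAreaFormOn Ω₀ U ∧ IsAreaFormOn Ω₁ (φ '' U) ∧
      DirectsCharFoliation α₀ ι₀ U Ω₀ X₀ ∧ DirectsCharFoliation α₁ ι₁ (φ '' U) Ω₁ X₁ ∧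
      ContMDiffOn (𝓡 2) 𝓘(ℝ, ℝ) ∞ f U ∧ (∀ q ∈ U, 0 < f q) ∧
      ∀ q ∈ U, mfderiv (𝓡 2) (𝓡 2) φ q (X₀ q) = f q • X₁ (φ q)

end CharacteristicFoliation

end

-- Equality of the oriented foliations means that the two forms, restricted to the surface, differ
-- by a smooth nowhere vanishing factor, also across the singularities
-- (`PreservesOrientedCharFoliation.exists_factor`). After absorbing the factor locally, two contact
-- forms `a`, `b` near the plane `x₂ = 0` of `ℝ³` have the same restriction to that plane, and
-- reflecting charts makes both positive. The contact condition then yields a vector field `w` with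
-- `b(w) = a(e₂)` and `w₂ > 0` (`exists_transverse_vector`). A map `Ψ` that is the identity on the
-- plane and has normal derivative `w` satisfies `Ψ^*b = a` along the plane, on all tangent vectors.
-- Hence the linear path from `a` to `Ψ^*b` is contact there, and Moser's trick in Gray's form
-- (`exists_gray_isotopy`) corrects `Ψ` to a contactomorphism germ by an isotopy fixing the plane.
--
-- Neither a global factor nor a coorientation of the surface is needed, because the local result is
-- proved relative to a compact set `K` on which a germ `ψ` is already given
-- (`exists_contactGerm_extension`). Two facts make this work. By `IsContactGerm.pullbackForm_eq`,
-- the 1-jet of a given germ is forced to satisfy the conditions imposed on `Ψ`; these are convex in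
-- the normal derivative, so `ψ` can be blended with the model map by a cut-off function. Moreover,
-- the Gray vector field vanishes wherever `Ψ` already maps kernels to kernels, so the correction
-- leaves `ψ` untouched near `K`.
--
-- Compactness of the surface patches finitely many such extensions (`exists_isContactExtensionAt`).
-- The outcome is a local diffeomorphism that is injective on the surface, hence injective on a
-- neighbourhood of it.
--
-- The smooth flow required by Gray's argument comes from the inverse function theorem in `C([0,1],
-- E)`, applied to the integral form of the differential equation.

local notation "𝔼" => EuclideanSpace ℝ (Fin 3)
local notation "𝔼₂" => EuclideanSpace ℝ (Fin 2)

/-! ## Smooth dependence of solutions of ordinary differential equations -/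

section SuperpositionOperator

universe u

variable {K : Type*} [TopologicalSpace K] [CompactSpace K]

set_option synthInstance.maxHeartbeats 200000 in
noncomputable instance ContinuousMap.normedAddCommGroupCLM (K : Type*) [TopologicalSpace K]
    [CompactSpace K] (E F : Type*) [NormedAddCommGroup E] [NormedSpace ℝ E]
    [NormedAddCommGroup F] [NormedSpace ℝ F] : NormedAddCommGroup C(K, E →L[ℝ] F) :=
  ContinuousMap.instNormedAddCommGroup

/-- Pointwise application of a continuous family of linear maps to a continuous family of
vectors, as a continuous bilinear map. -/
noncomputable def ContinuousMap.pointwiseApplyCLM (K : Type*) [TopologicalSpace K] [CompactSpace K]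
    (E F : Type*) [NormedAddCommGroup E] [NormedSpace ℝ E]
    [NormedAddCommGroup F] [NormedSpace ℝ F] :
    C(K, E →L[ℝ] F) →L[ℝ] C(K, E) →L[ℝ] C(K, F) :=
  LinearMap.mkContinuous₂
    (LinearMap.mk₂ ℝ (fun (A : C(K, E →L[ℝ] F)) (η : C(K, E)) ↦
        (⟨fun t ↦ A t (η t), by fun_prop⟩ : C(K, F)))
      (fun A A' η ↦ by ext; simp) (fun c A η ↦ by ext; simp)
      (fun A η η' ↦ by ext; simp) (fun c A η ↦ by ext; simp)) 1
    (fun A η ↦ by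
      rw [one_mul, ContinuousMap.norm_le _ (by positivity)]
      intro t
      exact (A t).le_of_opNorm_le_of_le (A.norm_coe_le_norm t) (η.norm_coe_le_norm t))

variable {E F : Type u} [NormedAddCommGroup E] [NormedSpace ℝ E]
  [NormedAddCommGroup F] [NormedSpace ℝ F]

@[simp]
theorem ContinuousMap.pointwiseApplyCLM_apply (A : C(K, E →L[ℝ] F)) (η : C(K, E)) (t : K) :
    ContinuousMap.pointwiseApplyCLM K E F A η t = A t (η t) := rfl

/-- The superposition operator of a `C^1` map is differentiable. -/
theorem hasFDerivAt_continuousMap_comp {f : E → F} (hf : ContDiff ℝ 1 f) (γ : C(K, E)) :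
    HasFDerivAt (fun γ : C(K, E) ↦ (⟨f, hf.continuous⟩ : C(E, F)).comp γ)
      (ContinuousMap.pointwiseApplyCLM K E F
        ((⟨fderiv ℝ f, hf.continuous_fderiv one_ne_zero⟩ : C(E, E →L[ℝ] F)).comp γ)) γ := by
  rw [hasFDerivAt_iff_isLittleO_nhds_zero, Asymptotics.isLittleO_iff]
  intro ε hε
  -- Compactness of the range gives one `δ` for all `t`; the mean value inequality on a ball of
  -- radius `δ` then bounds the remainder uniformly.
  have hc : IsCompact (range γ) := isCompact_range γ.continuous
  have hu := hc.uniformContinuousAt_of_continuousAt (fderiv ℝ f)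
    (fun a _ ↦ (hf.continuous_fderiv one_ne_zero).continuousAt) (Metric.dist_mem_uniformity hε)
  obtain ⟨δ, hδ, h⟩ := Metric.mem_uniformity_dist.1 hu
  filter_upwards [Metric.ball_mem_nhds (0 : C(K, E)) hδ] with η hη
  rw [ContinuousMap.norm_le _ (by positivity)]
  intro t
  have hηt : ‖η t‖ < δ := (η.norm_coe_le_norm t).trans_lt (by simpa using hη)
  have key : ‖f (γ t + η t) - f (γ t) - fderiv ℝ f (γ t) (γ t + η t - γ t)‖
      ≤ ε * ‖γ t + η t - γ t‖ := by
    refine (convex_ball (γ t) δ).norm_image_sub_le_of_norm_fderiv_le' (𝕜 := ℝ)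
      (fun x _ ↦ hf.differentiable one_ne_zero x) (fun x hx ↦ ?_) (Metric.mem_ball_self hδ)
      (by simpa using hηt)
    have := h (a := γ t) (b := x) (by rw [dist_comm]; exact hx) (mem_range_self t)
    rw [mem_ofPred_eq, dist_comm, dist_eq_norm] at this
    exact this.le
  simp only [add_sub_cancel_left] at key
  refine le_trans key ?_
  gcongr
  exact η.norm_coe_le_norm t

/-- The superposition operator of a `C^n` map is `C^n`. -/
theorem contDiff_nat_continuousMap_comp (n : ℕ) : ∀ {F : Type u} [NormedAddCommGroup F]
    [NormedSpace ℝ F] {f : E → F} (hc : Continuous f), ContDiff ℝ n f →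
    ContDiff ℝ n (fun γ : C(K, E) ↦ (⟨f, hc⟩ : C(E, F)).comp γ) := by
  induction n with
  | zero =>
    intro F _ _ f hc hf
    exact contDiff_zero.2 (ContinuousMap.continuous_postcomp _)
  | succ n ih =>
    intro F _ _ f hc hf
    have h1 : ContDiff ℝ 1 f := hf.of_le (by exact_mod_cast Nat.le_add_left 1 n)
    have h2 : ContDiff ℝ n (fderiv ℝ f) := hf.fderiv_right (by exact_mod_cast le_rfl)
    rw [Nat.cast_succ, contDiff_succ_iff_fderiv]
    refine ⟨fun γ ↦ (hasFDerivAt_continuousMap_comp h1 γ).differentiableAt, by simp, ?_⟩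
    -- The derivative is again a superposition operator, that of `fderiv ℝ f`, followed by a
    -- continuous linear map. The induction therefore changes the target to `E →L[ℝ] F`, which is
    -- why `F` is quantified inside and shares the universe of `E`.
    rw [show fderiv ℝ _ = _ from funext fun γ ↦ (hasFDerivAt_continuousMap_comp h1 γ).fderiv]
    exact (ContinuousMap.pointwiseApplyCLM K E F).contDiff.comp (ih _ h2)

theorem contDiff_continuousMap_comp {f : E → F} (hf : ContDiff ℝ ∞ f) :
    ContDiff ℝ ∞ (fun γ : C(K, E) ↦ (⟨f, hf.continuous⟩ : C(E, F)).comp γ) :=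
  contDiff_infty.2 fun n ↦ contDiff_nat_continuousMap_comp n hf.continuous (contDiff_infty.1 hf n)

end SuperpositionOperator

/-! ### Volterra operators on `C([0,1], E)`. -/

section Volterra

open unitInterval

variable {E : Type*} [NormedAddCommGroup E]

/-- Extension of a curve on `[0, 1]` to the real line, constant on both sides. -/
noncomputable def extendCurve (γ : C(I, E)) (t : ℝ) : E := γ (projIcc 0 1 zero_le_one t)

@[fun_prop]
theorem continuous_extendCurve (γ : C(I, E)) : Continuous (extendCurve γ) :=
  γ.continuous.comp continuous_projIcc

theorem extendCurve_of_mem (γ : C(I, E)) {t : ℝ} (ht : t ∈ I) : extendCurve γ t = γ ⟨t, ht⟩ := by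
  rw [extendCurve, projIcc_of_mem zero_le_one ht]

theorem norm_extendCurve_le (γ : C(I, E)) (t : ℝ) : ‖extendCurve γ t‖ ≤ ‖γ‖ :=
  γ.norm_coe_le_norm _

variable [NormedSpace ℝ E]

/-- The primitive, vanishing at `0`, of a continuous curve on `[0, 1]`. -/
noncomputable def primitiveCLM (E : Type*) [NormedAddCommGroup E] [NormedSpace ℝ E] :
    C(I, E) →L[ℝ] C(I, E) :=
  LinearMap.mkContinuous
    { toFun := fun η ↦ ⟨fun t ↦ ∫ s in (0 : ℝ)..t, extendCurve η s, by
        exact (intervalIntegral.continuous_primitive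
          (fun a b ↦ (continuous_extendCurve η).intervalIntegrable a b) 0).comp
          continuous_subtype_val⟩
      map_add' := fun η ζ ↦ by
        ext t
        exact intervalIntegral.integral_add ((continuous_extendCurve η).intervalIntegrable _ _)
          ((continuous_extendCurve ζ).intervalIntegrable _ _)
      map_smul' := fun c η ↦ by
        ext t
        exact intervalIntegral.integral_smul c _ } 1
    (fun η ↦ by
      rw [one_mul, ContinuousMap.norm_le _ (norm_nonneg _)]
      intro t
      refine (intervalIntegral.norm_integral_le_of_norm_le_const
        (fun s _ ↦ norm_extendCurve_le η s)).trans ?_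
      rw [sub_zero, abs_of_nonneg t.2.1]
      exact mul_le_of_le_one_right (norm_nonneg _) t.2.2)

theorem primitiveCLM_apply (η : C(I, E)) (t : I) :
    primitiveCLM E η t = ∫ s in (0 : ℝ)..t, extendCurve η s := rfl

theorem hasDerivWithinAt_primitiveCLM [CompleteSpace E] (η : C(I, E)) {t : ℝ} (ht : t ∈ I) :
    HasDerivWithinAt (extendCurve (primitiveCLM E η)) (extendCurve η t) I t := by
  have h : HasDerivAt (fun t ↦ ∫ s in (0 : ℝ)..t, extendCurve η s) (extendCurve η t) t :=
    intervalIntegral.integral_hasDerivAt_right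
      ((continuous_extendCurve η).intervalIntegrable _ _)
      (continuous_extendCurve η).stronglyMeasurable.stronglyMeasurableAtFilter
      (continuous_extendCurve η).continuousAt
  refine h.hasDerivWithinAt.congr_of_mem (fun s hs ↦ ?_) ht
  rw [extendCurve_of_mem _ hs, primitiveCLM_apply]

/-- The Volterra operator `η ↦ ∫₀ᵗ A η`. -/
noncomputable def volterraCLM (A : C(I, E →L[ℝ] E)) : C(I, E) →L[ℝ] C(I, E) :=
  (primitiveCLM E).comp (ContinuousMap.pointwiseApplyCLM I E E A)

/-- An `n`-fold iterated integral runs over a simplex of volume `tⁿ / n!`. The bound must keep its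
dependence on `t`, since the inductive step integrates it. -/
theorem norm_volterraCLM_pow_apply_le (A : C(I, E →L[ℝ] E)) (n : ℕ) (η : C(I, E)) (t : I) :
    ‖(volterraCLM A ^ n) η t‖ ≤ (‖A‖ * t) ^ n / n.factorial * ‖η‖ := by
  induction n generalizing t with
  | zero => simpa using η.norm_coe_le_norm t
  | succ n ih =>
    rw [pow_succ', mul_apply_eq_comp]
    set ζ := (volterraCLM A ^ n) η
    change ‖∫ s in (0 : ℝ)..t, extendCurve (ContinuousMap.pointwiseApplyCLM I E E A ζ) s‖ ≤ _
    have hint : ∫ s in (0 : ℝ)..t, ‖A‖ * ((‖A‖ * s) ^ n / n.factorial * ‖η‖)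
        = (‖A‖ * t) ^ (n + 1) / (n + 1).factorial * ‖η‖ := by
      have : (fun s : ℝ ↦ ‖A‖ * ((‖A‖ * s) ^ n / n.factorial * ‖η‖))
          = fun s ↦ (‖A‖ ^ (n + 1) / n.factorial * ‖η‖) * s ^ n := by
        funext s; rw [mul_pow]; ring
      rw [this, intervalIntegral.integral_const_mul, integral_pow, Nat.factorial_succ]
      push_cast
      have : (n.factorial : ℝ) ≠ 0 := by positivity
      have : (n : ℝ) + 1 ≠ 0 := by positivity
      field_simp
      simp only [ne_eq, Nat.add_eq_zero_iff, one_ne_zero, and_false, not_false_eq_true, zero_pow, sub_zero, mul_pow]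
      ring
    rw [← hint]
    refine intervalIntegral.norm_integral_le_of_norm_le t.2.1 (MeasureTheory.ae_of_all _ fun s hs ↦ ?_)
      (Continuous.intervalIntegrable (by fun_prop) _ _)
    have hsI : s ∈ I := ⟨hs.1.le, hs.2.trans t.2.2⟩
    rw [extendCurve_of_mem _ hsI, ContinuousMap.pointwiseApplyCLM_apply]
    exact (A _).le_of_opNorm_le_of_le (A.norm_coe_le_norm _) (ih ⟨s, hsI⟩)

/-- The operator `V` need not be a contraction, but by factorial decay some power is, so `1 - Vⁿ` is
invertible. It is the product of the commuting factors `1 - V` and `∑ Vⁱ`, so `1 - V` is invertible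
too. -/
theorem isUnit_one_sub_volterraCLM [CompleteSpace E] (A : C(I, E →L[ℝ] E)) :
    IsUnit (1 - volterraCLM A) := by
  obtain ⟨n, hn⟩ : ∃ n : ℕ, ‖A‖ ^ n / n.factorial < 1 :=
    ((FloorSemiring.tendsto_pow_div_factorial_atTop ‖A‖).eventually_lt_const zero_lt_one).exists
  have hlt : ‖volterraCLM A ^ n‖ < 1 := by
    refine lt_of_le_of_lt (ContinuousLinearMap.opNorm_le_bound _ (by positivity) fun η ↦ ?_) hn
    rw [ContinuousMap.norm_le _ (by positivity)]
    intro t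
    refine (norm_volterraCLM_pow_apply_le A n η t).trans ?_
    gcongr
    · exact mul_nonneg (norm_nonneg A) t.2.1
    · exact mul_le_of_le_one_right (norm_nonneg A) t.2.2
  have h1 : IsUnit (1 - volterraCLM A ^ n) := isUnit_one_sub_of_norm_lt_one (R := C(I, E) →L[ℝ] C(I, E)) hlt
  have hcomm : Commute (1 - volterraCLM A) (∑ i ∈ Finset.range n, volterraCLM A ^ i) :=
    (Commute.sum_right _ _ _ fun i _ ↦
      ((Commute.one_left _).sub_left ((Commute.refl _).pow_right i)))
  rw [← mul_neg_geom_sum] at h1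
  exact (hcomm.isUnit_mul_iff.1 h1).1

end Volterra

/-! ### Smooth flows of compactly supported time-dependent vector fields. -/

section Flow

open unitInterval

universe u

variable {E : Type u} [NormedAddCommGroup E] [NormedSpace ℝ E]

theorem HasDerivWithinAt.Ici_of_unitInterval {f : ℝ → E} {f' : E} {t : ℝ} (ht : t ∈ Ico (0 : ℝ) 1)
    (h : HasDerivWithinAt f f' I t) : HasDerivWithinAt f f' (Ici t) t :=
  h.mono_of_mem_nhdsWithin (Filter.mem_of_superset (Icc_mem_nhdsGE ht.2)
    (Icc_subset_Icc_left ht.1))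

theorem HasDerivWithinAt.Iic_of_unitInterval {f : ℝ → E} {f' : E} {t : ℝ} (ht : t ∈ Ioc (0 : ℝ) 1)
    (h : HasDerivWithinAt f f' I t) : HasDerivWithinAt f f' (Iic t) t :=
  h.mono_of_mem_nhdsWithin (Filter.mem_of_superset (Icc_mem_nhdsLE ht.1)
    (Icc_subset_Icc_right ht.2))

/-- Equivalence of integral equation and initial value problem. Keeping `ζ` independent of `γ` lets
it serve both the nonlinear equation and its linearisation. -/
theorem eq_const_add_primitiveCLM_iff [CompleteSpace E] {γ ζ : C(I, E)} {x : E} :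
    γ - primitiveCLM E ζ = ContinuousMap.const I x ↔
      γ 0 = x ∧ ∀ t ∈ I, HasDerivWithinAt (extendCurve γ) (extendCurve ζ t) I t := by
  have h0 : primitiveCLM E ζ 0 = 0 := by simp [primitiveCLM_apply]
  constructor
  · intro h
    have h' : γ = ContinuousMap.const I x + primitiveCLM E ζ := by rw [← h]; abel
    refine ⟨by simp [h', h0], fun t ht ↦ ?_⟩
    have : extendCurve γ = fun t ↦ x + extendCurve (primitiveCLM E ζ) t := by
      funext s; simp [h', extendCurve]
    rw [this]
    exact (hasDerivWithinAt_primitiveCLM ζ ht).const_add x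
  · rintro ⟨h1, h2⟩
    have hd : ∀ t ∈ I, HasDerivWithinAt
        (fun t ↦ extendCurve γ t - extendCurve (primitiveCLM E ζ) t) 0 I t := fun t ht ↦ by
      simpa only [sub_self] using (h2 t ht).fun_sub (hasDerivWithinAt_primitiveCLM ζ ht)
    have hc := constant_of_has_deriv_right_zero (fun t ht ↦ (hd t ht).continuousWithinAt)
      (fun t ht ↦ (hd t (Ico_subset_Icc_self ht)).Ici_of_unitInterval ht)
    ext t
    have := hc t t.2
    rw [extendCurve_of_mem _ t.2, extendCurve_of_mem _ t.2,
      extendCurve_of_mem _ (left_mem_Icc.2 zero_le_one),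
      extendCurve_of_mem _ (left_mem_Icc.2 zero_le_one)] at this
    change γ t - primitiveCLM E ζ t = γ 0 - primitiveCLM E ζ 0 at this
    simpa [h0, h1] using this

/-- The curve `t ↦ (t, γ t)`. -/
noncomputable def graphCurve (γ : C(I, E)) : C(I, ℝ × E) := ⟨fun t ↦ (t, γ t), by fun_prop⟩

theorem hasFDerivAt_graphCurve (γ : C(I, E)) : HasFDerivAt (graphCurve (E := E))
    ((ContinuousLinearMap.inr ℝ ℝ E).compLeftContinuous ℝ I) γ := by
  have : graphCurve (E := E) = fun γ ↦ (⟨fun t ↦ ((t : ℝ), 0), by fun_prop⟩ : C(I, ℝ × E)) +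
      (ContinuousLinearMap.inr ℝ ℝ E).compLeftContinuous ℝ I γ := by
    funext γ; ext t <;> simp [graphCurve]
  rw [this]
  exact (ContinuousLinearMap.hasFDerivAt _).const_add _

theorem contDiff_graphCurve : ContDiff ℝ ∞ (graphCurve (E := E)) := by
  have : graphCurve (E := E) = fun γ ↦ (⟨fun t ↦ ((t : ℝ), 0), by fun_prop⟩ : C(I, ℝ × E)) +
      (ContinuousLinearMap.inr ℝ ℝ E).compLeftContinuous ℝ I γ := by
    funext γ; ext t <;> simp [graphCurve]
  rw [this]
  exact contDiff_const.add (ContinuousLinearMap.contDiff _)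

variable {X : ℝ × E → E}

/-- The operator `γ ↦ γ - ∫₀ᵗ X(s, γ s) ds`, whose fibre over a constant `x` consists of the
integral curves of the time-dependent vector field `X` starting at `x`. -/
noncomputable def picardDefect (hX : ContDiff ℝ ∞ X) (γ : C(I, E)) : C(I, E) :=
  γ - primitiveCLM E ((⟨X, hX.continuous⟩ : C(ℝ × E, E)).comp (graphCurve γ))

theorem contDiff_picardDefect (hX : ContDiff ℝ ∞ X) : ContDiff ℝ ∞ (picardDefect hX) :=
  contDiff_id.sub ((primitiveCLM E).contDiff.comp
    ((contDiff_continuousMap_comp hX).comp contDiff_graphCurve))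

/-- The linearisation of a time-dependent vector field along a curve. -/
noncomputable def linearizationAlong (hX : ContDiff ℝ ∞ X) (γ : C(I, E)) : C(I, E →L[ℝ] E) :=
  ⟨fun t ↦ (fderiv ℝ X (t, γ t)).comp (ContinuousLinearMap.inr ℝ ℝ E), by
    have := hX.continuous_fderiv (by simp)
    fun_prop⟩

theorem hasFDerivAt_picardDefect (hX : ContDiff ℝ ∞ X) (γ : C(I, E)) :
    HasFDerivAt (picardDefect hX) (1 - volterraCLM (linearizationAlong hX γ)) γ := by
  have h1 : ContDiff ℝ 1 X := hX.of_le (by simp)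
  have := (hasFDerivAt_id γ).sub ((primitiveCLM E).hasFDerivAt.comp γ
    ((hasFDerivAt_continuousMap_comp h1 (graphCurve γ)).comp γ (hasFDerivAt_graphCurve γ)))
  refine this.congr_fderiv ?_
  rfl

theorem picardDefect_eq_const_iff [CompleteSpace E] (hX : ContDiff ℝ ∞ X) {γ : C(I, E)} {x : E} :
    picardDefect hX γ = ContinuousMap.const I x ↔ γ 0 = x ∧ ∀ t ∈ I,
      HasDerivWithinAt (extendCurve γ) (X (t, extendCurve γ t)) I t := by
  rw [picardDefect, eq_const_add_primitiveCLM_iff]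
  refine and_congr_right fun _ ↦ forall₂_congr fun t ht ↦ ?_
  rw [extendCurve_of_mem _ ht, extendCurve_of_mem _ ht]
  rfl

theorem exists_lipschitzWith_slice (hX : ContDiff ℝ ∞ X) (hs : HasCompactSupport X) :
    ∃ K, ∀ t, LipschitzWith K fun y ↦ X (t, y) := by
  obtain ⟨K, hK⟩ := hX.lipschitzWith_of_hasCompactSupport hs (by simp)
  refine ⟨K, fun t ↦ LipschitzWith.of_dist_le_mul fun y z ↦ ?_⟩
  simpa [Prod.dist_eq] using hK.dist_le_mul (t, y) (t, z)

theorem picardDefect_injective_of_const [CompleteSpace E] (hX : ContDiff ℝ ∞ X) (hs : HasCompactSupport X)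
    {γ γ' : C(I, E)} {x : E} (h : picardDefect hX γ = ContinuousMap.const I x)
    (h' : picardDefect hX γ' = ContinuousMap.const I x) : γ = γ' := by
  obtain ⟨K, hK⟩ := exists_lipschitzWith_slice hX hs
  rw [picardDefect_eq_const_iff] at h h'
  have := ODE_solution_unique_of_mem_Icc_right (v := fun t y ↦ X (t, y)) (s := fun _ ↦ univ)
    (fun t _ ↦ (hK t).lipschitzOnWith) (continuous_extendCurve γ).continuousOn
    (fun t ht ↦ (h.2 t (Ico_subset_Icc_self ht)).Ici_of_unitInterval ht) (fun _ _ ↦ mem_univ _)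
    (continuous_extendCurve γ').continuousOn
    (fun t ht ↦ (h'.2 t (Ico_subset_Icc_self ht)).Ici_of_unitInterval ht) (fun _ _ ↦ mem_univ _)
    (by rw [extendCurve_of_mem _ (left_mem_Icc.2 zero_le_one),
          extendCurve_of_mem _ (left_mem_Icc.2 zero_le_one)]
        exact h.1.trans h'.1.symm)
  ext t
  simpa only [extendCurve_of_mem _ t.2] using this t.2

theorem exists_picardDefect_eq_const [CompleteSpace E] (hX : ContDiff ℝ ∞ X) (hs : HasCompactSupport X) (x : E) :
    ∃ γ, picardDefect hX γ = ContinuousMap.const I x := by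
  obtain ⟨K, hK⟩ := exists_lipschitzWith_slice hX hs
  obtain ⟨L, hL⟩ := hs.exists_bound_of_continuous hX.continuous
  have hL0 : 0 ≤ L := (norm_nonneg _).trans (hL (0, 0))
  -- A field bounded by `L` moves a point by at most `L` in unit time, so the ball of radius `L`
  -- suffices and the solution lives on all of `[0, 1]`.
  have hPL : IsPicardLindelof (fun t y ↦ X (t, y)) (⟨0, by simp⟩ : Icc (0 : ℝ) 1) x
      ⟨L, hL0⟩ 0 ⟨L, hL0⟩ K :=
    { lipschitzOnWith := fun t _ ↦ (hK t).lipschitzOnWith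
      continuousOn := fun y _ ↦ (hX.continuous.comp (by fun_prop)).continuousOn
      norm_le := fun t _ y _ ↦ hL _
      mul_max_le := by simp }
  obtain ⟨α, hα0, hα⟩ := hPL.exists_eq_forall_mem_Icc_hasDerivWithinAt₀
  have hc : ContinuousOn α I := fun t ht ↦ (hα t ht).continuousWithinAt
  have he : ∀ t ∈ I, extendCurve (⟨domRestrict I α, hc.domRestrict⟩ : C(I, E)) t = α t := fun t ht ↦ by
    rw [extendCurve_of_mem _ ht]; rfl
  refine ⟨⟨domRestrict I α, hc.domRestrict⟩, (picardDefect_eq_const_iff hX).2 ⟨hα0, fun t ht ↦ ?_⟩⟩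
  rw [he t ht]
  exact (hα t ht).congr_of_mem he ht

/-- The integral curves on `[0, 1]` of a compactly supported time-dependent smooth vector field
depend smoothly on the initial value, and their derivatives solve the variational equation. -/
theorem exists_contDiff_integralCurves [CompleteSpace E] (hX : ContDiff ℝ ∞ X) (hs : HasCompactSupport X) :
    ∃ Γ : E → C(I, E), ContDiff ℝ ∞ Γ ∧
      (∀ x, Γ x 0 = x ∧ ∀ t ∈ I,
        HasDerivWithinAt (extendCurve (Γ x)) (X (t, extendCurve (Γ x) t)) I t) ∧
      (∀ x, (∀ t ∈ I, X (t, x) = 0) → Γ x = ContinuousMap.const I x) ∧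
      ∀ x v, fderiv ℝ Γ x v 0 = v ∧ ∀ t ∈ I,
        HasDerivWithinAt (extendCurve (fderiv ℝ Γ x v))
          (fderiv ℝ X (t, extendCurve (Γ x) t) (0, extendCurve (fderiv ℝ Γ x v) t)) I t := by
  choose Γ hΓ using exists_picardDefect_eq_const hX hs
  have hconst : ContDiff ℝ ∞ (ContinuousMap.const I : E → C(I, E)) := by
    let c : E →ₗ[ℝ] C(I, E) := ⟨⟨ContinuousMap.const I, fun _ _ ↦ rfl⟩, fun _ _ ↦ rfl⟩
    have hc : Continuous c := ContinuousMap.continuous_const'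
    exact (⟨c, hc⟩ : E →L[ℝ] C(I, E)).contDiff
  have hconst' (x v : E) : HasFDerivAt (ContinuousMap.const I : E → C(I, E))
      (⟨⟨⟨ContinuousMap.const I, fun _ _ ↦ rfl⟩, fun _ _ ↦ rfl⟩,
        ContinuousMap.continuous_const'⟩ : E →L[ℝ] C(I, E)) x := 
    ContinuousLinearMap.hasFDerivAt (⟨⟨⟨ContinuousMap.const I, fun _ _ ↦ rfl⟩, fun _ _ ↦ rfl⟩,
        ContinuousMap.continuous_const'⟩ : E →L[ℝ] C(I, E))
  have hsmooth : ContDiff ℝ ∞ Γ := by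
    refine contDiff_iff_contDiffAt.2 fun x ↦ ?_
    -- The differential of the defect is `1 - V` with `V` a Volterra operator, so the defect has a
    -- smooth local inverse. The solutions `Γ` were chosen point by point, but uniqueness identifies
    -- them near `x` with that inverse on the constant curves.
    obtain ⟨u, hu⟩ := isUnit_one_sub_volterraCLM (linearizationAlong hX (Γ x))
    have hG := (contDiff_picardDefect hX).contDiffAt (x := Γ x)
    have hG' : HasFDerivAt (picardDefect hX)
        (ContinuousLinearEquiv.unitsEquiv ℝ C(I, E) u : C(I, E) →L[ℝ] C(I, E)) (Γ x) := by
      refine (hasFDerivAt_picardDefect hX (Γ x)).congr_fderiv ?_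
      rw [← hu]; rfl
    have hinv : ContDiffAt ℝ ∞ (hG.localInverse hG' (by simp)) (ContinuousMap.const I x) := by
      have := hG.to_localInverse hG' (by simp)
      rwa [hΓ x] at this
    refine (hinv.comp x hconst.contDiffAt).congr_of_eventuallyEq ?_
    have hev : ∀ᶠ ζ in 𝓝 (ContinuousMap.const I x),
        picardDefect hX (hG.localInverse hG' (by simp) ζ) = ζ := by
      rw [← hΓ x]
      exact (hG.hasStrictFDerivAt' hG' (by simp)).eventually_right_inverse
    filter_upwards [hconst.continuous.continuousAt.eventually hev] with y hy
    exact picardDefect_injective_of_const hX hs (hΓ y) hy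
  refine ⟨Γ, hsmooth, fun x ↦ (picardDefect_eq_const_iff hX).1 (hΓ x), fun x hx ↦ ?_,
    fun x v ↦ ?_⟩
  · refine picardDefect_injective_of_const hX hs (hΓ x)
      ((picardDefect_eq_const_iff hX).2 ⟨rfl, fun t ht ↦ ?_⟩)
    rw [extendCurve_of_mem _ ht, ContinuousMap.const_apply, hx t ht]
    exact hasDerivWithinAt_const _ _ _
  · have h1 := (hasFDerivAt_picardDefect hX (Γ x)).comp x
      (hsmooth.differentiable (by simp) x).hasFDerivAt
    have h2 : picardDefect hX ∘ Γ = ContinuousMap.const I := funext hΓ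
    rw [h2] at h1
    have h3 := DFunLike.congr_fun (h1.unique (hconst' x v)) v
    change fderiv ℝ Γ x v - primitiveCLM E (ContinuousMap.pointwiseApplyCLM I E E
      (linearizationAlong hX (Γ x)) (fderiv ℝ Γ x v)) = ContinuousMap.const I v at h3
    obtain ⟨h4, h5⟩ := eq_const_add_primitiveCLM_iff.1 h3
    refine ⟨h4, fun t ht ↦ ?_⟩
    have := h5 t ht
    rw [extendCurve_of_mem _ ht] at this ⊢
    simpa [linearizationAlong, extendCurve_of_mem _ ht] using this

end Flow

/-! ### Cut-off functions. -/

theorem exists_contDiff_bump {V : Type*} [NormedAddCommGroup V] [NormedSpace ℝ V]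
    [FiniteDimensional ℝ V] {K O : Set V} (hK : IsCompact K) (hO : IsOpen O) (hKO : K ⊆ O) :
    ∃ η : V → ℝ, ContDiff ℝ ∞ η ∧ HasCompactSupport η ∧ (∀ x ∈ K, ∀ᶠ y in 𝓝 x, η y = 1) ∧
      (∀ x ∉ O, ∀ᶠ y in 𝓝 x, η y = 0) ∧ ∀ x, η x ∈ Icc 0 1 := by
  have : ProperSpace V := FiniteDimensional.proper ℝ V
  obtain ⟨L, hL, hKL, hLO⟩ := exists_compact_between hK hO hKO
  obtain ⟨f, h0, h1, h01⟩ := exists_contMDiffMap_zero_one_nhds_of_isClosed 𝓘(ℝ, V) (n := ⊤)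
    (isOpen_interior (s := L)).isClosed_compl hK.isClosed
    (disjoint_left.2 fun x hx hxK ↦ hx (hKL hxK))
  rw [eventually_nhdsSet_iff_forall] at h0 h1
  refine ⟨f, f.contMDiff.contDiff, HasCompactSupport.intro hL fun x hx ↦ ?_, h1, fun x hx ↦ ?_, h01⟩
  · exact (h0 x fun h ↦ hx (interior_subset h)).self_of_nhds
  · exact h0 x fun h ↦ hx (hLO (interior_subset h))

theorem contDiff_smul_of_contDiffAt {V W : Type*} [NormedAddCommGroup V] [NormedSpace ℝ V]
    [NormedAddCommGroup W] [NormedSpace ℝ W] {O : Set V} {η : V → ℝ} {g : V → W}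
    (hη : ContDiff ℝ ∞ η) (h0 : ∀ x ∉ O, ∀ᶠ y in 𝓝 x, η y = 0)
    (hg : ∀ x ∈ O, ContDiffAt ℝ ∞ g x) : ContDiff ℝ ∞ fun x ↦ η x • g x := by
  refine contDiff_iff_contDiffAt.2 fun x ↦ ?_
  by_cases hx : x ∈ O
  · exact hη.contDiffAt.smul (hg x hx)
  · refine (contDiffAt_const (c := (0 : W))).congr_of_eventuallyEq ?_
    filter_upwards [h0 x hx] with y hy
    rw [hy, zero_smul]

/-! ### Transport of kernels along a flow. -/

section TransportOfKernels

open unitInterval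

variable {E : Type*} [NormedAddCommGroup E] [NormedSpace ℝ E]

/-- Uniqueness, forwards and backwards in time, by comparison with the zero solution. It is used for
the kernels and also for the injectivity of the linearised flow. -/
theorem eq_zero_iff_of_hasDerivWithinAt_linear {A : ℝ → E →L[ℝ] E} {K : ℝ}
    (hA : ∀ t ∈ I, ‖A t‖ ≤ K) {m : ℝ → E} (hm : ∀ t ∈ I, HasDerivWithinAt m (A t (m t)) I t) :
    m 1 = 0 ↔ m 0 = 0 := by
  have hK : 0 ≤ K := (norm_nonneg _).trans (hA 0 (by simp))
  have hL : ∀ t ∈ I, LipschitzOnWith ⟨K, hK⟩ (fun y ↦ A t y) univ := fun t ht ↦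
    ((A t).lipschitz.weaken (by exact_mod_cast hA t ht)).lipschitzOnWith
  have hc : ContinuousOn m I := fun t ht ↦ (hm t ht).continuousWithinAt
  constructor
  · intro h
    exact ODE_solution_unique_of_mem_Icc_left (v := fun t y ↦ A t y) (s := fun _ ↦ univ)
      (g := fun _ ↦ 0) (fun t ht ↦ hL t (Ioc_subset_Icc_self ht)) hc
      (fun t ht ↦ (hm t (Ioc_subset_Icc_self ht)).Iic_of_unitInterval ht) (fun _ _ ↦ mem_univ _)
      continuousOn_const (fun t _ ↦ by simpa using hasDerivWithinAt_const t _ (0 : E))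
      (fun _ _ ↦ mem_univ _) h (left_mem_Icc.2 zero_le_one)
  · intro h
    exact ODE_solution_unique_of_mem_Icc_right (v := fun t y ↦ A t y) (s := fun _ ↦ univ)
      (g := fun _ ↦ 0) (fun t ht ↦ hL t (Ico_subset_Icc_self ht)) hc
      (fun t ht ↦ (hm t (Ico_subset_Icc_self ht)).Ici_of_unitInterval ht) (fun _ _ ↦ mem_univ _)
      continuousOn_const (fun t _ ↦ by simpa using hasDerivWithinAt_const t _ (0 : E))
      (fun _ _ ↦ mem_univ _) h (right_mem_Icc.2 zero_le_one)

/-- If a time-dependent 1-form `a` satisfies `∂ₜ a + i_X da = μ a` and `a(X) = 0` along an integral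
curve `γ` of `X`, then the linearised flow of `X` along `γ` preserves the kernels of `a`. -/
theorem oneForm_transport_eq_zero_iff {a : ℝ × E → E →L[ℝ] ℝ} {X : ℝ × E → E} {γ J : ℝ → E}
    {μ : ℝ → ℝ} {K : ℝ}
    (hγ : ∀ t ∈ I, HasDerivWithinAt γ (X (t, γ t)) I t)
    (hJ : ∀ t ∈ I, HasDerivWithinAt J (fderiv ℝ X (t, γ t) (0, J t)) I t)
    (ha : ∀ t ∈ I, DifferentiableAt ℝ a (t, γ t)) (hX : ∀ t ∈ I, DifferentiableAt ℝ X (t, γ t))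
    (haX : ∀ t ∈ I, ∀ᶠ p in 𝓝 (t, γ t), a p (X p) = 0)
    (hμ : ∀ t ∈ I, |μ t| ≤ K)
    (h : ∀ t ∈ I, ∀ v, fderiv ℝ a (t, γ t) (1, 0) v + fderiv ℝ a (t, γ t) (0, X (t, γ t)) v
      - fderiv ℝ a (t, γ t) (0, v) (X (t, γ t)) = μ t * a (t, γ t) v) :
    a (1, γ 1) (J 1) = 0 ↔ a (0, γ 0) (J 0) = 0 := by
  refine eq_zero_iff_of_hasDerivWithinAt_linear (m := fun t ↦ a (t, γ t) (J t))
    (A := fun t ↦ ContinuousLinearMap.toSpanSingleton ℝ (μ t)) (K := K)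
    (fun t ht ↦ by simpa using hμ t ht) (fun t ht ↦ ?_)
  have h1 : HasDerivWithinAt (fun t ↦ (t, γ t)) ((1 : ℝ), X (t, γ t)) I t :=
    (hasDerivWithinAt_id t _).prodMk (hγ t ht)
  have h2 := (ha t ht).hasFDerivAt.comp_hasDerivWithinAt t h1
  have h3 := h2.clm_apply (hJ t ht)
  refine h3.congr_deriv ?_
  -- Differentiating `a(X) = 0` in the direction `J` replaces `a(DX J)` by `-(D_J a)(X)`. The
  -- derivative of `a(J)` then becomes the left-hand side of `h`, hence `μ a(J)`.
  have h4 := (ha t ht).hasFDerivAt.clm_apply (hX t ht).hasFDerivAt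
  have h5 := h4.unique ((hasFDerivAt_const (0 : ℝ) _).congr_of_eventuallyEq (haX t ht))
  have h6 := DFunLike.congr_fun h5 (0, J t)
  simp only [add_apply, ContinuousLinearMap.comp_apply,
    ContinuousLinearMap.flip_apply, zero_apply] at h6
  have h7 := h t ht (J t)
  have h8 : fderiv ℝ a (t, γ t) (1, X (t, γ t)) = fderiv ℝ a (t, γ t) (1, 0)
      + fderiv ℝ a (t, γ t) (0, X (t, γ t)) := by rw [← map_add]; simp
  simp only [Function.comp, h8, add_apply,
    ContinuousLinearMap.toSpanSingleton_apply, smul_eq_mul]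
  linarith

end TransportOfKernels

/-! ### Linear algebra of contact forms on `ℝ³`. -/

section ContactAlgebra

/-- The standard basis vectors of `ℝ³`. -/
noncomputable def stdVec (i : Fin 3) : 𝔼 := EuclideanSpace.single i 1

@[simp]
theorem stdVec_apply (i j : Fin 3) : stdVec i j = if j = i then 1 else 0 := by
  simp [stdVec]

theorem eq_sum_stdVec (v : 𝔼) : v = v 0 • stdVec 0 + v 1 • stdVec 1 + v 2 • stdVec 2 := by
  ext i; fin_cases i <;> simp

theorem map_eq_sum_stdVec {F : Type*} [AddCommGroup F] [Module ℝ F] [TopologicalSpace F]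
    (L : 𝔼 →L[ℝ] F) (v : 𝔼) :
    L v = v 0 • L (stdVec 0) + v 1 • L (stdVec 1) + v 2 • L (stdVec 2) := by
  conv_lhs => rw [eq_sum_stdVec v]
  simp only [map_add, map_smul]

/-- The coefficient of `α ∧ d` with respect to the standard volume form of `ℝ³`, where `d` is the
alternating form `(v, w) ↦ D v w - D w v`. -/
noncomputable def contactCoeff (α : 𝔼 →L[ℝ] ℝ) (D : 𝔼 →L[ℝ] 𝔼 →L[ℝ] ℝ) : ℝ :=
  α (stdVec 0) * (D (stdVec 1) (stdVec 2) - D (stdVec 2) (stdVec 1))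
    + α (stdVec 1) * (D (stdVec 2) (stdVec 0) - D (stdVec 0) (stdVec 2))
    + α (stdVec 2) * (D (stdVec 0) (stdVec 1) - D (stdVec 1) (stdVec 0))

/-- The vector representing the wedge product of two linear forms on `ℝ³`. -/
noncomputable def crossForm (α β : 𝔼 →L[ℝ] ℝ) : 𝔼 :=
  !₂[α (stdVec 1) * β (stdVec 2) - α (stdVec 2) * β (stdVec 1),
    α (stdVec 2) * β (stdVec 0) - α (stdVec 0) * β (stdVec 2),
    α (stdVec 0) * β (stdVec 1) - α (stdVec 1) * β (stdVec 0)]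

@[simp] theorem crossForm_apply_zero (α β : 𝔼 →L[ℝ] ℝ) : crossForm α β 0 =
    α (stdVec 1) * β (stdVec 2) - α (stdVec 2) * β (stdVec 1) := rfl
@[simp] theorem crossForm_apply_one (α β : 𝔼 →L[ℝ] ℝ) : crossForm α β 1 =
    α (stdVec 2) * β (stdVec 0) - α (stdVec 0) * β (stdVec 2) := rfl
@[simp] theorem crossForm_apply_two (α β : 𝔼 →L[ℝ] ℝ) : crossForm α β 2 =
    α (stdVec 0) * β (stdVec 1) - α (stdVec 1) * β (stdVec 0) := rfl

theorem crossForm_smul_self (α : 𝔼 →L[ℝ] ℝ) (k : ℝ) : crossForm α (k • α) = 0 := by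
  ext i; fin_cases i <;> simp <;> ring

theorem apply_crossForm (α β : 𝔼 →L[ℝ] ℝ) (t k : ℝ) : (α + t • β) (k • crossForm α β) = 0 := by
  rw [map_smul, map_eq_sum_stdVec]
  simp
  right; ring

theorem contDiff_contactCoeff :
    ContDiff ℝ ∞ fun p : (𝔼 →L[ℝ] ℝ) × (𝔼 →L[ℝ] 𝔼 →L[ℝ] ℝ) ↦ contactCoeff p.1 p.2 := by
  unfold contactCoeff
  fun_prop

theorem contDiff_crossForm :
    ContDiff ℝ ∞ fun p : (𝔼 →L[ℝ] ℝ) × (𝔼 →L[ℝ] ℝ) ↦ crossForm p.1 p.2 := by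
  rw [contDiff_euclidean]
  intro i
  fin_cases i <;> simp <;> fun_prop

/-- The coefficient `μ` of Gray's equation `c + i_X da = μ a`. -/
noncomputable def grayCoeff (α c : 𝔼 →L[ℝ] ℝ) (D : 𝔼 →L[ℝ] 𝔼 →L[ℝ] ℝ) : ℝ :=
  contactCoeff c D / contactCoeff α D

/-- Write `d` for the alternation of `D` and `α_t = α + t c`. The 4-form `α_t ∧ c ∧ d` vanishes on
`ℝ³`; contracting it with `v` gives the equation multiplied by the contact coefficient. Since `α_t ∧
c = α ∧ c`, the cross product does not depend on `t`. -/
theorem gray_equation {α c : 𝔼 →L[ℝ] ℝ} {D : 𝔼 →L[ℝ] 𝔼 →L[ℝ] ℝ} {t : ℝ}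
    (h : contactCoeff (α + t • c) D ≠ 0) (v : 𝔼) :
    c v + D ((contactCoeff (α + t • c) D)⁻¹ • crossForm α c) v
      - D v ((contactCoeff (α + t • c) D)⁻¹ • crossForm α c)
      = grayCoeff (α + t • c) c D * (α + t • c) v := by
  set W := contactCoeff (α + t • c) D with hW
  suffices W * c v + D (crossForm α c) v - D v (crossForm α c)
      = contactCoeff c D * (α + t • c) v by
    rw [grayCoeff, ← hW, div_mul_eq_mul_div, eq_div_iff h, ← this]
    simp only [map_smul, smul_apply, smul_eq_mul]
    field_simp
  rw [map_eq_sum_stdVec c v, map_eq_sum_stdVec (α + t • c) v, map_eq_sum_stdVec D (crossForm α c),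
    map_eq_sum_stdVec (D v) (crossForm α c), map_eq_sum_stdVec D v, hW]
  simp only [add_apply, smul_apply, map_eq_sum_stdVec (D (stdVec 0)) v,
    map_eq_sum_stdVec (D (stdVec 1)) v, map_eq_sum_stdVec (D (stdVec 2)) v, contactCoeff,
    crossForm_apply_zero, crossForm_apply_one, crossForm_apply_two, smul_eq_mul]
  ring

end ContactAlgebra

/-! ### Gray stability. -/

section Gray

open unitInterval

/-- **Gray stability** for the linear path `a + t c` of contact forms near a compact set on which
the Gray vector field vanishes. -/
theorem exists_gray_isotopy {N Z : Set 𝔼} (hN : IsOpen N) (hZ : IsCompact Z) (hZN : Z ⊆ N)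
    {a c : 𝔼 → 𝔼 →L[ℝ] ℝ} (ha : ContDiffOn ℝ ∞ a N) (hc : ContDiffOn ℝ ∞ c N)
    (hY : ∀ y ∈ Z, crossForm (a y) (c y) = 0)
    (hW : ∀ y ∈ Z, ∀ t ∈ I, contactCoeff (a y + t • c y) (fderiv ℝ a y + t • fderiv ℝ c y) ≠ 0) :
    ∃ Φ : 𝔼 → 𝔼, ContDiff ℝ ∞ Φ ∧ (∀ x, Function.Injective (fderiv ℝ Φ x)) ∧
      (∀ x, crossForm (a x) (c x) = 0 → Φ x = x) ∧
      ∀ y ∈ Z, ∀ᶠ x in 𝓝 y, ∀ v,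
        a x v = 0 ↔ (a (Φ x) + c (Φ x)) (fderiv ℝ Φ x v) = 0 := by
  have haN {x} (hx : x ∈ N) : ContDiffAt ℝ ∞ a x := ha.contDiffAt (hN.mem_nhds hx)
  have hcN {x} (hx : x ∈ N) : ContDiffAt ℝ ∞ c x := hc.contDiffAt (hN.mem_nhds hx)
  set α : ℝ × 𝔼 → 𝔼 →L[ℝ] ℝ := fun p ↦ a p.2 + p.1 • c p.2 with hα
  set D : ℝ × 𝔼 → 𝔼 →L[ℝ] 𝔼 →L[ℝ] ℝ := fun p ↦ fderiv ℝ a p.2 + p.1 • fderiv ℝ c p.2 with hD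
  have hαs {p : ℝ × 𝔼} (hp : p.2 ∈ N) : ContDiffAt ℝ ∞ α p :=
    ((haN hp).comp p contDiffAt_snd).add
      (contDiffAt_fst.smul ((hcN hp).comp p contDiffAt_snd))
  have hDs {p : ℝ × 𝔼} (hp : p.2 ∈ N) : ContDiffAt ℝ ∞ D p :=
    (((haN hp).fderiv_right (by simp)).comp p contDiffAt_snd).add
      (contDiffAt_fst.smul (((hcN hp).fderiv_right (by simp)).comp p contDiffAt_snd))
  set w : ℝ × 𝔼 → ℝ := fun p ↦ contactCoeff (α p) (D p) with hw
  have hws {p : ℝ × 𝔼} (hp : p.2 ∈ N) : ContDiffAt ℝ ∞ w p :=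
    contDiff_contactCoeff.contDiffAt.comp p ((hαs hp).prodMk (hDs hp))
  set O : Set (ℝ × 𝔼) := {p | p.2 ∈ N ∧ w p ≠ 0} with hO
  have hOo : IsOpen O := by
    refine isOpen_iff_mem_nhds.2 fun p hp ↦ ?_
    filter_upwards [(hN.preimage continuous_snd).mem_nhds hp.1,
      (hws hp.1).continuousAt.eventually_ne hp.2] with q h1 h2 using ⟨h1, h2⟩
  -- The cut-off makes the Gray field globally smooth with compact support, without changing it near
  -- `[0, 1] × Z`.
  obtain ⟨η, hη, hηc, hη1, hη0, -⟩ := exists_contDiff_bump ((isCompact_Icc (a := (0 : ℝ))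
    (b := 1)).prod hZ) hOo (fun p hp ↦ ⟨hZN hp.2, hW p.2 hp.2 p.1 hp.1⟩)
  set Y : ℝ × 𝔼 → 𝔼 := fun p ↦ (w p)⁻¹ • crossForm (a p.2) (c p.2) with hYdef
  set X : ℝ × 𝔼 → 𝔼 := fun p ↦ η p • Y p with hXdef
  have hX : ContDiff ℝ ∞ X := contDiff_smul_of_contDiffAt hη hη0 fun p hp ↦
    ((hws hp.1).inv hp.2).smul (contDiff_crossForm.contDiffAt.comp p
      (((haN hp.1).comp p contDiffAt_snd).prodMk ((hcN hp.1).comp p contDiffAt_snd)))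
  have hXc : HasCompactSupport X := hηc.smul_right
  obtain ⟨Γ, hΓ, hΓ1, hΓ0, hΓ'⟩ := exists_contDiff_integralCurves hX hXc
  have h1I : (1 : ℝ) ∈ I := right_mem_Icc.2 zero_le_one
  have h0I : (0 : ℝ) ∈ I := left_mem_Icc.2 zero_le_one
  let ev : C(I, 𝔼) →L[ℝ] 𝔼 := ContinuousMap.evalCLM ℝ (1 : I)
  have hΦ' (x v : 𝔼) : fderiv ℝ (fun x ↦ Γ x 1) x v = fderiv ℝ Γ x v 1 := by
    have := ev.hasFDerivAt.comp x (hΓ.differentiable (by simp) x).hasFDerivAt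
    exact DFunLike.congr_fun (HasFDerivAt.fderiv this) v
  have he0 (γ : C(I, 𝔼)) : extendCurve γ 0 = γ 0 := extendCurve_of_mem γ h0I
  have he1 (γ : C(I, 𝔼)) : extendCurve γ 1 = γ 1 := extendCurve_of_mem γ h1I
  have hfix (x : 𝔼) (hx : crossForm (a x) (c x) = 0) : Γ x = ContinuousMap.const I x :=
    hΓ0 x fun t _ ↦ by simp [hXdef, hYdef, hx]
  obtain ⟨K, hK⟩ := (hX.continuous_fderiv (by simp)).norm.bddAbove_range_of_hasCompactSupport
    (hXc.fderiv ℝ).norm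
  refine ⟨fun x ↦ Γ x 1, ev.contDiff.comp hΓ, fun x ↦ ?_, fun x hx ↦ by simp [hfix x hx],
    fun y hy ↦ ?_⟩
  -- A solution of the variational equation that vanishes at time `1` vanishes at time `0`.
  · refine (injective_iff_map_eq_zero _).2 fun v hv ↦ ?_
    rw [hΦ', ← he1] at hv
    rw [← (hΓ' x v).1, ← he0]
    refine (eq_zero_iff_of_hasDerivWithinAt_linear (K := K)
      (A := fun t ↦ (fderiv ℝ X (t, extendCurve (Γ x) t)).comp (ContinuousLinearMap.inr ℝ ℝ 𝔼))
      (fun t _ ↦ ?_) fun t ht ↦ by simpa using (hΓ' x v).2 t ht).1 hv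
    refine (ContinuousLinearMap.opNorm_comp_le _ _).trans ?_
    refine (mul_le_of_le_one_right (norm_nonneg _) (ContinuousLinearMap.norm_inr_le_one ℝ ℝ 𝔼)).trans
      (hK (mem_range_self _))
  -- The integral curve through a point of `Z` is constant. By continuity of `Γ` in the sup norm,
  -- curves starting nearby stay where `η = 1` during the whole interval.
  · have hR : ∀ᶠ z in 𝓝 y, ∀ t ∈ I, ∀ᶠ p in 𝓝 (t, z), η p = 1 := by
      refine isCompact_Icc.eventually_forall_of_forall_eventually fun t ht ↦ ?_
      have := (hη1 (t, y) ⟨ht, hy⟩).eventually_nhds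
      have hsw : Filter.Tendsto (fun q : 𝔼 × ℝ ↦ (q.2, q.1)) (𝓝 (y, t)) (𝓝 (t, y)) :=
        (continuous_snd.prodMk continuous_fst).tendsto' _ _ rfl
      exact hsw.eventually this
    obtain ⟨δ, hδ, hball⟩ := Metric.eventually_nhds_iff_ball.1 hR
    filter_upwards [hΓ.continuous.continuousAt (Metric.ball_mem_nhds (Γ y) hδ)] with x hx v
    have hγ (t : ℝ) (ht : t ∈ I) : ∀ᶠ p in 𝓝 (t, extendCurve (Γ x) t), η p = 1 := by
      refine hball _ ?_ t ht
      rw [mem_preimage, mem_ball_iff_norm] at hx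
      rw [mem_ball_iff_norm]
      refine lt_of_le_of_lt ?_ hx
      have := (Γ x - Γ y).norm_coe_le_norm ⟨t, ht⟩
      rw [extendCurve_of_mem _ ht]
      simpa [hfix y (hY y hy)] using this
    have hγO (t : ℝ) (ht : t ∈ I) : (t, extendCurve (Γ x) t) ∈ O := by
      by_contra hcon
      have := ((hγ t ht).and (hη0 _ hcon)).self_of_nhds
      exact one_ne_zero (this.1.symm.trans this.2)
    have hαd (t : ℝ) (ht : t ∈ I) (s : ℝ) (u v : 𝔼) :
        fderiv ℝ α (t, extendCurve (Γ x) t) (s, u) v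
          = s * c (extendCurve (Γ x) t) v + D (t, extendCurve (Γ x) t) u v := by
      set z := extendCurve (Γ x) t
      have hz : z ∈ N := (hγO t ht).1
      have ha' : HasFDerivAt (fun p : ℝ × 𝔼 ↦ a p.2) _ (t, z) :=
        ((haN hz).differentiableAt (by simp)).hasFDerivAt.comp (t, z) hasFDerivAt_snd
      have hc' : HasFDerivAt (fun p : ℝ × 𝔼 ↦ c p.2) _ (t, z) :=
        ((hcN hz).differentiableAt (by simp)).hasFDerivAt.comp (t, z) hasFDerivAt_snd
      have := ha'.add ((hasFDerivAt_fst (p := (t, z))).smul hc')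
      have h2 := HasFDerivAt.fderiv this
      change fderiv ℝ α (t, z) = _ at h2
      rw [h2]
      simp [hD]
      ring
    have hcont : ContinuousOn (fun t ↦ grayCoeff (α (t, extendCurve (Γ x) t))
        (c (extendCurve (Γ x) t)) (D (t, extendCurve (Γ x) t))) I := by
      intro t ht
      have hcv : ContinuousAt (fun t ↦ (t, extendCurve (Γ x) t)) t := by fun_prop
      have h1 : ContinuousAt (fun p : ℝ × 𝔼 ↦ contactCoeff (c p.2) (D p))
          (t, extendCurve (Γ x) t) :=
        (contDiff_contactCoeff.contDiffAt.comp _ (((hcN (hγO t ht).1).comp (t, extendCurve (Γ x) t)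
          contDiffAt_snd).prodMk (hDs (hγO t ht).1))).continuousAt
      have h2 := (hws (hγO t ht).1).continuousAt
      exact ((h1.div h2 (hγO t ht).2).comp
        (f := fun t ↦ (t, extendCurve (Γ x) t)) hcv).continuousWithinAt
    obtain ⟨B, hB⟩ := isCompact_Icc.exists_bound_of_continuousOn hcont
    have key := oneForm_transport_eq_zero_iff (a := α) (X := X) (γ := extendCurve (Γ x))
      (J := extendCurve (fderiv ℝ Γ x v)) (K := B) (μ := fun t ↦ grayCoeff
        (α (t, extendCurve (Γ x) t)) (c (extendCurve (Γ x) t)) (D (t, extendCurve (Γ x) t)))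
      (hΓ1 x).2 (hΓ' x v).2 (fun t ht ↦ (hαs (hγO t ht).1).differentiableAt (by simp))
      (fun t _ ↦ hX.differentiable (by simp) _)
      (fun t ht ↦ Filter.Eventually.of_forall fun p ↦ by
        simp only [hXdef, hYdef, smul_smul, hα]; exact apply_crossForm _ _ _ _)
      hB (fun t ht u ↦ ?_)
    · rw [he1, he0, he1, he0, (hΓ' x v).1, (hΓ1 x).1] at key
      rw [hΦ']
      simpa [hα] using key.symm
    · have hX1 : X (t, extendCurve (Γ x) t) = Y (t, extendCurve (Γ x) t) := by
        simp [hXdef, (hγ t ht).self_of_nhds]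
      rw [hαd t ht, hαd t ht, hαd t ht, hX1]
      have := gray_equation (hγO t ht).2 u
      simp only [hYdef] at this ⊢
      simp only [one_mul, zero_mul, zero_add, map_zero, zero_apply, add_zero]
      exact this

end Gray

/-! ### The function `A ∧ dA / vol` under pull-back and rescaling. -/

section ContactFunction

/-- The coefficient of `A ∧ dA` with respect to the standard volume form of `ℝ³`. -/
noncomputable def contactFn (A : 𝔼 → 𝔼 →L[ℝ] ℝ) (y : 𝔼) : ℝ := contactCoeff (A y) (fderiv ℝ A y)

/-- The pull-back of a 1-form on `ℝ³`. -/
noncomputable def pullbackForm (Ψ : 𝔼 → 𝔼) (A : 𝔼 → 𝔼 →L[ℝ] ℝ) (x : 𝔼) : 𝔼 →L[ℝ] ℝ :=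
  (A (Ψ x)).comp (fderiv ℝ Ψ x)

@[simp]
theorem pullbackForm_apply (Ψ : 𝔼 → 𝔼) (A : 𝔼 → 𝔼 →L[ℝ] ℝ) (x v : 𝔼) :
    pullbackForm Ψ A x v = A (Ψ x) (fderiv ℝ Ψ x v) := rfl

theorem ContDiffAt.pullbackForm {Ψ : 𝔼 → 𝔼} {A : 𝔼 → 𝔼 →L[ℝ] ℝ} {x : 𝔼}
    (hΨ : ContDiffAt ℝ ∞ Ψ x) (hA : ContDiffAt ℝ ∞ A (Ψ x)) :
    ContDiffAt ℝ ∞ (pullbackForm Ψ A) x :=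
  (hA.comp x hΨ).clm_comp (hΨ.fderiv_right (by simp))

/-- The exterior derivative commutes with pull-back: the term with the second derivative of `Ψ` is
symmetric and cancels. -/
theorem fderiv_pullbackForm_sub_swap {Ψ : 𝔼 → 𝔼} {A : 𝔼 → 𝔼 →L[ℝ] ℝ} {x : 𝔼}
    (hΨ : ContDiffAt ℝ ∞ Ψ x) (hA : DifferentiableAt ℝ A (Ψ x)) (u v : 𝔼) :
    fderiv ℝ (pullbackForm Ψ A) x u v - fderiv ℝ (pullbackForm Ψ A) x v u
      = fderiv ℝ A (Ψ x) (fderiv ℝ Ψ x u) (fderiv ℝ Ψ x v)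
        - fderiv ℝ A (Ψ x) (fderiv ℝ Ψ x v) (fderiv ℝ Ψ x u) := by
  have h1 := hA.hasFDerivAt.comp x (hΨ.differentiableAt (by simp)).hasFDerivAt
  have h2 : DifferentiableAt ℝ (fderiv ℝ Ψ) x :=
    (hΨ.fderiv_right (m := 1) (by norm_cast)).differentiableAt (by simp)
  have h3 (u v : 𝔼) : fderiv ℝ (pullbackForm Ψ A) x u v
      = fderiv ℝ A (Ψ x) (fderiv ℝ Ψ x u) (fderiv ℝ Ψ x v)
        + A (Ψ x) (fderiv ℝ (fderiv ℝ Ψ) x u v) := by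
    have := (h1.clm_comp h2.hasFDerivAt).fderiv
    change fderiv ℝ (pullbackForm Ψ A) x = _ at this
    rw [this]
    simp [add_comm]
  have hs : fderiv ℝ (fderiv ℝ Ψ) x u v = fderiv ℝ (fderiv ℝ Ψ) x v u :=
    hΨ.isSymmSndFDerivAt (by simp only [minSmoothness_of_isRCLikeNormedField]; exact WithTop.coe_le_coe.2 (le_top : (2 : ℕ∞) ≤ ⊤)) u v
  rw [h3, h3, hs]
  ring

/-- The general factor is the Jacobian determinant; with the first two basis vectors fixed, only its
last diagonal entry remains. -/
theorem contactFn_pullbackForm {Ψ : 𝔼 → 𝔼} {A : 𝔼 → 𝔼 →L[ℝ] ℝ} {x : 𝔼}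
    (hΨ : ContDiffAt ℝ ∞ Ψ x) (hA : DifferentiableAt ℝ A (Ψ x))
    (h0 : fderiv ℝ Ψ x (stdVec 0) = stdVec 0) (h1 : fderiv ℝ Ψ x (stdVec 1) = stdVec 1) :
    contactFn (pullbackForm Ψ A) x = fderiv ℝ Ψ x (stdVec 2) 2 * contactFn A (Ψ x) := by
  unfold contactFn contactCoeff
  rw [fderiv_pullbackForm_sub_swap hΨ hA, fderiv_pullbackForm_sub_swap hΨ hA,
    fderiv_pullbackForm_sub_swap hΨ hA]
  simp only [pullbackForm_apply, h0, h1]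
  set v := fderiv ℝ Ψ x (stdVec 2)
  rw [map_eq_sum_stdVec (A (Ψ x)) v, map_eq_sum_stdVec (fderiv ℝ A (Ψ x)) v]
  simp only [add_apply, smul_apply, map_eq_sum_stdVec (fderiv ℝ A (Ψ x) (stdVec 0)) v,
    map_eq_sum_stdVec (fderiv ℝ A (Ψ x) (stdVec 1)) v, smul_eq_mul]
  ring

/-- The term with `dh` dies because `A ∧ A = 0`. The factor is a square, so rescaling by a function
of either sign preserves positivity. -/
theorem contactFn_smul {A : 𝔼 → 𝔼 →L[ℝ] ℝ} {h : 𝔼 → ℝ} {x : 𝔼} (hA : DifferentiableAt ℝ A x)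
    (hh : DifferentiableAt ℝ h x) : contactFn (fun y ↦ h y • A y) x = h x ^ 2 * contactFn A x := by
  unfold contactFn contactCoeff
  rw [fderiv_fun_smul hh hA]
  simp
  ring

theorem contactFn_congr {A A' : 𝔼 → 𝔼 →L[ℝ] ℝ} {x : 𝔼} (h : A =ᶠ[𝓝 x] A') :
    contactFn A x = contactFn A' x := by
  rw [contactFn, contactFn, h.fderiv_eq, h.self_of_nhds]

theorem crossForm_eq_zero_of_ker {α β : 𝔼 →L[ℝ] ℝ} (h : ∀ v, α v = 0 → β v = 0) :
    crossForm α β = 0 := by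
  have key (i j : Fin 3) : α (stdVec i) * β (stdVec j) = α (stdVec j) * β (stdVec i) := by
    have := h (α (stdVec i) • stdVec j - α (stdVec j) • stdVec i) (by simp [mul_comm])
    simpa [sub_eq_zero] using this
  ext i
  fin_cases i <;> simp [key 1 2, key 2 0, key 0 1]

theorem crossForm_sub_self (α β : 𝔼 →L[ℝ] ℝ) : crossForm α (β - α) = crossForm α β := by
  ext i
  fin_cases i <;> simp <;> ring

theorem mul_eq_mul_of_crossForm_eq_zero {α β : 𝔼 →L[ℝ] ℝ} (h : crossForm α β = 0) (i j : Fin 3) :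
    α (stdVec i) * β (stdVec j) = α (stdVec j) * β (stdVec i) := by
  have h0 : crossForm α β 0 = 0 := by rw [h]; rfl
  have h1 : crossForm α β 1 = 0 := by rw [h]; rfl
  have h2 : crossForm α β 2 = 0 := by rw [h]; rfl
  rw [crossForm_apply_zero] at h0
  rw [crossForm_apply_one] at h1
  rw [crossForm_apply_two] at h2
  fin_cases i <;> fin_cases j <;> simp only [Fin.zero_eta, Fin.mk_one, Fin.reduceFinMk] <;> linarith

theorem ext_stdVec {F : Type*} [AddCommGroup F] [Module ℝ F] [TopologicalSpace F]
    {L L' : 𝔼 →L[ℝ] F} (h : ∀ i, L (stdVec i) = L' (stdVec i)) : L = L' := by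
  ext1 v
  rw [map_eq_sum_stdVec L, map_eq_sum_stdVec L', h, h, h]

theorem fderiv_apply_eq_of_eq_on_plane {F : Type*} [NormedAddCommGroup F] [NormedSpace ℝ F]
    {f g : 𝔼 → F} {y v : 𝔼} (hf : DifferentiableAt ℝ f y) (hg : DifferentiableAt ℝ g y)
    (hy : y 2 = 0) (h : ∀ᶠ x in 𝓝 y, x 2 = 0 → f x = g x) (hv : v 2 = 0) :
    fderiv ℝ f y v = fderiv ℝ g y v := by
  have hline : HasDerivAt (fun t : ℝ ↦ y + t • v) v 0 := by
    simpa using ((hasDerivAt_id (0 : ℝ)).smul_const v).const_add y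
  have hy0 : y + (0 : ℝ) • v = y := by simp
  have hf' := (hy0.symm ▸ hf.hasFDerivAt : HasFDerivAt f (fderiv ℝ f y) (y + (0 : ℝ) • v)
    ).comp_hasDerivAt 0 hline
  have hg' := (hy0.symm ▸ hg.hasFDerivAt : HasFDerivAt g (fderiv ℝ g y) (y + (0 : ℝ) • v)
    ).comp_hasDerivAt 0 hline
  refine hf'.unique (hg'.congr_of_eventuallyEq ?_)
  have ht : Filter.Tendsto (fun t : ℝ ↦ y + t • v) (𝓝 0) (𝓝 y) :=
    Continuous.tendsto' (by fun_prop) _ _ hy0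
  filter_upwards [ht.eventually h] with t ht'
  exact ht' (by simp [hy, hv])

theorem stdVec_eq_zero_or {i : Fin 3} (hi : i ≠ 2) : stdVec i 2 = 0 := by
  simp [hi.symm]

end ContactFunction

/-! ### Rigidity of the 1-jet of a contactomorphism germ fixing a plane. -/

section ContactGerm

/-- Near `y`, the map `ψ` is a local diffeomorphism of `ℝ³` which maps the kernels of `a` to the
kernels of `b` and fixes the plane `x₂ = 0` pointwise. -/
def IsContactGerm (a b : 𝔼 → 𝔼 →L[ℝ] ℝ) (ψ : 𝔼 → 𝔼) (y : 𝔼) : Prop :=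
  ∀ᶠ x in 𝓝 y, ContDiffAt ℝ ∞ ψ x ∧ Function.Injective (fderiv ℝ ψ x) ∧
    (∀ v, a x v = 0 ↔ b (ψ x) (fderiv ℝ ψ x v) = 0) ∧ (x 2 = 0 → ψ x = x)

/-- The plane `x₂ = 0` has points with non-vanishing characteristic form near any of its points. -/
theorem frequently_characteristic_ne_zero {a : 𝔼 → 𝔼 →L[ℝ] ℝ} {y : 𝔼}
    (ha : DifferentiableAt ℝ a y) (hy : y 2 = 0) (hW : contactFn a y ≠ 0) :
    ∃ᶠ x in 𝓝[{x | x 2 = 0}] y, a x (stdVec 0) ≠ 0 ∨ a x (stdVec 1) ≠ 0 := by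
  intro hcon
  simp only [not_or, not_not] at hcon
  rw [eventually_nhdsWithin_iff] at hcon
  -- If the characteristic form vanished near `y` in the plane, so would its tangential derivatives;
  -- every term of `a ∧ da` contains one of these quantities.
  have h01 : fderiv ℝ a y (stdVec 0) (stdVec 1) = 0 := by
    have := fderiv_apply_eq_of_eq_on_plane (f := fun x ↦ a x (stdVec 1)) (g := fun _ ↦ (0 : ℝ))
      (ha.clm_apply (differentiableAt_const _)) (differentiableAt_const _) hy
      (hcon.mono fun x hx h ↦ (hx h).2) (stdVec_eq_zero_or (i := 0) (by decide))
    rw [fderiv_clm_apply ha (differentiableAt_const _)] at this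
    simpa using this
  have h10 : fderiv ℝ a y (stdVec 1) (stdVec 0) = 0 := by
    have := fderiv_apply_eq_of_eq_on_plane (f := fun x ↦ a x (stdVec 0)) (g := fun _ ↦ (0 : ℝ))
      (ha.clm_apply (differentiableAt_const _)) (differentiableAt_const _) hy
      (hcon.mono fun x hx h ↦ (hx h).1) (stdVec_eq_zero_or (i := 1) (by decide))
    rw [fderiv_clm_apply ha (differentiableAt_const _)] at this
    simpa using this
  have h0 := hcon.self_of_nhds hy
  exact hW (by simp [contactFn, contactCoeff, h01, h10, h0.1, h0.2])

/-- The 1-jet along the plane `x₂ = 0` of a contactomorphism germ between two contact forms with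
the same restriction to that plane. -/
theorem IsContactGerm.pullbackForm_eq {a b : 𝔼 → 𝔼 →L[ℝ] ℝ} {ψ : 𝔼 → 𝔼} {y : 𝔼}
    (h : IsContactGerm a b ψ y) (hy : y 2 = 0)
    (ha : ContDiffAt ℝ ∞ a y) (hb : ContDiffAt ℝ ∞ b y)
    (hab : ∀ᶠ x in 𝓝 y, x 2 = 0 → ∀ v : 𝔼, v 2 = 0 → a x v = b x v)
    (hWa : 0 < contactFn a y) (hWb : 0 < contactFn b y) :
    pullbackForm ψ b y = a y ∧ 0 < fderiv ℝ ψ y (stdVec 2) 2 := by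
  have hψy : ψ y = y := h.self_of_nhds.2.2.2 hy
  have hψs := h.self_of_nhds.1
  have hplane : ∀ᶠ x in 𝓝 y, x 2 = 0 → ∀ v : 𝔼, v 2 = 0 → fderiv ℝ ψ x v = v := by
    filter_upwards [h.eventually_nhds] with x hx hx2 v hv
    have := fderiv_apply_eq_of_eq_on_plane (f := ψ) (g := id)
      (hx.self_of_nhds.1.differentiableAt (by simp)) differentiableAt_id hx2
      (hx.mono fun z hz ↦ hz.2.2.2) hv
    simpa using this
  have hψy' (i : Fin 3) (hi : i ≠ 2) : fderiv ℝ ψ y (stdVec i) = stdVec i :=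
    hplane.self_of_nhds hy _ (stdVec_eq_zero_or hi)
  have hcross : ∀ᶠ x in 𝓝 y, crossForm (a x) (pullbackForm ψ b x) = 0 :=
    h.mono fun x hx ↦ crossForm_eq_zero_of_ker fun v ↦ (hx.2.2.1 v).1
  have hps : ContDiffAt ℝ ∞ (pullbackForm ψ b) y := hψs.pullbackForm (by rwa [hψy])
  have htan : ∀ᶠ x in 𝓝 y, x 2 = 0 → ∀ i : Fin 3, i ≠ 2 →
      pullbackForm ψ b x (stdVec i) = a x (stdVec i) := by
    filter_upwards [hplane, hab, h] with x h1 h2 h3 hx i hi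
    rw [pullbackForm_apply, h1 hx _ (stdVec_eq_zero_or hi), h3.2.2.2 hx,
      h2 hx _ (stdVec_eq_zero_or hi)]
  -- Where the characteristic form is non-zero, proportional forms with equal tangential parts are
  -- equal. Such points accumulate at `y`, so continuity gives equality at `y` even if `y` is
  -- singular.
  have heq2 : pullbackForm ψ b y (stdVec 2) = a y (stdVec 2) := by
    by_contra hne
    have hca : ContinuousAt (fun x ↦ a x (stdVec 2)) y :=
      ha.continuousAt.clm_apply continuousAt_const
    have hcp : ContinuousAt (fun x ↦ pullbackForm ψ b x (stdVec 2)) y :=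
      hps.continuousAt.clm_apply continuousAt_const
    have hev : ∀ᶠ x in 𝓝 y, pullbackForm ψ b x (stdVec 2) ≠ a x (stdVec 2) :=
      (hcp.sub hca).eventually_ne (sub_ne_zero.2 hne) |>.mono fun x hx ↦ sub_ne_zero.1 hx
    refine frequently_characteristic_ne_zero (ha.differentiableAt (by simp)) hy hWa.ne' ?_
    rw [eventually_nhdsWithin_iff]
    filter_upwards [hev, htan, hcross] with x h1 h2 h3 hx
    rintro (h4 | h4)
    · have := mul_eq_mul_of_crossForm_eq_zero h3 0 2
      rw [h2 hx 0 (by decide), mul_comm (a x (stdVec 2))] at this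
      exact h1 (mul_left_cancel₀ h4 this)
    · have := mul_eq_mul_of_crossForm_eq_zero h3 1 2
      rw [h2 hx 1 (by decide), mul_comm (a x (stdVec 2))] at this
      exact h1 (mul_left_cancel₀ h4 this)
  have heq : pullbackForm ψ b y = a y := ext_stdVec fun i ↦ by
    fin_cases i
    · exact htan.self_of_nhds hy 0 (by decide)
    · exact htan.self_of_nhds hy 1 (by decide)
    · exact heq2
  refine ⟨heq, ?_⟩
  -- Near `y` one has `ψ^*b = h a` with `h y = 1`, so the contact functions agree at `y`; by the
  -- pull-back formula this determines the sign of the normal derivative.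
  have hW : contactFn (pullbackForm ψ b) y = contactFn a y := by
    obtain ⟨j, hj⟩ : ∃ j, a y (stdVec j) ≠ 0 := by
      by_contra! hcon
      exact hWa.ne' (by simp [contactFn, contactCoeff, hcon])
    have hcj : DifferentiableAt ℝ (fun x ↦ a x (stdVec j)) y :=
      (ha.differentiableAt (by simp)).clm_apply (differentiableAt_const _)
    have hcj' : DifferentiableAt ℝ (fun x ↦ pullbackForm ψ b x (stdVec j)) y :=
      (hps.differentiableAt (by simp)).clm_apply (differentiableAt_const _)
    have he : pullbackForm ψ b =ᶠ[𝓝 y]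
        fun x ↦ (pullbackForm ψ b x (stdVec j) / a x (stdVec j)) • a x := by
      filter_upwards [hcross, hcj.continuousAt.eventually_ne hj] with x h1 h2
      refine ext_stdVec fun i ↦ ?_
      rw [smul_apply, smul_eq_mul, div_mul_eq_mul_div, eq_div_iff h2, mul_comm,
        mul_eq_mul_of_crossForm_eq_zero h1 j i, mul_comm]
    have hq : DifferentiableAt ℝ
        (fun x ↦ pullbackForm ψ b x (stdVec j) / a x (stdVec j)) y := by
      simp only [div_eq_mul_inv]
      exact hcj'.mul (hcj.inv hj)
    rw [contactFn_congr he, contactFn_smul (ha.differentiableAt (by simp)) hq,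
      heq, div_self hj]
    ring
  have hb' : DifferentiableAt ℝ b (ψ y) := by rw [hψy]; exact hb.differentiableAt (by simp)
  rw [contactFn_pullbackForm hψs hb' (hψy' 0 (by decide)) (hψy' 1 (by decide)), hψy] at hW
  exact (pos_iff_pos_of_mul_pos (hW ▸ hWa)).2 hWb

end ContactGerm

/-! ### Relative extension of contact germs in `ℝ³`. -/

section LocalExtension

theorem eventually_injective_fderiv {V : Type*} [NormedAddCommGroup V] [NormedSpace ℝ V]
    [FiniteDimensional ℝ V] {f : V → V} {x : V} (hf : ContDiffAt ℝ ∞ f x)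
    (h : Function.Injective (fderiv ℝ f x)) :
    ∀ᶠ z in 𝓝 x, Function.Injective (fderiv ℝ f z) := by
  have : CompleteSpace V := FiniteDimensional.complete ℝ V
  let e : V ≃L[ℝ] V := (LinearEquiv.ofInjectiveEndo (fderiv ℝ f x : V →ₗ[ℝ] V)
    h).toContinuousLinearEquiv
  have he : (e : V →L[ℝ] V) = fderiv ℝ f x := by ext v; rfl
  have hc : ContinuousAt (fderiv ℝ f) x := (hf.fderiv_right (m := 0) (by simp)).continuousAt
  have := hc (he ▸ ContinuousLinearEquiv.nhds e)
  filter_upwards [this] with z hz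
  obtain ⟨e', he'⟩ := hz
  rw [← he']
  exact e'.injective

/-- The model for a map fixing the plane `x₂ = 0` with prescribed normal derivative `w`. -/
noncomputable def planeCollar (w : 𝔼 → 𝔼) (x : 𝔼) : 𝔼 := x + x 2 • (w x - stdVec 2)

theorem planeCollar_of_mem {w : 𝔼 → 𝔼} {x : 𝔼} (hx : x 2 = 0) : planeCollar w x = x := by
  simp [planeCollar, hx]

theorem contDiffAt_planeCollar {w : 𝔼 → 𝔼} {x : 𝔼} (hw : ContDiffAt ℝ ∞ w x) :
    ContDiffAt ℝ ∞ (planeCollar w) x := by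
  have h2 : ContDiffAt ℝ ∞ (fun x : 𝔼 ↦ x 2) x := 
    (EuclideanSpace.proj (2 : Fin 3) : 𝔼 →L[ℝ] ℝ).contDiff.contDiffAt
  exact contDiffAt_id.add (h2.smul (hw.sub contDiffAt_const))

theorem fderiv_planeCollar {w : 𝔼 → 𝔼} {x : 𝔼} (hw : ContDiffAt ℝ ∞ w x) (hx : x 2 = 0) :
    fderiv ℝ (planeCollar w) x (stdVec 2) = w x := by
  have h2 : HasFDerivAt (fun x : 𝔼 ↦ x 2) (EuclideanSpace.proj (2 : Fin 3) : 𝔼 →L[ℝ] ℝ) x :=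
    (EuclideanSpace.proj (2 : Fin 3) : 𝔼 →L[ℝ] ℝ).hasFDerivAt
  have := (hasFDerivAt_id x).add (h2.smul ((hw.differentiableAt (by simp)).hasFDerivAt.sub_const
    (stdVec 2)))
  have h3 := DFunLike.congr_fun (HasFDerivAt.fderiv this) (stdVec 2)
  change fderiv ℝ (planeCollar w) x (stdVec 2) = _ at h3
  rw [h3]
  simp [hx]

variable {B : Set 𝔼} {a b : 𝔼 → 𝔼 →L[ℝ] ℝ} {w ψ : 𝔼 → 𝔼} {K : Set 𝔼}

/-- A map which coincides with a given contactomorphism germ near `K` and whose 1-jet along the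
plane `x₂ = 0` matches the two contact forms everywhere. -/
theorem exists_map_matching_contactForms (hB : IsOpen B)
    (ha : ContDiffOn ℝ ∞ a B) (hb : ContDiffOn ℝ ∞ b B)
    (hWa : ∀ y ∈ B, 0 < contactFn a y) (hWb : ∀ y ∈ B, 0 < contactFn b y)
    (hab : ∀ y ∈ B, y 2 = 0 → ∀ v : 𝔼, v 2 = 0 → a y v = b y v)
    (hw : ContDiffOn ℝ ∞ w B)
    (hw1 : ∀ y ∈ B, y 2 = 0 → b y (w y) = a y (stdVec 2) ∧ 0 < w y 2)
    (hK : IsCompact K) (hKB : K ⊆ B) (hψ : ∀ y ∈ K, IsContactGerm a b ψ y) :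
    ∃ Ψ : 𝔼 → 𝔼, (∀ y ∈ B, ContDiffAt ℝ ∞ Ψ y) ∧ (∀ y ∈ K, Ψ =ᶠ[𝓝 y] ψ) ∧
      ∀ y ∈ B, y 2 = 0 → Ψ y = y ∧ (∀ v : 𝔼, v 2 = 0 → fderiv ℝ Ψ y v = v) ∧
        0 < fderiv ℝ Ψ y (stdVec 2) 2 ∧ pullbackForm Ψ b y = a y := by
  set O : Set 𝔼 := {x | IsContactGerm a b ψ x} ∩ B
  have hO : IsOpen O := (isOpen_iff_mem_nhds.2 fun x hx ↦ hx.eventually_nhds).inter hB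
  obtain ⟨χ, hχ, -, hχ1, hχ0, hχ01⟩ := exists_contDiff_bump hK hO fun y hy ↦ ⟨hψ y hy, hKB hy⟩
  have hcol {y : 𝔼} (hy : y ∈ B) : ContDiffAt ℝ ∞ (planeCollar w) y :=
    contDiffAt_planeCollar (hw.contDiffAt (hB.mem_nhds hy))
  set Ψ : 𝔼 → 𝔼 := fun x ↦ planeCollar w x + χ x • (ψ x - planeCollar w x) with hΨ
  have hdiff : ContDiff ℝ ∞ fun x ↦ χ x • (ψ x - planeCollar w x) :=
    contDiff_smul_of_contDiffAt hχ hχ0 fun x hx ↦ hx.1.self_of_nhds.1.sub (hcol hx.2)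
  have hΨs : ∀ y ∈ B, ContDiffAt ℝ ∞ Ψ y := fun y hy ↦ (hcol hy).add hdiff.contDiffAt
  have hΨid : ∀ y ∈ B, y 2 = 0 → Ψ y = y := fun y hy hy2 ↦ by
    simp only [hΨ, planeCollar_of_mem hy2]
    by_cases hyO : y ∈ O
    · simp [hyO.1.self_of_nhds.2.2.2 hy2]
    · simp [(hχ0 y hyO).self_of_nhds]
  refine ⟨Ψ, hΨs, fun y hy ↦ ?_, fun y hy hy2 ↦ ?_⟩
  · filter_upwards [hχ1 y hy] with x hx
    simp [hΨ, hx]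
  · have htan (v : 𝔼) (hv : v 2 = 0) : fderiv ℝ Ψ y v = v := by
      have := fderiv_apply_eq_of_eq_on_plane (f := Ψ) (g := id)
        ((hΨs y hy).differentiableAt (by simp)) differentiableAt_id hy2
        (Filter.eventually_of_mem (hB.mem_nhds hy) fun x hx hx2 ↦ hΨid x hx hx2) hv
      simpa using this
    -- On the plane both maps are the identity, so the term with the derivative of `χ` drops out.
    -- The normal derivative of `Ψ` is thus a convex combination of two vectors meeting the same
    -- affine condition and the same inequality.
    have hnormal : b y (fderiv ℝ Ψ y (stdVec 2)) = a y (stdVec 2) ∧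
        0 < fderiv ℝ Ψ y (stdVec 2) 2 := by
      by_cases hyO : y ∈ O
      · have hψd := hyO.1.self_of_nhds.1.differentiableAt (by simp)
        have hcd := (hcol hy).differentiableAt (by simp)
        have hψy := hyO.1.self_of_nhds.2.2.2 hy2
        have h1 := hcd.hasFDerivAt.add ((hχ.differentiable (by simp) y).hasFDerivAt.smul
          (hψd.hasFDerivAt.sub hcd.hasFDerivAt))
        have h2 := DFunLike.congr_fun (HasFDerivAt.fderiv h1) (stdVec 2)
        change fderiv ℝ Ψ y (stdVec 2) = _ at h2
        have h3 : fderiv ℝ Ψ y (stdVec 2) =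
            w y + χ y • (fderiv ℝ ψ y (stdVec 2) - w y) := by
          rw [h2]
          simp [hψy, planeCollar_of_mem hy2,
            fderiv_planeCollar (hw.contDiffAt (hB.mem_nhds hy)) hy2]
        obtain ⟨h4, h5⟩ := hyO.1.pullbackForm_eq hy2 (ha.contDiffAt (hB.mem_nhds hy))
          (hb.contDiffAt (hB.mem_nhds hy))
          (Filter.eventually_of_mem (hB.mem_nhds hy) fun x hx ↦ hab x hx) (hWa y hy) (hWb y hy)
        have h6 := DFunLike.congr_fun h4 (stdVec 2)
        rw [pullbackForm_apply, hψy] at h6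
        obtain ⟨h7, h8⟩ := hw1 y hy hy2
        refine ⟨by rw [h3, map_add, map_smul, map_sub, h6, h7]; simp, ?_⟩
        have h9 : fderiv ℝ Ψ y (stdVec 2) 2
            = (1 - χ y) * w y 2 + χ y * fderiv ℝ ψ y (stdVec 2) 2 := by
          rw [h3]; simp; ring
        rw [h9]
        rcases (hχ01 y).1.eq_or_lt with h0 | h0
        · rw [← h0]; simpa using h8
        · exact add_pos_of_nonneg_of_pos (mul_nonneg (sub_nonneg.2 (hχ01 y).2) h8.le) (mul_pos h0 h5)
      · have h1 : Ψ =ᶠ[𝓝 y] planeCollar w := by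
          filter_upwards [hχ0 y hyO] with x hx
          simp [hΨ, hx]
        rw [h1.fderiv_eq, fderiv_planeCollar (hw.contDiffAt (hB.mem_nhds hy)) hy2]
        exact hw1 y hy hy2
    refine ⟨hΨid y hy hy2, htan, hnormal.2, ext_stdVec fun i ↦ ?_⟩
    rw [pullbackForm_apply, hΨid y hy hy2]
    by_cases hi : i = 2
    · rw [hi, hnormal.1]
    · rw [htan _ (stdVec_eq_zero_or hi), hab y hy hy2 _ (stdVec_eq_zero_or hi)]

/-- Relative local version of the theorem that the characteristic foliation determines the germ
of a contact structure along a surface. -/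
theorem exists_contactGerm_extension (hB : IsOpen B)
    (ha : ContDiffOn ℝ ∞ a B) (hb : ContDiffOn ℝ ∞ b B)
    (hWa : ∀ y ∈ B, 0 < contactFn a y) (hWb : ∀ y ∈ B, 0 < contactFn b y)
    (hab : ∀ y ∈ B, y 2 = 0 → ∀ v : 𝔼, v 2 = 0 → a y v = b y v)
    (hw : ContDiffOn ℝ ∞ w B)
    (hw1 : ∀ y ∈ B, y 2 = 0 → b y (w y) = a y (stdVec 2) ∧ 0 < w y 2)
    (hK : IsCompact K) (hψ : ∀ y ∈ K, IsContactGerm a b ψ y)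
    {Z : Set 𝔼} (hZ : IsCompact Z) (hZB : Z ⊆ B) (hZ2 : ∀ y ∈ Z, y 2 = 0) (hKZ : K ⊆ Z) :
    ∃ Θ : 𝔼 → 𝔼, (∀ y ∈ Z, IsContactGerm a b Θ y) ∧ ∀ y ∈ K, Θ =ᶠ[𝓝 y] ψ := by
  obtain ⟨Ψ, hΨ, hΨψ, hΨS⟩ := exists_map_matching_contactForms hB ha hb hWa hWb hab hw hw1 hK
    (hKZ.trans hZB) hψ
  set N : Set 𝔼 := B ∩ Ψ ⁻¹' B
  have hN : IsOpen N :=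
    ContinuousOn.isOpen_inter_preimage (fun y hy ↦ (hΨ y hy).continuousAt.continuousWithinAt) hB hB
  have hBN {y : 𝔼} (hy : y ∈ B) (hy2 : y 2 = 0) : y ∈ N :=
    ⟨hy, by rw [mem_preimage, (hΨS y hy hy2).1]; exact hy⟩
  have haB {y : 𝔼} (hy : y ∈ B) : ContDiffAt ℝ ∞ a y := ha.contDiffAt (hB.mem_nhds hy)
  have hbB {y : 𝔼} (hy : y ∈ B) : ContDiffAt ℝ ∞ b y := hb.contDiffAt (hB.mem_nhds hy)
  have hpull {y : 𝔼} (hy : y ∈ N) : ContDiffAt ℝ ∞ (pullbackForm Ψ b) y :=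
    (hΨ y hy.1).pullbackForm (hbB hy.2)
  set c : 𝔼 → 𝔼 →L[ℝ] ℝ := fun x ↦ pullbackForm Ψ b x - a x with hc
  have hc0 {y : 𝔼} (hy : y ∈ B) (hy2 : y 2 = 0) : c y = 0 := by
    simp [hc, (hΨS y hy hy2).2.2.2]
  have hcross0 {y : 𝔼} (hy : y ∈ B) (hy2 : y 2 = 0) : crossForm (a y) (c y) = 0 := by
    rw [hc0 hy hy2]
    simpa using crossForm_smul_self (a y) 0
  obtain ⟨Φ, hΦ, hΦinj, hΦfix, hΦker⟩ := exists_gray_isotopy hN hZ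
    (fun y hy ↦ hBN (hZB hy) (hZ2 y hy)) (a := a) (c := c)
    (fun y hy ↦ (haB hy.1).contDiffWithinAt)
    (fun y hy ↦ ((hpull hy).sub (haB hy.1)).contDiffWithinAt)
    (fun y hy ↦ hcross0 (hZB hy) (hZ2 y hy)) (fun y hy t ht ↦ by
      have hyB := hZB hy
      have hy2 := hZ2 y hy
      obtain ⟨h1, h2, h3, h4⟩ := hΨS y hyB hy2
      have h5 : 0 < contactFn (pullbackForm Ψ b) y := by
        rw [contactFn_pullbackForm (hΨ y hyB) (by rw [h1]; exact (hbB hyB).differentiableAt (by simp))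
          (h2 _ (stdVec_eq_zero_or (by decide))) (h2 _ (stdVec_eq_zero_or (by decide))), h1]
        exact mul_pos h3 (hWb y hyB)
      have h6 : fderiv ℝ c y = fderiv ℝ (pullbackForm Ψ b) y - fderiv ℝ a y :=
        fderiv_fun_sub ((hpull (hBN hyB hy2)).differentiableAt (by simp))
          ((haB hyB).differentiableAt (by simp))
      -- On the plane `c = 0`, so the form itself does not move with `t`. As the coefficient is
      -- linear in the derivative, it interpolates affinely between two positive numbers.
      have h7 : contactCoeff (a y + t • c y) (fderiv ℝ a y + t • fderiv ℝ c y)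
          = (1 - t) * contactFn a y + t * contactFn (pullbackForm Ψ b) y := by
        rw [hc0 hyB hy2, h6, contactFn, contactFn, h4]
        simp [contactCoeff]
        ring
      rw [h7]
      rcases ht.1.eq_or_lt with h0 | h0
      · rw [← h0]; simpa using (hWa y hyB).ne'
      · exact (add_pos_of_nonneg_of_pos (mul_nonneg (sub_nonneg.2 ht.2) (hWa y hyB).le)
          (mul_pos h0 h5)).ne')
  refine ⟨Ψ ∘ Φ, fun y hy ↦ ?_, fun y hy ↦ ?_⟩
  · have hyB := hZB hy
    have hy2 := hZ2 y hy
    have hΦy : Φ y = y := hΦfix y (hcross0 hyB hy2)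
    have hinj : Function.Injective (fderiv ℝ Ψ y) := by
      refine (injective_iff_map_eq_zero _).2 fun v hv ↦ ?_
      obtain ⟨-, h2, h3, -⟩ := hΨS y hyB hy2
      rw [map_eq_sum_stdVec, h2 _ (stdVec_eq_zero_or (by decide)),
        h2 _ (stdVec_eq_zero_or (by decide))] at hv
      have hv2 : v 2 = 0 := by
        have := congrArg (fun z : 𝔼 ↦ z 2) hv
        simpa [h3.ne'] using this
      rw [hv2, zero_smul, add_zero] at hv
      rw [eq_sum_stdVec v, hv2, zero_smul, add_zero, hv]
    have hΦc : Filter.Tendsto Φ (𝓝 y) (𝓝 y) := by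
      have := hΦ.continuous.tendsto y
      rwa [hΦy] at this
    filter_upwards [hΦker y hy, hΦc.eventually (hN.mem_nhds (hBN hyB hy2)),
      hΦc.eventually (eventually_injective_fderiv (hΨ y hyB) hinj), hB.mem_nhds hyB]
      with x h1 h2 h3 hxB
    have hcomp : fderiv ℝ (Ψ ∘ Φ) x = (fderiv ℝ Ψ (Φ x)).comp (fderiv ℝ Φ x) :=
      fderiv_comp x ((hΨ _ h2.1).differentiableAt (by simp)) (hΦ.differentiable (by simp) x)
    refine ⟨(hΨ _ h2.1).comp x hΦ.contDiffAt, ?_, fun v ↦ ?_, fun hx2 ↦ ?_⟩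
    · rw [hcomp]
      exact h3.comp (hΦinj x)
    · rw [h1 v, hcomp]
      simp [hc]
    · rw [Function.comp_apply, hΦfix x (hcross0 hxB hx2), (hΨS x hxB hx2).1]
  -- Near `K` the map `Ψ = ψ` already respects kernels, so `a` and `c` are proportional, the cross
  -- product vanishes and the isotopy is stationary.
  · have hfix : ∀ᶠ x in 𝓝 y, Φ x = x := by
      filter_upwards [hψ y hy, (hΨψ y hy).eventually_nhds] with x h1 h2
      replace h2 : Ψ =ᶠ[𝓝 x] ψ := h2
      refine hΦfix x ?_
      rw [hc, crossForm_sub_self]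
      refine crossForm_eq_zero_of_ker fun v hv ↦ ?_
      rw [pullbackForm_apply, h2.fderiv_eq, h2.self_of_nhds]
      exact (h1.2.2.1 v).1 hv
    filter_upwards [hfix, hΨψ y hy] with x h1 h2
    rw [Function.comp_apply, h1, h2]

end LocalExtension

/-! ### Pull-backs of forms under parametrizations. -/

section ParametrizedPullback

variable {V E' : Type*} [NormedAddCommGroup V] [NormedSpace ℝ V]
  [NormedAddCommGroup E'] [NormedSpace ℝ E']
  {M : Type*} [TopologicalSpace M] [ChartedSpace E' M] [IsManifold 𝓘(ℝ, E') ∞ M]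

theorem contMDiffAt_mfderiv_apply_const {σ : V → M} {y : V}
    (hσ : ContMDiffAt 𝓘(ℝ, V) 𝓘(ℝ, E') ∞ σ y) (v : V) :
    ContMDiffAt 𝓘(ℝ, V) (𝓘(ℝ, E').prod 𝓘(ℝ, E')) ∞
      (fun m ↦ TotalSpace.mk' E' (E := TangentSpace 𝓘(ℝ, E')) (σ m)
        (mfderiv 𝓘(ℝ, V) 𝓘(ℝ, E') σ m v)) y := by
  have h1 : ContMDiffAt 𝓘(ℝ, V) 𝓘(ℝ, V →L[ℝ] E') ∞ (inTangentCoordinates 𝓘(ℝ, V) 𝓘(ℝ, E')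
      (id : V → V) σ (fun m ↦ mfderiv 𝓘(ℝ, V) 𝓘(ℝ, E') σ m) y) y :=
    ContMDiffAt.mfderiv_const hσ (by simp)
  refine ContMDiffAt.clm_apply_of_inCoordinates (IM := 𝓘(ℝ, V)) (IB₁ := 𝓘(ℝ, V))
    (IB₂ := 𝓘(ℝ, E'))
    (F₁ := V) (E₁ := TangentSpace 𝓘(ℝ, V)) (F₂ := E') (E₂ := TangentSpace 𝓘(ℝ, E'))
    (b₁ := (id : V → V)) (b₂ := σ)
    (ϕ := fun m ↦ mfderiv 𝓘(ℝ, V) 𝓘(ℝ, E') σ m) (v := fun _ ↦ v) h1 ?_ hσ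
  rw [← contMDiffWithinAt_univ]
  exact contMDiffWithinAt_vectorSpace_iff_contDiffWithinAt.2 contDiffWithinAt_const

end ParametrizedPullback

section OneFormPullback

theorem contDiffAt_clm_apply {D E F : Type*} [NormedAddCommGroup D] [NormedSpace ℝ D]
    [NormedAddCommGroup E] [NormedSpace ℝ E] [NormedAddCommGroup F] [NormedSpace ℝ F]
    [FiniteDimensional ℝ E] {f : D → E →L[ℝ] F} {x : D} {n : WithTop ℕ∞}
    (h : ∀ v, ContDiffAt ℝ n (fun x ↦ f x v) x) : ContDiffAt ℝ n f x := by
  let e₁ := ContinuousLinearEquiv.ofFinrankEq (Module.finrank_fin_fun ℝ (n := Module.finrank ℝ E)).symm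
  let e₂ := (e₁.arrowCongr (1 : F ≃L[ℝ] F)).trans (ContinuousLinearEquiv.piRing _)
  rw [← Function.id_comp f, ← e₂.symm_comp_self]
  exact e₂.symm.contDiff.contDiffAt.comp x (contDiffAt_pi.mpr fun i => h _)

variable {V : Type*} [NormedAddCommGroup V] [NormedSpace ℝ V]
  {M : Type*} [TopologicalSpace M] [ChartedSpace 𝔼 M]

/-- The pull-back of a 1-form under a map from a vector space, e.g. a parametrization. -/
noncomputable def OneForm.pullback (α : OneForm M) (σ : V → M) (y : V) : V →L[ℝ] ℝ :=
  (α (σ y)).comp (mfderiv 𝓘(ℝ, V) (𝓡 3) σ y)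

theorem OneForm.inChart_eq_pullback (α : OneForm M) (p : M) :
    α.inChart p = α.pullback (chartAt 𝔼 p).symm := rfl

theorem OneForm.Smooth.contDiffAt_pullback [IsManifold (𝓡 3) ∞ M] [FiniteDimensional ℝ V]
    {α : OneForm M} (hα : α.Smooth) {σ : V → M} {y : V} (hσ : ContMDiffAt 𝓘(ℝ, V) (𝓡 3) ∞ σ y) :
    ContDiffAt ℝ ∞ (α.pullback σ) y := by
  refine contDiffAt_clm_apply fun v ↦ ?_
  rw [← contMDiffAt_iff_contDiffAt]
  have h1 := (hα (σ y)).comp y hσ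
  have h2 := ContMDiffAt.clm_bundle_apply (E₂ := fun _ ↦ ℝ) (b := σ) (ϕ := fun m ↦ α (σ m)) h1
    (contMDiffAt_mfderiv_apply_const hσ v)
  exact (contMDiffAt_totalSpace.1 h2).2

theorem OneForm.pullback_comp {W : Type*} [NormedAddCommGroup W] [NormedSpace ℝ W]
    (α : OneForm M) {σ : V → M} {τ : W → V} {y : W}
    (hσ : MDifferentiableAt 𝓘(ℝ, V) (𝓡 3) σ (τ y)) (hτ : DifferentiableAt ℝ τ y) :
    α.pullback (σ ∘ τ) y = (α.pullback σ (τ y)).comp (fderiv ℝ τ y) := by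
  rw [OneForm.pullback, mfderiv_comp y hσ hτ.mdifferentiableAt, mfderiv_eq_fderiv]
  rfl

theorem OneForm.pullback_congr (α : OneForm M) {σ σ' : V → M} {y : V} (h : σ =ᶠ[𝓝 y] σ') :
    α.pullback σ y = α.pullback σ' y := by
  ext v
  change α (σ y) (mfderiv 𝓘(ℝ, V) (𝓡 3) σ y v) = α (σ' y) (mfderiv 𝓘(ℝ, V) (𝓡 3) σ' y v)
  rw [h.mfderiv_eq]
  have := h.self_of_nhds
  congr!

end OneFormPullback

/-! ### The inverse function theorem with smooth inverse. -/

section InverseFunction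

/-- The source is cut down to the open set where the derivative is injective, so that the inverse is
smooth on the whole target and not only at the image of `x`. -/
theorem exists_openPartialHomeomorph_of_injective_fderiv {V : Type*} [NormedAddCommGroup V]
    [NormedSpace ℝ V] [FiniteDimensional ℝ V] {f : V → V} {U : Set V} (hU : IsOpen U)
    (hf : ∀ y ∈ U, ContDiffAt ℝ ∞ f y) {x : V} (hx : x ∈ U)
    (hinj : Function.Injective (fderiv ℝ f x)) :
    ∃ g : OpenPartialHomeomorph V V, x ∈ g.source ∧ g.source ⊆ U ∧ (∀ y, g y = f y) ∧
      ∀ z ∈ g.target, ContDiffAt ℝ ∞ g.symm z := by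
  have : CompleteSpace V := FiniteDimensional.complete ℝ V
  have hequiv {y : V} (hy : y ∈ U) (h : Function.Injective (fderiv ℝ f y)) :
      ∃ e : V ≃L[ℝ] V, HasFDerivAt f (e : V →L[ℝ] V) y :=
    ⟨(LinearEquiv.ofInjectiveEndo (fderiv ℝ f y : V →ₗ[ℝ] V) h).toContinuousLinearEquiv,
      ((hf y hy).differentiableAt (by simp)).hasFDerivAt⟩
  obtain ⟨e, he⟩ := hequiv hx hinj
  set O : Set V := {y | y ∈ U ∧ Function.Injective (fderiv ℝ f y)}
  have hO : IsOpen O := isOpen_iff_mem_nhds.2 fun y hy ↦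
    Filter.inter_mem (hU.mem_nhds hy.1) (eventually_injective_fderiv (hf y hy.1) hy.2)
  set g₀ := (hf x hx).toOpenPartialHomeomorph f he (by simp)
  have hg₀ (y : V) : g₀ y = f y := rfl
  refine ⟨g₀.restrOpen O hO, ⟨(hf x hx).mem_toOpenPartialHomeomorph_source he (by simp), hx, hinj⟩,
    fun y hy ↦ hy.2.1, fun y ↦ rfl, fun z hz ↦ ?_⟩
  have hzs : (g₀.restrOpen O hO).symm z ∈ g₀.source ∩ O := (g₀.restrOpen O hO).map_target hz
  obtain ⟨e', he'⟩ := hequiv hzs.2.1 hzs.2.2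
  exact (g₀.restrOpen O hO).contDiffAt_symm hz he' (hf _ hzs.2.1)

variable {V : Type*} [NormedAddCommGroup V] [NormedSpace ℝ V]
  {M N : Type*} [TopologicalSpace M] [ChartedSpace V M] [TopologicalSpace N] [ChartedSpace V N]

theorem injective_mfderiv_chartAt [IsManifold 𝓘(ℝ, V) ∞ M] (p : M) {x : M}
    (hx : x ∈ (chartAt V p).source) :
    Function.Injective (mfderiv 𝓘(ℝ, V) 𝓘(ℝ, V) (chartAt V p) x) :=
  (mdifferentiable_chart p).mfderiv_injective hx

theorem injective_mfderiv_chartAt_symm [IsManifold 𝓘(ℝ, V) ∞ M] (p : M) {y : V}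
    (hy : y ∈ (chartAt V p).target) :
    Function.Injective (mfderiv 𝓘(ℝ, V) 𝓘(ℝ, V) (chartAt V p).symm y) :=
  (mdifferentiable_chart p).symm.mfderiv_injective hy

/-- The inverse function theorem for maps between manifolds. -/
theorem exists_openPartialHomeomorph_of_injective_mfderiv [FiniteDimensional ℝ V]
    [IsManifold 𝓘(ℝ, V) ∞ M] [IsManifold 𝓘(ℝ, V) ∞ N] {ψ : M → N} {O : Set M} (hO : IsOpen O)
    (hψ : ∀ x ∈ O, ContMDiffAt 𝓘(ℝ, V) 𝓘(ℝ, V) ∞ ψ x) {x : M} (hx : x ∈ O)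
    (hinj : Function.Injective (mfderiv 𝓘(ℝ, V) 𝓘(ℝ, V) ψ x)) :
    ∃ Ψ : OpenPartialHomeomorph M N, x ∈ Ψ.source ∧ Ψ.source ⊆ O ∧ EqOn Ψ ψ Ψ.source ∧
      ∀ z ∈ Ψ.target, ContMDiffAt 𝓘(ℝ, V) 𝓘(ℝ, V) ∞ Ψ.symm z := by
  set c := chartAt V x
  set d := chartAt V (ψ x)
  have hxc : x ∈ c.source := mem_chart_source V x
  have hxd : ψ x ∈ d.source := mem_chart_source V (ψ x)
  have hc {z} (hz : z ∈ c.source) : ContMDiffAt 𝓘(ℝ, V) 𝓘(ℝ, V) ∞ c z :=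
    contMDiffAt_of_mem_maximalAtlas (IsManifold.chart_mem_maximalAtlas x) hz
  have hcs {z} (hz : z ∈ c.target) : ContMDiffAt 𝓘(ℝ, V) 𝓘(ℝ, V) ∞ c.symm z :=
    contMDiffAt_symm_of_mem_maximalAtlas (IsManifold.chart_mem_maximalAtlas x) hz
  have hd {z} (hz : z ∈ d.source) : ContMDiffAt 𝓘(ℝ, V) 𝓘(ℝ, V) ∞ d z :=
    contMDiffAt_of_mem_maximalAtlas (IsManifold.chart_mem_maximalAtlas (ψ x)) hz
  have hds {z} (hz : z ∈ d.target) : ContMDiffAt 𝓘(ℝ, V) 𝓘(ℝ, V) ∞ d.symm z :=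
    contMDiffAt_symm_of_mem_maximalAtlas (IsManifold.chart_mem_maximalAtlas (ψ x)) hz
  set O' : Set M := O ∩ ψ ⁻¹' d.source
  have hO' : IsOpen O' := ContinuousOn.isOpen_inter_preimage
    (fun z hz ↦ (hψ z hz).continuousAt.continuousWithinAt) hO d.open_source
  set U : Set V := c.target ∩ c.symm ⁻¹' O'
  have hU : IsOpen U := c.isOpen_inter_preimage_symm hO'
  have hf : ∀ y ∈ U, ContMDiffAt 𝓘(ℝ, V) 𝓘(ℝ, V) ∞ (d ∘ ψ ∘ c.symm) y := fun y hy ↦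
    (hd hy.2.2).comp y ((hψ _ hy.2.1).comp y (hcs hy.1))
  have hxU : c x ∈ U := ⟨c.map_source hxc, by
    rw [mem_preimage, c.left_inv hxc]; exact ⟨hx, hxd⟩⟩
  have hfinj : Function.Injective (fderiv ℝ (d ∘ ψ ∘ c.symm) (c x)) := by
    have hsx : c.symm (c x) = x := c.left_inv hxc
    have h1 : MDifferentiableAt 𝓘(ℝ, V) 𝓘(ℝ, V) c.symm (c x) :=
      (hcs (c.map_source hxc)).mdifferentiableAt (by simp)
    have h2 : MDifferentiableAt 𝓘(ℝ, V) 𝓘(ℝ, V) ψ (c.symm (c x)) := by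
      rw [hsx]; exact (hψ x hx).mdifferentiableAt (by simp)
    have h3 : MDifferentiableAt 𝓘(ℝ, V) 𝓘(ℝ, V) d ((ψ ∘ c.symm) (c x)) := by
      rw [Function.comp_apply, hsx]; exact (hd hxd).mdifferentiableAt (by simp)
    rw [← mfderiv_eq_fderiv, mfderiv_comp (c x) h3 (h2.comp (c x) h1), mfderiv_comp (c x) h2 h1]
    have i1 := injective_mfderiv_chartAt_symm x (c.map_source hxc)
    have i2 : Function.Injective (mfderiv 𝓘(ℝ, V) 𝓘(ℝ, V) ψ (c.symm (c x))) := by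
      rw [hsx]; exact hinj
    have i3 : Function.Injective (mfderiv 𝓘(ℝ, V) 𝓘(ℝ, V) d ((ψ ∘ c.symm) (c x))) := by
      rw [Function.comp_apply, hsx]; exact injective_mfderiv_chartAt (ψ x) hxd
    exact fun u v huv ↦ i1 (i2 (i3 huv))
  obtain ⟨g, hg1, hg2, hg3, hg4⟩ := exists_openPartialHomeomorph_of_injective_fderiv hU
    (fun y hy ↦ (hf y hy).contDiffAt) hxU hfinj
  refine ⟨(c.trans g).trans d.symm, ?_, fun z hz ↦ ?_, fun z hz ↦ ?_, fun z hz ↦ ?_⟩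
  · simp only [OpenPartialHomeomorph.trans_source, OpenPartialHomeomorph.symm_source, mem_inter_iff,
      mem_preimage, OpenPartialHomeomorph.coe_trans, Function.comp_apply, hg3, c.left_inv hxc]
    exact ⟨⟨hxc, hg1⟩, d.map_source hxd⟩
  · simp only [OpenPartialHomeomorph.trans_source, mem_inter_iff, mem_preimage] at hz
    have := (hg2 hz.1.2).2.1
    rwa [c.left_inv hz.1.1] at this
  · simp only [OpenPartialHomeomorph.trans_source, mem_inter_iff, mem_preimage] at hz
    have := (hg2 hz.1.2).2.2
    rw [mem_preimage, c.left_inv hz.1.1] at this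
    simp [hg3, c.left_inv hz.1.1, d.left_inv this]
  · simp only [OpenPartialHomeomorph.trans_target, OpenPartialHomeomorph.symm_target,
      OpenPartialHomeomorph.symm_symm, mem_inter_iff, mem_preimage] at hz
    have h1 := ContMDiffAt.comp z ((hg4 _ hz.2.1).contMDiffAt) (hd hz.1)
    exact ContMDiffAt.comp (g := c.symm) (f := g.symm ∘ d) z (hcs hz.2.2) h1

end InverseFunction

/-! ### The contact condition in arbitrary parametrizations. -/

section ContactFunctionOfParametrization

variable {M : Type*} [TopologicalSpace M] [ChartedSpace 𝔼 M]

theorem extDerivOneForm_eq {A : 𝔼 → 𝔼 →L[ℝ] ℝ} {y : 𝔼} (hA : DifferentiableAt ℝ A y) (v w : 𝔼) :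
    extDerivOneForm A y v w = fderiv ℝ A y v w - fderiv ℝ A y w v := by
  have h : DifferentiableAt ℝ (fun z ↦ ContinuousAlternatingMap.ofSubsingleton ℝ 𝔼 ℝ
      (0 : Fin 1) (A z)) y := by
    exact ((ContinuousAlternatingMap.ofSubsingletonLIE (𝕜 := ℝ) (E := 𝔼) (F := ℝ)
      (0 : Fin 1)).toContinuousLinearEquiv.differentiableAt).comp y hA
  rw [extDerivOneForm, extDeriv_apply h, Fin.sum_univ_two]
  have key (u : 𝔼) : fderiv ℝ (fun z ↦ A z u) y = (fderiv ℝ A y).flip u := by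
    rw [fderiv_clm_apply hA (differentiableAt_const _)]
    simp
  simp [ContinuousAlternatingMap.ofSubsingleton_apply_apply, Fin.removeNth, key, sub_eq_add_neg]

theorem wedgeExtDeriv_eq {A : 𝔼 → 𝔼 →L[ℝ] ℝ} {y : 𝔼} (hA : DifferentiableAt ℝ A y) (u v w : 𝔼) :
    wedgeExtDeriv A y u v w = (u 0 * (v 1 * w 2 - v 2 * w 1) - u 1 * (v 0 * w 2 - v 2 * w 0)
      + u 2 * (v 0 * w 1 - v 1 * w 0)) * contactFn A y := by
  simp only [wedgeExtDeriv, extDerivOneForm_eq hA, contactFn, contactCoeff]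
  rw [map_eq_sum_stdVec (A y) u, map_eq_sum_stdVec (A y) v, map_eq_sum_stdVec (A y) w,
    map_eq_sum_stdVec (fderiv ℝ A y) u, map_eq_sum_stdVec (fderiv ℝ A y) v,
    map_eq_sum_stdVec (fderiv ℝ A y) w]
  have key (i : Fin 3) (z : 𝔼) := map_eq_sum_stdVec (fderiv ℝ A y (stdVec i)) z
  simp only [add_apply, smul_apply, smul_eq_mul]
  rw [key 0 u, key 0 v, key 0 w, key 1 u, key 1 v, key 1 w, key 2 u, key 2 v, key 2 w]
  simp only [smul_eq_mul]
  ring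

theorem wedgeExtDeriv_pullbackForm {Ψ : 𝔼 → 𝔼} {A : 𝔼 → 𝔼 →L[ℝ] ℝ} {y : 𝔼}
    (hΨ : ContDiffAt ℝ ∞ Ψ y) (hA : ContDiffAt ℝ ∞ A (Ψ y)) (u v w : 𝔼) :
    wedgeExtDeriv (pullbackForm Ψ A) y u v w
      = wedgeExtDeriv A (Ψ y) (fderiv ℝ Ψ y u) (fderiv ℝ Ψ y v) (fderiv ℝ Ψ y w) := by
  have h1 := (hΨ.pullbackForm hA).differentiableAt (by simp)
  have h2 := hA.differentiableAt (by simp)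
  simp only [wedgeExtDeriv, extDerivOneForm_eq h1, extDerivOneForm_eq h2,
    fderiv_pullbackForm_sub_swap hΨ h2, pullbackForm_apply]

/-- The contact condition at a point is stated only in the preferred chart there. The transition map
`τ` carries it to `σ`, by naturality of `A ∧ dA`. -/
theorem IsContactForm.contactFn_pullback_ne_zero [IsManifold (𝓡 3) ∞ M] {α : OneForm M}
    (hα : IsContactForm α) {σ : 𝔼 → M} {y : 𝔼} (hσ : ∀ᶠ z in 𝓝 y, ContMDiffAt (𝓡 3) (𝓡 3) ∞ σ z)
    (hinj : Function.Injective (mfderiv (𝓡 3) (𝓡 3) σ y)) : contactFn (α.pullback σ) y ≠ 0 := by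
  set c := chartAt 𝔼 (σ y)
  have hyc : σ y ∈ c.source := mem_chart_source 𝔼 (σ y)
  have hcs {z} (hz : z ∈ c.target) : ContMDiffAt (𝓡 3) (𝓡 3) ∞ c.symm z :=
    contMDiffAt_symm_of_mem_maximalAtlas (IsManifold.chart_mem_maximalAtlas (σ y)) hz
  have hc {z} (hz : z ∈ c.source) : ContMDiffAt (𝓡 3) (𝓡 3) ∞ c z :=
    contMDiffAt_of_mem_maximalAtlas (IsManifold.chart_mem_maximalAtlas (σ y)) hz
  set τ : 𝔼 → 𝔼 := c ∘ σ
  have hsrc : ∀ᶠ z in 𝓝 y, σ z ∈ c.source :=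
    hσ.self_of_nhds.continuousAt.eventually_mem (c.open_source.mem_nhds hyc)
  have hτ : ∀ᶠ z in 𝓝 y, ContDiffAt ℝ ∞ τ z := by
    filter_upwards [hσ, hsrc] with z h1 h2
    exact ((hc h2).comp z h1).contDiffAt
  have heq : α.pullback σ =ᶠ[𝓝 y] pullbackForm τ (α.pullback c.symm) := by
    filter_upwards [hτ, hsrc, hsrc.eventually_nhds] with z h1 h2 h3
    have h4 : σ =ᶠ[𝓝 z] c.symm ∘ τ := by
      filter_upwards [h3] with z' h5
      exact (c.left_inv h5).symm
    rw [α.pullback_congr h4, α.pullback_comp (σ := c.symm) (τ := τ) ((hcs (c.map_source h2)).mdifferentiableAt (by simp))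
      (h1.differentiableAt (by simp))]
    rfl
  have hA : ContDiffAt ℝ ∞ (α.pullback c.symm) (τ y) :=
    hα.1.contDiffAt_pullback (hcs (c.map_source hyc))
  have hτinj : Function.Injective (fderiv ℝ τ y) := by
    rw [← mfderiv_eq_fderiv, mfderiv_comp y ((hc hyc).mdifferentiableAt (by simp))
      (hσ.self_of_nhds.mdifferentiableAt (by simp))]
    exact (injective_mfderiv_chartAt (σ y) hyc).comp hinj
  have hsurj : Function.Surjective (fderiv ℝ τ y) :=
    LinearMap.injective_iff_surjective.1 hτinj
  obtain ⟨u, v, w, huvw⟩ := hα.2 (σ y)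
  rw [α.inChart_eq_pullback] at huvw
  obtain ⟨u, rfl⟩ := hsurj u
  obtain ⟨v, rfl⟩ := hsurj v
  obtain ⟨w, rfl⟩ := hsurj w
  have h1 : extChartAt (𝓡 3) (σ y) (σ y) = τ y := rfl
  rw [h1, ← wedgeExtDeriv_pullbackForm hτ.self_of_nhds hA,
    wedgeExtDeriv_eq ((hτ.self_of_nhds.pullbackForm hA).differentiableAt (by simp))] at huvw
  rw [contactFn_congr heq]
  exact right_ne_zero_of_mul huvw

end ContactFunctionOfParametrization

/-! ### Immersions and surfaces as coordinate planes. -/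

section Immersion

/-- The local normal form provides a differentiable left inverse `d.symm ∘ g` of `ι` near `q`; the
chain rule gives a left inverse of the differential. -/
theorem IsImmersionAt.injective_mfderiv {S M : Type*} [TopologicalSpace S] [ChartedSpace 𝔼₂ S]
    [IsManifold (𝓡 2) ∞ S] [TopologicalSpace M] [ChartedSpace 𝔼 M] [IsManifold (𝓡 3) ∞ M]
    {ι : S → M} {q : S} (h : IsImmersionAt (𝓡 2) (𝓡 3) ∞ ι q) :
    Function.Injective (mfderiv (𝓡 2) (𝓡 3) ι q) := by
  set d := h.domChart with hd
  set c := h.codChart with hc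
  have hqd : q ∈ d.source := h.mem_domChart_source
  have hqc : ι q ∈ c.source := h.mem_codChart_source
  have hw (z : S) (hz : z ∈ d.source) : c (ι z) = h.equiv (d z, 0) := by
    have := h.writtenInCharts (show d z ∈ (d.extend (𝓡 2)).target by simpa using d.map_source hz)
    change c (ι (d.symm (d z))) = h.equiv (d z, 0) at this
    rwa [d.left_inv hz] at this
  set g : M → 𝔼₂ := fun x ↦ (h.equiv.symm (c x)).1
  have hg (z : S) (hz : z ∈ d.source) : g (ι z) = d z := by
    simp [g, hw z hz]
  have hcs : ContMDiffAt (𝓡 3) (𝓡 3) ∞ c (ι q) :=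
    contMDiffAt_of_mem_maximalAtlas h.codChart_mem_maximalAtlas hqc
  have hgs : MDifferentiableAt (𝓡 3) (𝓡 2) g (ι q) := by
    have h1 : DifferentiableAt ℝ (fun y : 𝔼 ↦ (h.equiv.symm y).1) (c (ι q)) :=
      ((ContinuousLinearMap.fst ℝ 𝔼₂ h.complement).comp
        (h.equiv.symm : 𝔼 →L[ℝ] 𝔼₂ × h.complement)).differentiableAt
    exact h1.mdifferentiableAt.comp (ι q) (hcs.mdifferentiableAt (by simp))
  have hds : MDifferentiableAt (𝓡 2) (𝓡 2) d.symm (g (ι q)) := by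
    rw [hg q hqd]
    exact (contMDiffAt_symm_of_mem_maximalAtlas h.domChart_mem_maximalAtlas
      (d.map_source hqd)).mdifferentiableAt (by simp)
  have hι : MDifferentiableAt (𝓡 2) (𝓡 3) ι q := h.contMDiffAt.mdifferentiableAt (by simp)
  have hid : (d.symm ∘ g) ∘ ι =ᶠ[𝓝 q] id := by
    filter_upwards [d.open_source.mem_nhds hqd] with z hz
    simp [hg z hz, d.left_inv hz]
  have hcomp := mfderiv_comp q (hds.comp (ι q) hgs) hι
  rw [hid.mfderiv_eq, mfderiv_id] at hcomp
  intro u v huv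
  have key (u : TangentSpace (𝓡 2) q) :
      mfderiv (𝓡 3) (𝓡 2) (d.symm ∘ g) (ι q) (mfderiv (𝓡 2) (𝓡 3) ι q u) = u :=
    (DFunLike.congr_fun hcomp u).symm
  have h1 := key u
  rw [huv] at h1
  exact h1.symm.trans (key v)

end Immersion

section PlaneCoordinates

/-- The projection `ℝ³ → ℝ²` which forgets the last coordinate. -/
noncomputable def planeProj : 𝔼 →L[ℝ] 𝔼₂ :=
  LinearMap.toContinuousLinearMap
    { toFun := fun y ↦ !₂[y 0, y 1]
      map_add' := fun x y ↦ by ext i; fin_cases i <;> simp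
      map_smul' := fun t y ↦ by ext i; fin_cases i <;> simp }

/-- The inclusion `ℝ² → ℝ³` as the plane on which the last coordinate vanishes. -/
noncomputable def planeIncl : 𝔼₂ →L[ℝ] 𝔼 :=
  LinearMap.toContinuousLinearMap
    { toFun := fun u ↦ !₂[u 0, u 1, 0]
      map_add' := fun x y ↦ by ext i; fin_cases i <;> simp
      map_smul' := fun t y ↦ by ext i; fin_cases i <;> simp }

@[simp] theorem planeProj_apply_zero (y : 𝔼) : planeProj y 0 = y 0 := rfl
@[simp] theorem planeProj_apply_one (y : 𝔼) : planeProj y 1 = y 1 := rfl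
@[simp] theorem planeIncl_apply_zero (u : 𝔼₂) : planeIncl u 0 = u 0 := rfl
@[simp] theorem planeIncl_apply_one (u : 𝔼₂) : planeIncl u 1 = u 1 := rfl
@[simp] theorem planeIncl_apply_two (u : 𝔼₂) : planeIncl u 2 = 0 := rfl

@[simp] theorem planeProj_planeIncl (u : 𝔼₂) : planeProj (planeIncl u) = u := by
  ext i; fin_cases i <;> simp

theorem planeIncl_planeProj {y : 𝔼} (hy : y 2 = 0) : planeIncl (planeProj y) = y := by
  ext i; fin_cases i <;> simp [hy]

/-- The reflection of `ℝ³` in the plane `x₂ = 0`. -/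
noncomputable def planeReflection : 𝔼 →L[ℝ] 𝔼 :=
  ContinuousLinearMap.id ℝ 𝔼 - (2 : ℝ) • (EuclideanSpace.proj (2 : Fin 3)).smulRight (stdVec 2)

theorem planeReflection_apply (y : 𝔼) : planeReflection y = y - (2 * y 2) • stdVec 2 := by
  simp [planeReflection, smul_smul]

theorem planeReflection_apply_of_eq_zero {y : 𝔼} (hy : y 2 = 0) : planeReflection y = y := by
  simp [planeReflection_apply, hy]

theorem planeReflection_planeReflection (y : 𝔼) : planeReflection (planeReflection y) = y := by
  ext i; fin_cases i <;> simp [planeReflection_apply]; ring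

end PlaneCoordinates

section Slice

theorem ContDiffAt.contactFn {A : 𝔼 → 𝔼 →L[ℝ] ℝ} {y : 𝔼} (hA : ContDiffAt ℝ ∞ A y) :
    ContDiffAt ℝ ∞ (contactFn A) y :=
  contDiff_contactCoeff.contDiffAt.comp y (hA.prodMk (hA.fderiv_right (by simp)))

variable {M : Type*} [TopologicalSpace M] [ChartedSpace 𝔼 M] [IsManifold (𝓡 3) ∞ M]

/-- In a chart, the surface is thickened along a constant direction `n` outside its tangent plane at
the given point. -/
theorem exists_slice_parametrization {α : OneForm M} (hα : IsContactForm α) {κ : 𝔼₂ → M} {u : 𝔼₂}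
    (hκ : ∀ᶠ z in 𝓝 u, ContMDiffAt (𝓡 2) (𝓡 3) ∞ κ z)
    (hinj : Function.Injective (mfderiv (𝓡 2) (𝓡 3) κ u)) :
    ∃ σ : 𝔼 → M, (∀ᶠ y in 𝓝 (planeIncl u), ContMDiffAt (𝓡 3) (𝓡 3) ∞ σ y) ∧
      Function.Injective (mfderiv (𝓡 3) (𝓡 3) σ (planeIncl u)) ∧
      (∀ᶠ y in 𝓝 (planeIncl u), y 2 = 0 → σ y = κ (planeProj y)) ∧
      contactFn (α.pullback σ) (planeIncl u) ≠ 0 := by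
  set c := chartAt 𝔼 (κ u)
  have huc : κ u ∈ c.source := mem_chart_source 𝔼 (κ u)
  have hcs {z} (hz : z ∈ c.target) : ContMDiffAt (𝓡 3) (𝓡 3) ∞ c.symm z :=
    contMDiffAt_symm_of_mem_maximalAtlas (IsManifold.chart_mem_maximalAtlas (κ u)) hz
  have hc {z} (hz : z ∈ c.source) : ContMDiffAt (𝓡 3) (𝓡 3) ∞ c z :=
    contMDiffAt_of_mem_maximalAtlas (IsManifold.chart_mem_maximalAtlas (κ u)) hz
  have hsrc : ∀ᶠ z in 𝓝 u, κ z ∈ c.source :=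
    hκ.self_of_nhds.continuousAt.eventually_mem (c.open_source.mem_nhds huc)
  set F : 𝔼₂ → 𝔼 := c ∘ κ
  have hF : ∀ᶠ z in 𝓝 u, ContDiffAt ℝ ∞ F z := by
    filter_upwards [hκ, hsrc] with z h1 h2
    exact ((hc h2).comp z h1).contDiffAt
  have hFinj : Function.Injective (fderiv ℝ F u) := by
    rw [← mfderiv_eq_fderiv, mfderiv_comp u ((hc huc).mdifferentiableAt (by simp))
      (hκ.self_of_nhds.mdifferentiableAt (by simp))]
    exact (injective_mfderiv_chartAt (κ u) huc).comp hinj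
  obtain ⟨n, hn⟩ : ∃ n : 𝔼, n ∉ LinearMap.range (fderiv ℝ F u : 𝔼₂ →ₗ[ℝ] 𝔼) := by
    by_contra! h
    have h1 := LinearMap.finrank_range_le (fderiv ℝ F u : 𝔼₂ →ₗ[ℝ] 𝔼)
    rw [Submodule.eq_top_iff'.2 h] at h1
    simp at h1
  set f : 𝔼 → 𝔼 := fun y ↦ F (planeProj y) + y 2 • n
  have hproj : Filter.Tendsto planeProj (𝓝 (planeIncl u)) (𝓝 u) := by
    have := planeProj.continuous.tendsto (planeIncl u)
    rwa [planeProj_planeIncl] at this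
  have hf : ∀ᶠ y in 𝓝 (planeIncl u), ContDiffAt ℝ ∞ f y := by
    filter_upwards [hproj.eventually hF] with y hy
    exact (hy.comp y planeProj.contDiff.contDiffAt).add
      ((EuclideanSpace.proj (𝕜 := ℝ) (2 : Fin 3)).contDiff.contDiffAt.smul contDiffAt_const)
  have hfu : f (planeIncl u) = c (κ u) := by simp [f, F]
  have hft : ∀ᶠ y in 𝓝 (planeIncl u), f y ∈ c.target :=
    hf.self_of_nhds.continuousAt.eventually_mem
      (c.open_target.mem_nhds (by rw [hfu]; exact c.map_source huc))
  have hfd (v : 𝔼) : fderiv ℝ f (planeIncl u) v = fderiv ℝ F u (planeProj v) + v 2 • n := by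
    have h1 : HasFDerivAt F (fderiv ℝ F u) (planeProj (planeIncl u)) := by
      rw [planeProj_planeIncl]
      exact (hF.self_of_nhds.differentiableAt (by simp)).hasFDerivAt
    have h2 := (h1.comp (planeIncl u) planeProj.hasFDerivAt).add
      ((EuclideanSpace.proj (𝕜 := ℝ) (2 : Fin 3)).hasFDerivAt.smul_const n)
    have h3 : HasFDerivAt f _ (planeIncl u) := h2
    rw [h3.fderiv]
    simp
  have hfinj : Function.Injective (fderiv ℝ f (planeIncl u)) := by
    rw [injective_iff_map_eq_zero]
    intro v hv
    rw [hfd] at hv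
    have hv2 : v 2 = 0 := by
      by_contra hne
      refine hn ⟨-(v 2)⁻¹ • planeProj v, ?_⟩
      have h1 : fderiv ℝ F u (planeProj v) = -(v 2 • n) := eq_neg_of_add_eq_zero_left hv
      simp [h1, smul_smul, hne]
    rw [hv2, zero_smul, add_zero] at hv
    have := hFinj (hv.trans (map_zero _).symm)
    rw [← planeIncl_planeProj hv2, this, map_zero]
  have hσ : ∀ᶠ y in 𝓝 (planeIncl u), ContMDiffAt (𝓡 3) (𝓡 3) ∞ (c.symm ∘ f) y := by
    filter_upwards [hf, hft] with y h1 h2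
    exact (hcs h2).comp y h1.contMDiffAt
  have hσinj : Function.Injective (mfderiv (𝓡 3) (𝓡 3) (c.symm ∘ f) (planeIncl u)) := by
    rw [mfderiv_comp _ ((hcs hft.self_of_nhds).mdifferentiableAt (by simp))
      (hf.self_of_nhds.differentiableAt (by simp)).mdifferentiableAt, mfderiv_eq_fderiv]
    exact (injective_mfderiv_chartAt_symm (κ u) hft.self_of_nhds).comp hfinj
  refine ⟨c.symm ∘ f, hσ, hσinj, ?_, hα.contactFn_pullback_ne_zero hσ hσinj⟩
  filter_upwards [hproj.eventually hsrc] with y h1 hy2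
  simp [f, F, hy2, c.left_inv h1]

/-- If the sign is wrong, composing with the reflection in the plane reverses it and leaves the
surface unchanged. -/
theorem exists_positive_slice_parametrization {α : OneForm M} (hα : IsContactForm α) {κ : 𝔼₂ → M}
    {u : 𝔼₂} (hκ : ∀ᶠ z in 𝓝 u, ContMDiffAt (𝓡 2) (𝓡 3) ∞ κ z)
    (hinj : Function.Injective (mfderiv (𝓡 2) (𝓡 3) κ u)) :
    ∃ σ : 𝔼 → M, (∀ᶠ y in 𝓝 (planeIncl u), ContMDiffAt (𝓡 3) (𝓡 3) ∞ σ y) ∧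
      Function.Injective (mfderiv (𝓡 3) (𝓡 3) σ (planeIncl u)) ∧
      (∀ᶠ y in 𝓝 (planeIncl u), y 2 = 0 → σ y = κ (planeProj y)) ∧
      0 < contactFn (α.pullback σ) (planeIncl u) := by
  obtain ⟨σ, h1, h2, h3, h4⟩ := exists_slice_parametrization hα hκ hinj
  rcases h4.lt_or_gt with h4 | h4
  swap
  · exact ⟨σ, h1, h2, h3, h4⟩
  have hR : planeReflection (planeIncl u) = planeIncl u :=
    planeReflection_apply_of_eq_zero (planeIncl_apply_two u)
  have hRt : Filter.Tendsto planeReflection (𝓝 (planeIncl u)) (𝓝 (planeIncl u)) := by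
    have := planeReflection.continuous.tendsto (planeIncl u)
    rwa [hR] at this
  have hRs (y : 𝔼) : ContDiffAt ℝ ∞ planeReflection y := planeReflection.contDiff.contDiffAt
  have hσ : ∀ᶠ y in 𝓝 (planeIncl u), ContMDiffAt (𝓡 3) (𝓡 3) ∞ (σ ∘ planeReflection) y := by
    filter_upwards [hRt.eventually h1] with y hy
    exact hy.comp y (hRs y).contMDiffAt
  refine ⟨σ ∘ planeReflection, hσ, ?_, ?_, ?_⟩
  · rw [mfderiv_comp _ (by rw [hR]; exact h1.self_of_nhds.mdifferentiableAt (by simp))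
      ((hRs _).differentiableAt (by simp)).mdifferentiableAt, mfderiv_eq_fderiv,
      ContinuousLinearMap.fderiv]
    have h2' : Function.Injective
        (mfderiv (𝓡 3) (𝓡 3) σ (planeReflection (planeIncl u))) := by rw [hR]; exact h2
    exact h2'.comp (Function.LeftInverse.injective planeReflection_planeReflection)
  · filter_upwards [h3] with y hy hy2
    rw [Function.comp_apply, planeReflection_apply_of_eq_zero hy2, hy hy2]
  · have heq : α.pullback (σ ∘ planeReflection) =ᶠ[𝓝 (planeIncl u)]
        pullbackForm planeReflection (α.pullback σ) := by
      filter_upwards [hRt.eventually h1] with y hy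
      exact α.pullback_comp (hy.mdifferentiableAt (by simp))
        ((hRs y).differentiableAt (by simp))
    rw [contactFn_congr heq, contactFn_pullbackForm (hRs _), hR]
    · refine mul_pos_of_neg_of_neg ?_ h4
      simp [planeReflection_apply]
    · rw [hR]
      exact (hα.1.contDiffAt_pullback h1.self_of_nhds).differentiableAt (by simp)
    · simp [planeReflection_apply]
    · simp [planeReflection_apply]

theorem exists_slice_chart {α : OneForm M} (hα : IsContactForm α) {κ : 𝔼₂ → M} {u : 𝔼₂}
    (hκ : ∀ᶠ z in 𝓝 u, ContMDiffAt (𝓡 2) (𝓡 3) ∞ κ z)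
    (hinj : Function.Injective (mfderiv (𝓡 2) (𝓡 3) κ u)) :
    ∃ σ : OpenPartialHomeomorph 𝔼 M, planeIncl u ∈ σ.source ∧
      (∀ y ∈ σ.source, ContMDiffAt (𝓡 3) (𝓡 3) ∞ σ y) ∧
      (∀ x ∈ σ.target, ContMDiffAt (𝓡 3) (𝓡 3) ∞ σ.symm x) ∧
      (∀ y ∈ σ.source, y 2 = 0 → σ y = κ (planeProj y)) ∧
      ∀ y ∈ σ.source, 0 < contactFn (α.pullback σ) y := by
  obtain ⟨σ, h1, h2, h3, h4⟩ := exists_positive_slice_parametrization hα hκ hinj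
  have h5 : ∀ᶠ y in 𝓝 (planeIncl u), 0 < contactFn (α.pullback σ) y :=
    (hα.1.contDiffAt_pullback h1.self_of_nhds).contactFn.continuousAt.eventually_const_lt h4
  obtain ⟨O, hO, hOo, huO⟩ := eventually_nhds_iff.1 (h1.and (h3.and h5))
  obtain ⟨g, hg1, hg2, hg3, hg4⟩ := exists_openPartialHomeomorph_of_injective_mfderiv hOo
    (fun y hy ↦ (hO y hy).1) huO h2
  have hgσ {y} (hy : y ∈ g.source) : g =ᶠ[𝓝 y] σ := by
    filter_upwards [g.open_source.mem_nhds hy] with z hz using hg3 hz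
  refine ⟨g, hg1, fun y hy ↦ (hO y (hg2 hy)).1.congr_of_eventuallyEq (hgσ hy), hg4,
    fun y hy hy2 ↦ (hg3 hy).trans ((hO y (hg2 hy)).2.1 hy2), fun y hy ↦ ?_⟩
  have heq : α.pullback g =ᶠ[𝓝 y] α.pullback σ := by
    filter_upwards [(hgσ hy).eventually_nhds] with z hz using α.pullback_congr hz
  rw [contactFn_congr heq]
  exact (hO y (hg2 hy)).2.2

end Slice

/-! ### From equal foliations to proportional characteristic forms. -/

section FoliationFactor

theorem eq_sum_single_plane (v : 𝔼₂) :
    v = v 0 • EuclideanSpace.single (0 : Fin 2) (1 : ℝ)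
      + v 1 • EuclideanSpace.single (1 : Fin 2) (1 : ℝ) := by
  ext i; fin_cases i <;> simp

theorem alternating_apply_eq_det_mul {E : Type*} [TopologicalSpace E] [AddCommGroup E] [Module ℝ E]
    (B : E →L[ℝ] E →L[ℝ] ℝ) (hB : ∀ v, B v v = 0) (T : 𝔼₂ →L[ℝ] E) (x v : 𝔼₂) :
    B (T x) (T v) = (x 0 * v 1 - x 1 * v 0)
      * B (T (EuclideanSpace.single 0 1)) (T (EuclideanSpace.single 1 1)) := by
  set t₀ := T (EuclideanSpace.single 0 1)
  set t₁ := T (EuclideanSpace.single 1 1)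
  have h : B t₁ t₀ = - B t₀ t₁ := by
    have := hB (t₀ + t₁)
    simp only [map_add, add_apply, hB] at this
    linarith
  have hT (v : 𝔼₂) : T v = v 0 • t₀ + v 1 • t₁ := by
    conv_lhs => rw [eq_sum_single_plane v]
    simp only [map_add, map_smul, t₀, t₁]
  rw [hT x, hT v]
  simp only [map_add, map_smul, add_apply, smul_apply, smul_eq_mul, hB, h]
  ring

variable {S : Type*} [TopologicalSpace S] [ChartedSpace 𝔼₂ S]

/-- The coefficient of the pull-back of a 2-form under a map from the plane. -/
noncomputable def BilinField.pullbackCoeff (Ω : BilinField S) (τ : 𝔼₂ → S) (u : 𝔼₂) : ℝ :=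
  Ω (τ u) (mfderiv (𝓡 2) (𝓡 2) τ u (EuclideanSpace.single 0 1))
    (mfderiv (𝓡 2) (𝓡 2) τ u (EuclideanSpace.single 1 1))

theorem BilinField.apply_mfderiv {Ω : BilinField S} {τ : 𝔼₂ → S} {u : 𝔼₂}
    (hΩ : ∀ v, Ω (τ u) v v = 0) (x v : 𝔼₂) :
    Ω (τ u) (mfderiv (𝓡 2) (𝓡 2) τ u x) (mfderiv (𝓡 2) (𝓡 2) τ u v)
      = (x 0 * v 1 - x 1 * v 0) * Ω.pullbackCoeff τ u :=
  alternating_apply_eq_det_mul (Ω (τ u)) hΩ (mfderiv (𝓡 2) (𝓡 2) τ u) x v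

variable [IsManifold (𝓡 2) ∞ S]

theorem IsAreaFormOn.contDiffAt_pullbackCoeff {Ω : BilinField S} {U : Set S}
    (hΩ : IsAreaFormOn Ω U) (hU : IsOpen U) {τ : 𝔼₂ → S} {u : 𝔼₂} (hu : τ u ∈ U)
    (hτ : ContMDiffAt (𝓡 2) (𝓡 2) ∞ τ u) : ContDiffAt ℝ ∞ (Ω.pullbackCoeff τ) u := by
  rw [← contMDiffAt_iff_contDiffAt]
  have h1 := (hΩ.smooth.contMDiffAt (hU.mem_nhds hu)).comp u hτ
  have h2 := ContMDiffAt.clm_bundle_apply₂ (E₃ := fun _ ↦ ℝ) (b := τ) (ψ := fun m ↦ Ω (τ m)) h1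
    (contMDiffAt_mfderiv_apply_const hτ (EuclideanSpace.single 0 1))
    (contMDiffAt_mfderiv_apply_const hτ (EuclideanSpace.single 1 1))
  exact (contMDiffAt_totalSpace.1 h2).2

theorem IsAreaFormOn.pullbackCoeff_ne_zero {Ω : BilinField S} {U : Set S}
    (hΩ : IsAreaFormOn Ω U) {τ : 𝔼₂ → S} {u : 𝔼₂} (hu : τ u ∈ U)
    (hτ : Function.Surjective (mfderiv (𝓡 2) (𝓡 2) τ u)) : Ω.pullbackCoeff τ u ≠ 0 := by
  intro h
  refine hΩ.ne_zero _ hu ?_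
  ext v w
  obtain ⟨v, rfl⟩ := hτ v
  obtain ⟨w, rfl⟩ := hτ w
  exact (BilinField.apply_mfderiv (hΩ.alternating _ hu) v w).trans (by rw [h, mul_zero]; rfl)

variable {M : Type*} [TopologicalSpace M] [ChartedSpace 𝔼 M]
  {S' : Type*} [TopologicalSpace S'] [ChartedSpace 𝔼₂ S'] [IsManifold (𝓡 2) ∞ S']
  {M' : Type*} [TopologicalSpace M'] [ChartedSpace 𝔼 M']

/-- Surfaces with the same oriented characteristic foliation have proportional
characteristic forms. -/
theorem PreservesOrientedCharFoliation.exists_factor {α₀ : OneForm M} {ι₀ : S → M}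
    {α₁ : OneForm M'} {ι₁ : S' → M'} {φ : S ≃ₘ^∞⟮𝓡 2, 𝓡 2⟯ S'}
    (hφ : PreservesOrientedCharFoliation α₀ ι₀ α₁ ι₁ φ) (hι₀ : MDifferentiable (𝓡 2) (𝓡 3) ι₀)
    (hι₁ : MDifferentiable (𝓡 2) (𝓡 3) ι₁) (p : S) {τ : 𝔼₂ → S} {u : 𝔼₂}
    (hτ : ∀ᶠ z in 𝓝 u, ContMDiffAt (𝓡 2) (𝓡 2) ∞ τ z ∧
      Function.Surjective (mfderiv (𝓡 2) (𝓡 2) τ z)) (hu : τ u = p) :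
    ∃ G : 𝔼₂ → ℝ, ∀ᶠ z in 𝓝 u, ContDiffAt ℝ ∞ G z ∧ G z ≠ 0 ∧
      α₀.pullback (ι₀ ∘ τ) z = G z • α₁.pullback (ι₁ ∘ φ ∘ τ) z := by
  obtain ⟨U, hU, hpU, Ω₀, Ω₁, X₀, X₁, f, hΩ₀, hΩ₁, hX₀, hX₁, hf, hfpos, hfX⟩ := hφ p
  have hU' : IsOpen (φ '' U) := φ.toHomeomorph.isOpenMap U hU
  have hτU : ∀ᶠ z in 𝓝 u, τ z ∈ U :=
    hτ.self_of_nhds.1.continuousAt.eventually_mem (hU.mem_nhds (hu ▸ hpU))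
  -- With `X₀ = Tτ(x)`, the two pull-backs `α₀` and `f α₁` are `det(x, ·)` times the coefficients of
  -- `Ω₀` and `Ω₁`. The factor is therefore a ratio of area coefficients times `f`, defined even
  -- where `X₀` vanishes.
  refine ⟨fun z ↦ f (τ z) * Ω₀.pullbackCoeff τ z / Ω₁.pullbackCoeff (φ ∘ τ) z, ?_⟩
  filter_upwards [hτ, hτU] with z ⟨hz, hsurj⟩ hzU
  have hzU' : (φ ∘ τ) z ∈ φ '' U := mem_image_of_mem φ hzU
  have hφz : MDifferentiableAt (𝓡 2) (𝓡 2) φ (τ z) := φ.contMDiff.mdifferentiable (by simp) _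
  have hz' : ContMDiffAt (𝓡 2) (𝓡 2) ∞ (φ ∘ τ) z := (φ.contMDiff _).comp z hz
  have hzd := hz.mdifferentiableAt (n := ∞) (by simp)
  have hcomp := mfderiv_comp z hφz hzd
  have hsurj' : Function.Surjective (mfderiv (𝓡 2) (𝓡 2) (φ ∘ τ) z) := by
    rw [hcomp]
    exact (φ.mfderivToContinuousLinearEquiv (by simp) (τ z)).surjective.comp hsurj
  have hω₀ := hΩ₀.pullbackCoeff_ne_zero hzU hsurj
  have hω₁ := hΩ₁.pullbackCoeff_ne_zero hzU' hsurj'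
  have hfz := hfpos _ hzU
  refine ⟨?_, ?_, ?_⟩
  · have h1 : ContDiffAt ℝ ∞ (f ∘ τ) z := by
      rw [← contMDiffAt_iff_contDiffAt]
      exact (hf.contMDiffAt (hU.mem_nhds hzU)).comp z hz
    exact (h1.mul (hΩ₀.contDiffAt_pullbackCoeff hU hzU hz)).div
      (hΩ₁.contDiffAt_pullbackCoeff hU' hzU' hz') hω₁
  · exact div_ne_zero (mul_ne_zero hfz.ne' hω₀) hω₁
  · ext v
    obtain ⟨(x : 𝔼₂), hx⟩ := hsurj (X₀ (τ z))
    have e0 : α₀.pullback (ι₀ ∘ τ) z v = (x 0 * v 1 - x 1 * v 0) * Ω₀.pullbackCoeff τ z := by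
      rw [OneForm.pullback, mfderiv_comp z (hι₀ _) hzd]
      have h1 := hX₀ (τ z) hzU (mfderiv (𝓡 2) (𝓡 2) τ z v)
      have h2 := congrArg (fun t ↦ Ω₀ (τ z) t (mfderiv (𝓡 2) (𝓡 2) τ z v)) hx
      exact h1.symm.trans (h2.symm.trans (BilinField.apply_mfderiv (hΩ₀.alternating _ hzU) x v))
    have e1 : f (τ z) * α₁.pullback (ι₁ ∘ φ ∘ τ) z v
        = (x 0 * v 1 - x 1 * v 0) * Ω₁.pullbackCoeff (φ ∘ τ) z := by
      rw [OneForm.pullback, mfderiv_comp z (hι₁ _) (hφz.comp z hzd)]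
      have h1 := hX₁ _ hzU' (mfderiv (𝓡 2) (𝓡 2) (φ ∘ τ) z v)
      have h2 : mfderiv (𝓡 2) (𝓡 2) (φ ∘ τ) z x = f (τ z) • X₁ (φ (τ z)) := by
        rw [hcomp, ← hfX _ hzU, ← hx]
        rfl
      have h3 := congrArg (fun t ↦ Ω₁ ((φ ∘ τ) z) t (mfderiv (𝓡 2) (𝓡 2) (φ ∘ τ) z v)) h2
      have h4 := BilinField.apply_mfderiv (τ := φ ∘ τ) (hΩ₁.alternating _ hzU') x v
      have h5 : Ω₁ ((φ ∘ τ) z) (f (τ z) • X₁ ((φ ∘ τ) z)) (mfderiv (𝓡 2) (𝓡 2) (φ ∘ τ) z v)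
          = f (τ z) * Ω₁ ((φ ∘ τ) z) (X₁ ((φ ∘ τ) z)) (mfderiv (𝓡 2) (𝓡 2) (φ ∘ τ) z v) := by
        rw [map_smul]; rfl
      exact (congrArg (f (τ z) * ·) h1).symm.trans (h5.symm.trans (h3.symm.trans h4))
    change _ = _ * α₁.pullback (ι₁ ∘ φ ∘ τ) z v
    rw [e0]
    field_simp
    linear_combination -e1

end FoliationFactor

/-! ### The transverse vector field matching the two forms. -/

section TransverseVector

/-- At a regular point, the value on `e₂` is adjusted by adding a multiple of a tangent vector on
which `b` does not vanish. At a singular point, `a ∧ da` and `b ∧ db` reduce to `a(e₂) D` and `b(e₂)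
D`, with the same tangential curl `D`; positivity of both makes `a(e₂) / b(e₂)` positive, and `e₂`
is rescaled by this ratio. -/
theorem exists_transverse_vector {a b : 𝔼 → 𝔼 →L[ℝ] ℝ} {y₀ : 𝔼}
    (ha : ∀ᶠ y in 𝓝 y₀, ContDiffAt ℝ ∞ a y) (hb : ∀ᶠ y in 𝓝 y₀, ContDiffAt ℝ ∞ b y)
    (hWa : 0 < contactFn a y₀) (hWb : 0 < contactFn b y₀) (hy₀ : y₀ 2 = 0)
    (hab : ∀ᶠ y in 𝓝 y₀, y 2 = 0 → ∀ v : 𝔼, v 2 = 0 → a y v = b y v) :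
    ∃ w : 𝔼 → 𝔼, ∀ᶠ y in 𝓝 y₀, ContDiffAt ℝ ∞ w y ∧ b y (w y) = a y (stdVec 2) ∧ 0 < w y 2 := by
  have hap (v : 𝔼) : ∀ᶠ y in 𝓝 y₀, ContDiffAt ℝ ∞ (fun y ↦ a y v) y := by
    filter_upwards [ha] with y hy using hy.clm_apply contDiffAt_const
  have hbp (v : 𝔼) : ∀ᶠ y in 𝓝 y₀, ContDiffAt ℝ ∞ (fun y ↦ b y v) y := by
    filter_upwards [hb] with y hy using hy.clm_apply contDiffAt_const
  by_cases hex : ∃ i : Fin 3, i ≠ 2 ∧ b y₀ (stdVec i) ≠ 0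
  · obtain ⟨i, hi, hne⟩ := hex
    refine ⟨fun y ↦ stdVec 2 + ((a y (stdVec 2) - b y (stdVec 2)) / b y (stdVec i)) • stdVec i, ?_⟩
    filter_upwards [hap (stdVec 2), hbp (stdVec 2), hbp (stdVec i),
      (hbp (stdVec i)).self_of_nhds.continuousAt.eventually_ne hne] with y h1 h2 h3 h4
    refine ⟨contDiffAt_const.add (((h1.sub h2).div h3 h4).smul contDiffAt_const), ?_, ?_⟩
    · simp only [map_add, map_smul, smul_eq_mul]
      field_simp
      ring
    · simp [hi.symm]
  · push Not at hex
    have hb0 := hex 0 (by decide)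
    have hb1 := hex 1 (by decide)
    have ha0 : a y₀ (stdVec 0) = 0 :=
      (hab.self_of_nhds hy₀ _ (stdVec_eq_zero_or (by decide))).trans hb0
    have ha1 : a y₀ (stdVec 1) = 0 :=
      (hab.self_of_nhds hy₀ _ (stdVec_eq_zero_or (by decide))).trans hb1
    have hd {i j : Fin 3} (hi : i ≠ 2) (hj : j ≠ 2) :
        fderiv ℝ a y₀ (stdVec i) (stdVec j) = fderiv ℝ b y₀ (stdVec i) (stdVec j) := by
      have h1 := ha.self_of_nhds.differentiableAt (by simp)
      have h2 := hb.self_of_nhds.differentiableAt (by simp)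
      have := fderiv_apply_eq_of_eq_on_plane (f := fun x ↦ a x (stdVec j))
        (g := fun x ↦ b x (stdVec j)) (h1.clm_apply (differentiableAt_const _))
        (h2.clm_apply (differentiableAt_const _)) hy₀
        (hab.mono fun x hx hx2 ↦ hx hx2 _ (stdVec_eq_zero_or hj)) (stdVec_eq_zero_or hi)
      rw [fderiv_clm_apply h1 (differentiableAt_const _),
        fderiv_clm_apply h2 (differentiableAt_const _)] at this
      simpa using this
    set D := fderiv ℝ b y₀ (stdVec 0) (stdVec 1) - fderiv ℝ b y₀ (stdVec 1) (stdVec 0) with hD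
    have hWa' : 0 < a y₀ (stdVec 2) * D := by
      rw [hD, ← hd (i := 0) (j := 1) (by decide) (by decide),
        ← hd (i := 1) (j := 0) (by decide) (by decide)]
      simpa [contactFn, contactCoeff, ha0, ha1] using hWa
    have hWb' : 0 < b y₀ (stdVec 2) * D := by
      rw [contactFn, contactCoeff, hb0, hb1] at hWb
      simpa using hWb
    have hq : 0 < a y₀ (stdVec 2) / b y₀ (stdVec 2) := by
      have := div_pos hWa' hWb'
      rwa [mul_div_mul_right _ _ (right_ne_zero_of_mul hWa'.ne')] at this
    have hqs : ∀ᶠ y in 𝓝 y₀, ContDiffAt ℝ ∞ (fun y ↦ a y (stdVec 2) / b y (stdVec 2)) y ∧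
        b y (stdVec 2) ≠ 0 := by
      filter_upwards [hap (stdVec 2), hbp (stdVec 2),
        (hbp (stdVec 2)).self_of_nhds.continuousAt.eventually_ne (left_ne_zero_of_mul hWb'.ne')]
        with y h1 h2 h3 using ⟨h1.div h2 h3, h3⟩
    refine ⟨fun y ↦ (a y (stdVec 2) / b y (stdVec 2)) • stdVec 2, ?_⟩
    filter_upwards [hqs, hqs.self_of_nhds.1.continuousAt.eventually_const_lt hq] with y h1 h2
    refine ⟨h1.1.smul contDiffAt_const, ?_, ?_⟩
    · rw [map_smul, smul_eq_mul, div_mul_cancel₀ _ h1.2]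
    · simpa using h2

end TransverseVector

/-! ### Adapted charts of both manifolds near a surface point. -/

section SurfaceCharts

variable {M₀ M₁ S : Type*} [TopologicalSpace M₀] [ChartedSpace 𝔼 M₀]
  [TopologicalSpace M₁] [ChartedSpace 𝔼 M₁]

theorem OneForm.pullback_slice_apply (α : OneForm M₀) {σ : 𝔼 → M₀} {κ : 𝔼₂ → M₀} {y v : 𝔼}
    (hσ : ContMDiffAt (𝓡 3) (𝓡 3) ∞ σ y) (h : ∀ᶠ x in 𝓝 y, x 2 = 0 → σ x = κ (planeProj x))
    (hy : y 2 = 0) (hv : v 2 = 0) :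
    α.pullback κ (planeProj y) (planeProj v) = α.pullback σ y v := by
  have hyy := planeIncl_planeProj hy
  have ht : Filter.Tendsto planeIncl (𝓝 (planeProj y)) (𝓝 y) := by
    have := planeIncl.continuous.tendsto (planeProj y)
    rwa [hyy] at this
  have h1 : κ =ᶠ[𝓝 (planeProj y)] σ ∘ planeIncl := by
    filter_upwards [ht.eventually h] with z hz
    rw [Function.comp_apply, hz (planeIncl_apply_two z), planeProj_planeIncl]
  rw [α.pullback_congr h1, α.pullback_comp (by rw [hyy]; exact hσ.mdifferentiableAt (by simp))
    planeIncl.differentiableAt, ContinuousLinearMap.fderiv, hyy, ContinuousLinearMap.comp_apply,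
    planeIncl_planeProj hv]

theorem comp_chartAt_symm [IsManifold (𝓡 3) ∞ M₀] [TopologicalSpace S] [ChartedSpace 𝔼₂ S]
    [IsManifold (𝓡 2) ∞ S] {κ : S → M₀} (p : S)
    (hκ : ∀ q, ContMDiffAt (𝓡 2) (𝓡 3) ∞ κ q)
    (hinj : ∀ q, Function.Injective (mfderiv (𝓡 2) (𝓡 3) κ q)) :
    (∀ᶠ z in 𝓝 (chartAt 𝔼₂ p p),
      ContMDiffAt (𝓡 2) (𝓡 3) ∞ (κ ∘ (chartAt 𝔼₂ p).symm) z) ∧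
      Function.Injective (mfderiv (𝓡 2) (𝓡 3) (κ ∘ (chartAt 𝔼₂ p).symm) (chartAt 𝔼₂ p p)) := by
  have hτ {z} (hz : z ∈ (chartAt 𝔼₂ p).target) :
      ContMDiffAt (𝓡 2) (𝓡 2) ∞ (chartAt 𝔼₂ p).symm z :=
    contMDiffAt_symm_of_mem_maximalAtlas (IsManifold.chart_mem_maximalAtlas p) hz
  have huc := mem_chart_target 𝔼₂ p
  have htar : ∀ᶠ z in 𝓝 (chartAt 𝔼₂ p p), z ∈ (chartAt 𝔼₂ p).target :=
    (chartAt 𝔼₂ p).open_target.mem_nhds huc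
  refine ⟨htar.mono fun z hz ↦ (hκ _).comp z (hτ hz), ?_⟩
  rw [mfderiv_comp _ ((hκ _).mdifferentiableAt (by simp)) ((hτ huc).mdifferentiableAt (by simp))]
  exact (hinj _).comp (injective_mfderiv_chartAt_symm p huc)

/-- Local parametrizations `σ₀`, `σ₁` of two 3-manifolds near a point `p` of a common surface `S`,
in which the surface is the plane `x₂ = 0`, parametrized by `s`, and the forms `α₀` and
`factor • α₁` have the same restriction to that plane. -/
structure SurfaceCharts (α₀ : OneForm M₀) (ι₀ : S → M₀) (α₁ : OneForm M₁) (ι₁ : S → M₁)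
    (p : S) where
  σ₀ : OpenPartialHomeomorph 𝔼 M₀
  σ₁ : OpenPartialHomeomorph 𝔼 M₁
  s : 𝔼 → S
  center : 𝔼
  radius : ℝ
  factor : 𝔼 → ℝ
  transverse : 𝔼 → 𝔼
  radius_pos : 0 < radius
  ball_subset_source₀ : Metric.ball center radius ⊆ σ₀.source
  ball_subset_source₁ : Metric.ball center radius ⊆ σ₁.source
  contMDiffAt₀ : ∀ y ∈ σ₀.source, ContMDiffAt (𝓡 3) (𝓡 3) ∞ σ₀ y
  contMDiffAt₁ : ∀ y ∈ σ₁.source, ContMDiffAt (𝓡 3) (𝓡 3) ∞ σ₁ y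
  contMDiffAt_symm₀ : ∀ x ∈ σ₀.target, ContMDiffAt (𝓡 3) (𝓡 3) ∞ σ₀.symm x
  contMDiffAt_symm₁ : ∀ x ∈ σ₁.target, ContMDiffAt (𝓡 3) (𝓡 3) ∞ σ₁.symm x
  contDiffOn₀ : ContDiffOn ℝ ∞ (α₀.pullback σ₀) (Metric.ball center radius)
  contDiffOn₁ : ContDiffOn ℝ ∞ (fun y ↦ factor y • α₁.pullback σ₁ y) (Metric.ball center radius)
  contactFn_pos₀ : ∀ y ∈ Metric.ball center radius, 0 < contactFn (α₀.pullback σ₀) y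
  contactFn_pos₁ : ∀ y ∈ Metric.ball center radius,
    0 < contactFn (fun y ↦ factor y • α₁.pullback σ₁ y) y
  factor_ne_zero : ∀ y ∈ Metric.ball center radius, factor y ≠ 0
  apply_tangent : ∀ y ∈ Metric.ball center radius, y 2 = 0 → ∀ v : 𝔼, v 2 = 0 →
    α₀.pullback σ₀ y v = (factor y • α₁.pullback σ₁ y) v
  contDiffOn_transverse : ContDiffOn ℝ ∞ transverse (Metric.ball center radius)
  apply_transverse : ∀ y ∈ Metric.ball center radius, y 2 = 0 →
    (factor y • α₁.pullback σ₁ y) (transverse y) = α₀.pullback σ₀ y (stdVec 2) ∧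
      0 < transverse y 2
  apply₀ : ∀ y ∈ Metric.ball center radius, y 2 = 0 → σ₀ y = ι₀ (s y)
  apply₁ : ∀ y ∈ Metric.ball center radius, y 2 = 0 → σ₁ y = ι₁ (s y)
  symm_apply₀ : ∀ q, ι₀ q ∈ σ₀.target → σ₀.symm (ι₀ q) ∈ Metric.ball center radius →
    σ₀.symm (ι₀ q) 2 = 0 ∧ s (σ₀.symm (ι₀ q)) = q
  mem_target : ι₀ p ∈ σ₀.target
  symm_apply_self : σ₀.symm (ι₀ p) = center

variable {S₁ : Type*} [IsManifold (𝓡 3) ∞ M₀] [IsManifold (𝓡 3) ∞ M₁]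
  [TopologicalSpace S] [ChartedSpace 𝔼₂ S] [IsManifold (𝓡 2) ∞ S]
  [TopologicalSpace S₁] [ChartedSpace 𝔼₂ S₁] [IsManifold (𝓡 2) ∞ S₁]

theorem PreservesOrientedCharFoliation.nonempty_surfaceCharts {α₀ : OneForm M₀}
    (hα₀ : IsContactForm α₀) {α₁ : OneForm M₁} (hα₁ : IsContactForm α₁)
    {ι₀ : S → M₀} (hι₀ : IsSmoothEmbedding (𝓡 2) (𝓡 3) ∞ ι₀)
    {ι₁ : S₁ → M₁} (hι₁ : IsSmoothEmbedding (𝓡 2) (𝓡 3) ∞ ι₁) {φ : S ≃ₘ^∞⟮𝓡 2, 𝓡 2⟯ S₁}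
    (hφ : PreservesOrientedCharFoliation α₀ ι₀ α₁ ι₁ φ) (p : S) :
    Nonempty (SurfaceCharts α₀ ι₀ α₁ (ι₁ ∘ φ) p) := by
  set c := chartAt 𝔼₂ p
  have hpc : p ∈ c.source := mem_chart_source 𝔼₂ p
  set u : 𝔼₂ := c p
  have huc : u ∈ c.target := c.map_source hpc
  have hτ {z} (hz : z ∈ c.target) : ContMDiffAt (𝓡 2) (𝓡 2) ∞ c.symm z :=
    contMDiffAt_symm_of_mem_maximalAtlas (IsManifold.chart_mem_maximalAtlas p) hz
  have htar : ∀ᶠ z in 𝓝 u, z ∈ c.target := c.open_target.mem_nhds huc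
  have hφc (q : S) : ContMDiffAt (𝓡 2) (𝓡 2) ∞ φ q := φ.contMDiff q
  have hι₁φ (q : S) : ContMDiffAt (𝓡 2) (𝓡 3) ∞ (ι₁ ∘ φ) q := (hι₁.contMDiff _).comp q (hφc q)
  have hι₁φinj (q : S) : Function.Injective (mfderiv (𝓡 2) (𝓡 3) (ι₁ ∘ φ) q) := by
    rw [mfderiv_comp q ((hι₁.contMDiff _).mdifferentiableAt (by simp))
      ((hφc q).mdifferentiableAt (by simp))]
    exact (IsImmersionAt.injective_mfderiv (hι₁.isImmersion.isImmersionAt _)).comp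
      (φ.mfderivToContinuousLinearEquiv (by simp) q).injective
  obtain ⟨h01, h02⟩ := comp_chartAt_symm p hι₀.contMDiff
    fun q ↦ IsImmersionAt.injective_mfderiv (hι₀.isImmersion.isImmersionAt q)
  obtain ⟨h11, h12⟩ := comp_chartAt_symm p hι₁φ hι₁φinj
  obtain ⟨σ₀, hu₀, hσ₀, hσ₀', hp₀, hW₀⟩ := exists_slice_chart hα₀ h01 h02
  obtain ⟨σ₁, hu₁, hσ₁, hσ₁', hp₁, hW₁⟩ := exists_slice_chart hα₁ h11 h12
  obtain ⟨G, hG⟩ := hφ.exists_factor (hι₀.contMDiff.mdifferentiable (by simp))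
    (hι₁.contMDiff.mdifferentiable (by simp)) p (τ := c.symm) (u := u)
    (htar.mono fun z hz ↦ ⟨hτ hz, (mdifferentiable_chart p).symm.mfderiv_surjective hz⟩)
    (c.left_inv hpc)
  set y₀ : 𝔼 := planeIncl u
  have hy₀ : y₀ 2 = 0 := planeIncl_apply_two u
  have hproj : Filter.Tendsto planeProj (𝓝 y₀) (𝓝 u) := by
    have := planeProj.continuous.tendsto y₀
    rwa [planeProj_planeIncl] at this
  have hG' := hproj.eventually hG
  have hs₀ : ∀ᶠ y in 𝓝 y₀, y ∈ σ₀.source := σ₀.open_source.mem_nhds hu₀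
  have hs₁ : ∀ᶠ y in 𝓝 y₀, y ∈ σ₁.source := σ₁.open_source.mem_nhds hu₁
  set a : 𝔼 → 𝔼 →L[ℝ] ℝ := α₀.pullback σ₀
  set b : 𝔼 → 𝔼 →L[ℝ] ℝ := fun y ↦ G (planeProj y) • α₁.pullback σ₁ y
  have ha : ∀ᶠ y in 𝓝 y₀, ContDiffAt ℝ ∞ a y :=
    hs₀.mono fun y hy ↦ hα₀.1.contDiffAt_pullback (hσ₀ y hy)
  have hGs : ∀ᶠ y in 𝓝 y₀, ContDiffAt ℝ ∞ (fun y ↦ G (planeProj y)) y :=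
    hG'.mono fun y hy ↦ hy.1.comp y planeProj.contDiff.contDiffAt
  have hb : ∀ᶠ y in 𝓝 y₀, ContDiffAt ℝ ∞ b y := by
    filter_upwards [hGs, hs₁] with y h1 h2 using h1.smul (hα₁.1.contDiffAt_pullback (hσ₁ y h2))
  have hWb : ∀ᶠ y in 𝓝 y₀, 0 < contactFn b y := by
    filter_upwards [hGs, hG', hs₁] with y h1 h2 h3
    rw [contactFn_smul ((hα₁.1.contDiffAt_pullback (hσ₁ y h3)).differentiableAt (by simp))
      (h1.differentiableAt (by simp))]
    exact mul_pos (by have := h2.2.1; positivity) (hW₁ y h3)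
  have hab : ∀ᶠ y in 𝓝 y₀, y 2 = 0 → ∀ v : 𝔼, v 2 = 0 → a y v = b y v := by
    filter_upwards [hG', hs₀, hs₁] with y h1 h2 h3 hy v hv
    rw [← α₀.pullback_slice_apply (κ := ι₀ ∘ c.symm) (hσ₀ y h2)
      (by filter_upwards [σ₀.open_source.mem_nhds h2] with x hx using hp₀ x hx) hy hv, h1.2.2]
    exact congrArg (G (planeProj y) * ·) (α₁.pullback_slice_apply (κ := (ι₁ ∘ φ) ∘ c.symm) (hσ₁ y h3)
      (by filter_upwards [σ₁.open_source.mem_nhds h3] with x hx using hp₁ x hx) hy hv)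
  obtain ⟨w, hw⟩ := exists_transverse_vector ha hb (hW₀ _ hu₀) hWb.self_of_nhds hy₀ hab
  set N : Set S := c.source ∩ c ⁻¹' (planeIncl ⁻¹' σ₀.source)
  have hN : IsOpen N := c.isOpen_inter_preimage (σ₀.open_source.preimage planeIncl.continuous)
  -- Here the embedding property enters: `O` meets the surface only in the sheet seen by the chart,
  -- so other parts of the surface do not return to the ball.
  obtain ⟨O, hO, hON⟩ := hι₀.isEmbedding.isOpen_iff.1 hN
  have hpN : p ∈ N := ⟨hpc, hu₀⟩
  have hσ₀N {q : S} (hq : q ∈ N) : σ₀ (planeIncl (c q)) = ι₀ q := by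
    rw [hp₀ _ hq.2 (planeIncl_apply_two _), planeProj_planeIncl, Function.comp_apply,
      c.left_inv hq.1]
  have hσ₀N' {q : S} (hq : q ∈ N) : σ₀.symm (ι₀ q) = planeIncl (c q) := by
    rw [← hσ₀N hq, σ₀.left_inv hq.2]
  have hOy : ∀ᶠ y in 𝓝 y₀, σ₀ y ∈ O := by
    refine (σ₀.continuousAt hu₀).eventually_mem (hO.mem_nhds ?_)
    rw [hσ₀N hpN]
    exact (hON ▸ hpN : p ∈ ι₀ ⁻¹' O)
  obtain ⟨r, hr, hball⟩ := Metric.eventually_nhds_iff_ball.1 (hs₀.and (hs₁.and (ha.and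
    (hb.and (hWb.and (hG'.and (hab.and (hw.and hOy))))))))
  exact ⟨{
    σ₀ := σ₀, σ₁ := σ₁, s := c.symm ∘ planeProj, center := y₀, radius := r
    factor := fun y ↦ G (planeProj y), transverse := w, radius_pos := hr
    ball_subset_source₀ := fun y hy ↦ (hball y hy).1
    ball_subset_source₁ := fun y hy ↦ (hball y hy).2.1
    contMDiffAt₀ := hσ₀, contMDiffAt₁ := hσ₁, contMDiffAt_symm₀ := hσ₀', contMDiffAt_symm₁ := hσ₁'
    contDiffOn₀ := fun y hy ↦ (hball y hy).2.2.1.contDiffWithinAt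
    contDiffOn₁ := fun y hy ↦ (hball y hy).2.2.2.1.contDiffWithinAt
    contactFn_pos₀ := fun y hy ↦ hW₀ y (hball y hy).1
    contactFn_pos₁ := fun y hy ↦ (hball y hy).2.2.2.2.1
    factor_ne_zero := fun y hy ↦ (hball y hy).2.2.2.2.2.1.2.1
    apply_tangent := fun y hy ↦ (hball y hy).2.2.2.2.2.2.1
    contDiffOn_transverse := fun y hy ↦ (hball y hy).2.2.2.2.2.2.2.1.1.contDiffWithinAt
    apply_transverse := fun y hy _ ↦ (hball y hy).2.2.2.2.2.2.2.1.2
    apply₀ := fun y hy ↦ hp₀ y (hball y hy).1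
    apply₁ := fun y hy ↦ hp₁ y (hball y hy).2.1
    symm_apply₀ := fun q hq hqb ↦ by
      have h1 : ι₀ q ∈ O := by
        have := (hball _ hqb).2.2.2.2.2.2.2.2
        rwa [σ₀.right_inv hq] at this
      have h2 : q ∈ N := hON ▸ (h1 : q ∈ ι₀ ⁻¹' O)
      rw [hσ₀N' h2, Function.comp_apply, planeProj_planeIncl, c.left_inv h2.1]
      exact ⟨planeIncl_apply_two _, rfl⟩
    mem_target := by rw [← hσ₀N hpN]; exact σ₀.map_source hu₀
    symm_apply_self := hσ₀N' hpN }⟩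

end SurfaceCharts

/-! ### Patching contact extensions along the surface. -/

section ContactExtension

variable {M₀ M₁ S : Type*} [TopologicalSpace M₀] [ChartedSpace 𝔼 M₀]
  [TopologicalSpace M₁] [ChartedSpace 𝔼 M₁]

/-- Near `x`, the map `ψ` is a local diffeomorphism which maps the contact planes of `α₀` to those
of `α₁` and extends the identification `ι₀ q ↦ ι₁ q` of the surfaces. -/
def IsContactExtensionAt (α₀ : OneForm M₀) (ι₀ : S → M₀) (α₁ : OneForm M₁) (ι₁ : S → M₁)
    (ψ : M₀ → M₁) (x : M₀) : Prop :=
  ∀ᶠ z in 𝓝 x, ContMDiffAt (𝓡 3) (𝓡 3) ∞ ψ z ∧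
    Function.Injective (mfderiv (𝓡 3) (𝓡 3) ψ z) ∧
    (∀ v, α₀ z v = 0 ↔ α₁ (ψ z) (mfderiv (𝓡 3) (𝓡 3) ψ z v) = 0) ∧
    ∀ q, ι₀ q = z → ψ z = ι₁ q

theorem OneForm.apply_mfderiv_congr (α₁ : OneForm M₁) {ψ ψ' : M₀ → M₁} {x : M₀}
    (h : ψ' =ᶠ[𝓝 x] ψ) (v : TangentSpace (𝓡 3) x) :
    α₁ (ψ' x) (mfderiv (𝓡 3) (𝓡 3) ψ' x v) = α₁ (ψ x) (mfderiv (𝓡 3) (𝓡 3) ψ x v) := by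
  rw [h.mfderiv_eq]
  have := h.self_of_nhds
  congr!

theorem IsContactExtensionAt.congr {α₀ : OneForm M₀} {ι₀ : S → M₀} {α₁ : OneForm M₁} {ι₁ : S → M₁}
    {ψ ψ' : M₀ → M₁} {x : M₀} (h : IsContactExtensionAt α₀ ι₀ α₁ ι₁ ψ x) (he : ψ' =ᶠ[𝓝 x] ψ) :
    IsContactExtensionAt α₀ ι₀ α₁ ι₁ ψ' x := by
  filter_upwards [h, he.eventually_nhds] with z hz hez
  replace hez : ψ' =ᶠ[𝓝 z] ψ := hez
  refine ⟨hz.1.congr_of_eventuallyEq hez, ?_, fun v ↦ ?_, fun q hq ↦ ?_⟩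
  · rw [hez.mfderiv_eq]
    exact hz.2.1
  · rw [α₁.apply_mfderiv_congr hez]
    exact hz.2.2.1 v
  · rw [hez.self_of_nhds]
    exact hz.2.2.2 q hq

theorem OneForm.apply_mfderiv_of_semiconj (α₁ : OneForm M₁) {ψ : M₀ → M₁} {Θ : 𝔼 → 𝔼} {σ₀ : 𝔼 → M₀}
    {σ₁ : 𝔼 → M₁} {y : 𝔼} (h : ψ ∘ σ₀ =ᶠ[𝓝 y] σ₁ ∘ Θ)
    (hψ : MDifferentiableAt (𝓡 3) (𝓡 3) ψ (σ₀ y)) (hσ₀ : MDifferentiableAt (𝓡 3) (𝓡 3) σ₀ y)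
    (hσ₁ : MDifferentiableAt (𝓡 3) (𝓡 3) σ₁ (Θ y)) (hΘ : DifferentiableAt ℝ Θ y) (v : 𝔼) :
    α₁ (ψ (σ₀ y)) (mfderiv (𝓡 3) (𝓡 3) ψ (σ₀ y) (mfderiv (𝓡 3) (𝓡 3) σ₀ y v))
      = α₁.pullback σ₁ (Θ y) (fderiv ℝ Θ y v) := by
  have h1 := DFunLike.congr_fun (α₁.pullback_congr h) v
  rw [α₁.pullback_comp hσ₁ hΘ, OneForm.pullback, mfderiv_comp y hψ hσ₀] at h1
  exact h1

namespace SurfaceCharts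

variable {α₀ : OneForm M₀} {ι₀ : S → M₀} {α₁ : OneForm M₁} {ι₁ : S → M₁} {p : S}
  (C : SurfaceCharts α₀ ι₀ α₁ ι₁ p)

theorem mdifferentiable₀ : C.σ₀.MDifferentiable (𝓡 3) (𝓡 3) :=
  ⟨fun y hy ↦ ((C.contMDiffAt₀ y hy).mdifferentiableAt (by simp)).mdifferentiableWithinAt,
    fun y hy ↦ ((C.contMDiffAt_symm₀ y hy).mdifferentiableAt (by simp)).mdifferentiableWithinAt⟩

theorem mdifferentiable₁ : C.σ₁.MDifferentiable (𝓡 3) (𝓡 3) :=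
  ⟨fun y hy ↦ ((C.contMDiffAt₁ y hy).mdifferentiableAt (by simp)).mdifferentiableWithinAt,
    fun y hy ↦ ((C.contMDiffAt_symm₁ y hy).mdifferentiableAt (by simp)).mdifferentiableWithinAt⟩

/-- The pull-back of `α₀` in surface charts. -/
noncomputable def form₀ (y : 𝔼) : 𝔼 →L[ℝ] ℝ := α₀.pullback C.σ₀ y

/-- The rescaled pull-back of `α₁` in surface charts. -/
noncomputable def form₁ (y : 𝔼) : 𝔼 →L[ℝ] ℝ := C.factor y • α₁.pullback C.σ₁ y

theorem form₁_apply_eq_zero_iff {y : 𝔼} (hy : y ∈ Metric.ball C.center C.radius) (v : 𝔼) :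
    C.form₁ y v = 0 ↔ α₁.pullback C.σ₁ y v = 0 := by
  simp [form₁, C.factor_ne_zero y hy]

theorem eventually_mem_ball {y : 𝔼} (hy : y ∈ Metric.ball C.center C.radius) :
    ∀ᶠ x in 𝓝 y, x ∈ Metric.ball C.center C.radius := Metric.isOpen_ball.mem_nhds hy

theorem isContactGerm {ψ : M₀ → M₁} {y : 𝔼} (hy : y ∈ Metric.ball C.center C.radius)
    (hy2 : y 2 = 0) (h : IsContactExtensionAt α₀ ι₀ α₁ ι₁ ψ (C.σ₀ y)) :
    IsContactGerm C.form₀ C.form₁ (C.σ₁.symm ∘ ψ ∘ C.σ₀) y := by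
  have hσ₀c := (C.contMDiffAt₀ y (C.ball_subset_source₀ hy)).continuousAt
  have hψy : ψ (C.σ₀ y) = C.σ₁ y := by
    rw [C.apply₁ y hy hy2]
    exact h.self_of_nhds.2.2.2 _ (C.apply₀ y hy hy2).symm
  have hψc : ContinuousAt (ψ ∘ C.σ₀) y := h.self_of_nhds.1.continuousAt.comp hσ₀c
  have hcont : ContinuousAt (C.σ₁.symm ∘ ψ ∘ C.σ₀) y := by
    refine ContinuousAt.comp ?_ hψc
    rw [Function.comp_apply, hψy]
    exact (C.contMDiffAt_symm₁ _ (C.σ₁.map_source (C.ball_subset_source₁ hy))).continuousAt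
  have htar : ∀ᶠ x in 𝓝 y, ψ (C.σ₀ x) ∈ C.σ₁.target :=
    hψc.eventually_mem (C.σ₁.open_target.mem_nhds (by
      rw [Function.comp_apply, hψy]
      exact C.σ₁.map_source (C.ball_subset_source₁ hy)))
  have hball : ∀ᶠ x in 𝓝 y, C.σ₁.symm (ψ (C.σ₀ x)) ∈ Metric.ball C.center C.radius :=
    hcont.eventually_mem (Metric.isOpen_ball.mem_nhds (by
      rw [Function.comp_apply, Function.comp_apply, hψy, C.σ₁.left_inv (C.ball_subset_source₁ hy)]
      exact hy))
  filter_upwards [hσ₀c.eventually h, C.eventually_mem_ball hy, htar.eventually_nhds, htar, hball]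
    with x h1 hx h2 h3 h4
  have hxs := C.ball_subset_source₀ hx
  have hs₀ := C.contMDiffAt₀ x hxs
  have hs₁ := C.contMDiffAt_symm₁ _ h3
  have hs : ContMDiffAt (𝓡 3) (𝓡 3) ∞ (C.σ₁.symm ∘ ψ ∘ C.σ₀) x := hs₁.comp x (h1.1.comp x hs₀)
  have hs₀d := hs₀.mdifferentiableAt (n := ∞) (by simp)
  have hψd := h1.1.mdifferentiableAt (n := ∞) (by simp)
  refine ⟨hs.contDiffAt, ?_, fun v ↦ ?_, fun hx2 ↦ ?_⟩
  · rw [← mfderiv_eq_fderiv, mfderiv_comp x (hs₁.mdifferentiableAt (by simp)) (hψd.comp x hs₀d),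
      mfderiv_comp x hψd hs₀d]
    have i1 := C.mdifferentiable₀.mfderiv_injective hxs
    have i2 := h1.2.1
    have i3 : Function.Injective (mfderiv (𝓡 3) (𝓡 3) C.σ₁.symm ((ψ ∘ C.σ₀) x)) :=
      C.mdifferentiable₁.symm.mfderiv_injective h3
    exact fun u v huv ↦ i1 (i2 (i3 huv))
  · have hsemi : ψ ∘ C.σ₀ =ᶠ[𝓝 x] C.σ₁ ∘ (C.σ₁.symm ∘ ψ ∘ C.σ₀) := by
      filter_upwards [h2] with z hz
      exact (C.σ₁.right_inv hz).symm
    have hkey := α₁.apply_mfderiv_of_semiconj hsemi hψd hs₀d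
      ((C.contMDiffAt₁ _ (C.ball_subset_source₁ h4)).mdifferentiableAt (by simp))
      (hs.contDiffAt.differentiableAt (by simp)) v
    refine (h1.2.2.1 (mfderiv (𝓡 3) (𝓡 3) C.σ₀ x v)).trans ?_
    rw [hkey]
    exact (C.form₁_apply_eq_zero_iff h4 _).symm
  · have := h1.2.2.2 _ (C.apply₀ x hx hx2).symm
    rw [Function.comp_apply, Function.comp_apply, this, ← C.apply₁ x hx hx2,
      C.σ₁.left_inv (C.ball_subset_source₁ hx)]

theorem isContactExtensionAt {Θ : 𝔼 → 𝔼} {y : 𝔼} (hy : y ∈ Metric.ball C.center C.radius)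
    (hy2 : y 2 = 0) (h : IsContactGerm C.form₀ C.form₁ Θ y) :
    IsContactExtensionAt α₀ ι₀ α₁ ι₁ (C.σ₁ ∘ Θ ∘ C.σ₀.symm) (C.σ₀ y) := by
  have hys := C.ball_subset_source₀ hy
  have hyt := C.σ₀.map_source hys
  have hinv : C.σ₀.symm (C.σ₀ y) = y := C.σ₀.left_inv hys
  have hsymm : Filter.Tendsto C.σ₀.symm (𝓝 (C.σ₀ y)) (𝓝 y) := by
    have := (C.contMDiffAt_symm₀ _ hyt).continuousAt.tendsto
    rwa [hinv] at this
  have hΘy : ∀ᶠ x in 𝓝 y, Θ x ∈ Metric.ball C.center C.radius :=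
    h.self_of_nhds.1.continuousAt.eventually_mem (Metric.isOpen_ball.mem_nhds (by
      rw [h.self_of_nhds.2.2.2 hy2]; exact hy))
  filter_upwards [hsymm.eventually h, hsymm.eventually hΘy,
    hsymm.eventually (C.eventually_mem_ball hy), C.σ₀.open_target.mem_nhds hyt] with x h1 h2 h3 hx
  obtain ⟨z, hz, rfl⟩ : ∃ z ∈ C.σ₀.source, C.σ₀ z = x :=
    ⟨C.σ₀.symm x, C.σ₀.map_target hx, C.σ₀.right_inv hx⟩
  have hzz : C.σ₀.symm (C.σ₀ z) = z := C.σ₀.left_inv hz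
  have hss := C.contMDiffAt_symm₀ _ hx
  have hs₁ := C.contMDiffAt₁ _ (C.ball_subset_source₁ h2)
  have hs : ContMDiffAt (𝓡 3) (𝓡 3) ∞ (C.σ₁ ∘ Θ ∘ C.σ₀.symm) (C.σ₀ z) :=
    ContMDiffAt.comp (g := C.σ₁) (f := Θ ∘ C.σ₀.symm) _ hs₁ (h1.1.contMDiffAt.comp _ hss)
  have hssd := hss.mdifferentiableAt (n := ∞) (by simp)
  have hs₁d := hs₁.mdifferentiableAt (n := ∞) (by simp)
  have hΘd := h1.1.differentiableAt (n := ∞) (by simp)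
  refine ⟨hs, ?_, fun v ↦ ?_, fun q hq ↦ ?_⟩
  · rw [mfderiv_comp (g := C.σ₁) (f := Θ ∘ C.σ₀.symm) (C.σ₀ z) hs₁d
        (hΘd.mdifferentiableAt.comp _ hssd),
      mfderiv_comp _ hΘd.mdifferentiableAt hssd, mfderiv_eq_fderiv]
    have i1 := C.mdifferentiable₀.symm.mfderiv_injective hx
    have i2 := h1.2.1
    have i3 : Function.Injective (mfderiv (𝓡 3) (𝓡 3) C.σ₁ ((Θ ∘ C.σ₀.symm) (C.σ₀ z))) :=
      C.mdifferentiable₁.mfderiv_injective (C.ball_subset_source₁ h2)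
    exact fun u v huv ↦ i1 (i2 (i3 huv))
  · rw [hzz] at h1 h2 h3 hs₁d hΘd
    obtain ⟨(v : 𝔼), rfl⟩ := C.mdifferentiable₀.mfderiv_surjective hz v
    have hsemi : (C.σ₁ ∘ Θ ∘ C.σ₀.symm) ∘ C.σ₀ =ᶠ[𝓝 z] C.σ₁ ∘ Θ := by
      filter_upwards [C.σ₀.open_source.mem_nhds hz] with z' hz'
      simp [C.σ₀.left_inv hz']
    have hkey := α₁.apply_mfderiv_of_semiconj hsemi (hs.mdifferentiableAt (by simp))
      ((C.contMDiffAt₀ _ hz).mdifferentiableAt (by simp)) hs₁d hΘd v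
    rw [hkey, ← C.form₁_apply_eq_zero_iff h2]
    exact h1.2.2.1 v
  · rw [← hq] at h1 h3 hx ⊢
    obtain ⟨h4, h5⟩ := C.symm_apply₀ q hx h3
    rw [Function.comp_apply, Function.comp_apply, h1.2.2.2 h4, C.apply₁ _ h3 h4, h5]

/-- The extended map is defined piecewise and may be discontinuous, because only its germs at the
listed surface points matter. At points of `K` on the boundary of the patch both pieces have the
same germ, since the new local map equals the old one near `K'`. -/
theorem exists_extension [T2Space M₀] [TopologicalSpace S] (hι₀ : Continuous ι₀) {K : Set S}
    (hK : IsCompact K) {ψ : M₀ → M₁} (hψ : ∀ q ∈ K, IsContactExtensionAt α₀ ι₀ α₁ ι₁ ψ (ι₀ q)) :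
    ∃ ψ' : M₀ → M₁, (∀ q ∈ K, IsContactExtensionAt α₀ ι₀ α₁ ι₁ ψ' (ι₀ q)) ∧
      ∀ q, ι₀ q ∈ C.σ₀ '' Metric.ball C.center (C.radius / 2) →
        IsContactExtensionAt α₀ ι₀ α₁ ι₁ ψ' (ι₀ q) := by
  classical
  set B := Metric.ball C.center C.radius
  set D := Metric.closedBall C.center (C.radius / 2)
  have hDB : D ⊆ B := Metric.closedBall_subset_ball (half_lt_self C.radius_pos)
  have hDs : D ⊆ C.σ₀.source := hDB.trans C.ball_subset_source₀
  have hσ₀D : ContinuousOn C.σ₀ D := C.σ₀.continuousOn.mono hDs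
  have hDc : IsCompact D := isCompact_closedBall _ _
  have hDcl : IsClosed (C.σ₀ '' D) := (hDc.image_of_continuousOn hσ₀D).isClosed
  set Z : Set 𝔼 := D ∩ {y | y 2 = 0}
  have hZ : IsCompact Z := hDc.inter_right (isClosed_eq (by fun_prop) continuous_const)
  set K' : Set 𝔼 := Z ∩ C.σ₀ ⁻¹' (ι₀ '' K)
  have hK' : IsCompact K' := hZ.of_isClosed_subset
    ((hσ₀D.mono inter_subset_left).preimage_isClosed_of_isClosed hZ.isClosed
      (hK.image hι₀).isClosed) inter_subset_left
  have hgerm : ∀ y ∈ K', IsContactGerm C.form₀ C.form₁ (C.σ₁.symm ∘ ψ ∘ C.σ₀) y := by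
    rintro y ⟨hyZ, q, hq, hqy⟩
    exact C.isContactGerm (hDB hyZ.1) hyZ.2 (hqy ▸ hψ q hq)
  obtain ⟨Θ, hΘ, hΘψ⟩ := exists_contactGerm_extension Metric.isOpen_ball C.contDiffOn₀
    C.contDiffOn₁ C.contactFn_pos₀ C.contactFn_pos₁ C.apply_tangent C.contDiffOn_transverse
    C.apply_transverse hK' hgerm hZ (fun y hy ↦ hDB hy.1) (fun y hy ↦ hy.2) inter_subset_left
  refine ⟨(C.σ₀ '' D).piecewise (C.σ₁ ∘ Θ ∘ C.σ₀.symm) ψ, fun q hq ↦ ?_, ?_⟩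
  · refine (hψ q hq).congr ?_
    by_cases hqD : ι₀ q ∈ C.σ₀ '' D
    · obtain ⟨y, hyD, hyq⟩ := hqD
      have hys := hDs hyD
      have hqt : ι₀ q ∈ C.σ₀.target := hyq ▸ C.σ₀.map_source hys
      have hsy : C.σ₀.symm (ι₀ q) = y := by rw [← hyq, C.σ₀.left_inv hys]
      have hy2 := C.symm_apply₀ q hqt (by rw [hsy]; exact hDB hyD)
      rw [hsy] at hy2
      have hyK : y ∈ K' := ⟨⟨hyD, hy2.1⟩, q, hq, hyq.symm⟩
      have hsymm : Filter.Tendsto C.σ₀.symm (𝓝 (ι₀ q)) (𝓝 y) := by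
        have := (C.contMDiffAt_symm₀ _ hqt).continuousAt.tendsto
        rwa [hsy] at this
      have htar : ∀ᶠ x in 𝓝 (ι₀ q), ψ x ∈ C.σ₁.target :=
        (hψ q hq).self_of_nhds.1.continuousAt.eventually_mem (C.σ₁.open_target.mem_nhds (by
          rw [(hψ q hq).self_of_nhds.2.2.2 q rfl, ← hy2.2, ← C.apply₁ y (hDB hyD) hy2.1]
          exact C.σ₁.map_source (C.ball_subset_source₁ (hDB hyD))))
      filter_upwards [hsymm.eventually (hΘψ y hyK), htar, C.σ₀.open_target.mem_nhds hqt]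
        with x h1 h2 h3
      by_cases hx : x ∈ C.σ₀ '' D
      · rw [piecewise_eq_of_mem _ _ _ hx, Function.comp_apply, Function.comp_apply, h1,
          Function.comp_apply, Function.comp_apply, C.σ₀.right_inv h3, C.σ₁.right_inv h2]
      · rw [piecewise_eq_of_notMem _ _ _ hx]
    · filter_upwards [hDcl.isOpen_compl.mem_nhds hqD] with x hx
      exact piecewise_eq_of_notMem _ _ _ hx
  · rintro q ⟨y, hy, hyq⟩
    have hyD := Metric.ball_subset_closedBall hy
    have hys := hDs hyD
    have hsy : C.σ₀.symm (ι₀ q) = y := by rw [← hyq, C.σ₀.left_inv hys]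
    have hy2 := C.symm_apply₀ q (hyq ▸ C.σ₀.map_source hys) (by rw [hsy]; exact hDB hyD)
    rw [hsy] at hy2
    rw [← hyq]
    refine (C.isContactExtensionAt (hDB hyD) hy2.1 (hΘ y ⟨hyD, hy2.1⟩)).congr ?_
    have hopen : IsOpen (C.σ₀ '' Metric.ball C.center (C.radius / 2)) :=
      C.σ₀.isOpen_image_of_subset_source Metric.isOpen_ball
        (Metric.ball_subset_closedBall.trans hDs)
    filter_upwards [hopen.mem_nhds (mem_image_of_mem _ hy)] with x hx
    exact piecewise_eq_of_mem _ _ _ (image_mono Metric.ball_subset_closedBall hx)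

end SurfaceCharts

/-- Patching of local contact extensions along a compact surface. -/
theorem exists_isContactExtensionAt [T2Space M₀] [Nonempty M₁] [TopologicalSpace S] [CompactSpace S]
    {α₀ : OneForm M₀} {ι₀ : S → M₀} (hι₀ : Continuous ι₀) {α₁ : OneForm M₁} {ι₁ : S → M₁}
    (hC : ∀ p, Nonempty (SurfaceCharts α₀ ι₀ α₁ ι₁ p)) :
    ∃ ψ : M₀ → M₁, ∀ q, IsContactExtensionAt α₀ ι₀ α₁ ι₁ ψ (ι₀ q) := by
  -- The induction claims that any map good on a closed set `K` can be made good on `K ∪ closure A`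
  -- as well. This form is stable under unions of sets `A`, as the second extension starts from the
  -- result of the first.
  suffices h : ∀ K : Set S, IsClosed K → ∀ ψ : M₀ → M₁,
      (∀ q ∈ K, IsContactExtensionAt α₀ ι₀ α₁ ι₁ ψ (ι₀ q)) →
      ∃ ψ' : M₀ → M₁, ∀ q ∈ K ∪ closure univ, IsContactExtensionAt α₀ ι₀ α₁ ι₁ ψ' (ι₀ q) by
    obtain ⟨ψ, hψ⟩ := h ∅ isClosed_empty (fun _ ↦ Classical.arbitrary M₁) (by simp)
    exact ⟨ψ, fun q ↦ hψ q (by simp)⟩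
  refine isCompact_univ.induction_on (p := fun A ↦ ∀ K : Set S, IsClosed K → ∀ ψ : M₀ → M₁,
      (∀ q ∈ K, IsContactExtensionAt α₀ ι₀ α₁ ι₁ ψ (ι₀ q)) →
      ∃ ψ' : M₀ → M₁, ∀ q ∈ K ∪ closure A, IsContactExtensionAt α₀ ι₀ α₁ ι₁ ψ' (ι₀ q))
    ?_ ?_ ?_ ?_
  · intro K _ ψ hψ
    exact ⟨ψ, by simpa using hψ⟩
  · intro A A' hAA' h K hK ψ hψ
    obtain ⟨ψ', hψ'⟩ := h K hK ψ hψ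
    exact ⟨ψ', fun q hq ↦ hψ' q (union_subset_union_right K (closure_mono hAA') hq)⟩
  · intro A A' h h' K hK ψ hψ
    obtain ⟨ψ', hψ'⟩ := h K hK ψ hψ
    obtain ⟨ψ'', hψ''⟩ := h' _ (hK.union isClosed_closure) ψ' hψ'
    exact ⟨ψ'', by rwa [closure_union, ← union_assoc]⟩
  · intro p _
    obtain ⟨C⟩ := hC p
    -- The closure of the patch of radius one third lies in the patch of radius one half, where the
    -- extension is good.
    have hlt : C.radius / 3 < C.radius / 2 := by linarith [C.radius_pos]
    have hss {s : ℝ} (hs : s < C.radius) : Metric.closedBall C.center s ⊆ C.σ₀.source :=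
      (Metric.closedBall_subset_ball hs).trans C.ball_subset_source₀
    have hs3 := hss (show C.radius / 3 < C.radius by linarith [C.radius_pos])
    refine ⟨ι₀ ⁻¹' (C.σ₀ '' Metric.ball C.center (C.radius / 3)), mem_nhdsWithin_of_mem_nhds
      (((C.σ₀.isOpen_image_of_subset_source Metric.isOpen_ball
        (Metric.ball_subset_closedBall.trans hs3)).preimage hι₀).mem_nhds
      ⟨C.center, Metric.mem_ball_self (by linarith [C.radius_pos]), ?_⟩), fun K hK ψ hψ ↦ ?_⟩
    · rw [← C.symm_apply_self, C.σ₀.right_inv C.mem_target]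
    · obtain ⟨ψ', h1, h2⟩ := C.exists_extension hι₀ hK.isCompact hψ
      refine ⟨ψ', fun q hq ↦ hq.elim (h1 q) fun hq ↦ h2 q ?_⟩
      have hcl : IsClosed (ι₀ ⁻¹' (C.σ₀ '' Metric.closedBall C.center (C.radius / 3))) :=
        (((isCompact_closedBall _ _).image_of_continuousOn
          (C.σ₀.continuousOn.mono hs3)).isClosed).preimage hι₀
      have := closure_minimal (preimage_mono (image_mono Metric.ball_subset_closedBall)) hcl hq
      exact image_mono (Metric.closedBall_subset_ball hlt) this

end ContactExtension

/-! ### From local to global diffeomorphisms. -/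

section GlobalInverse

/-- By injectivity the global inverse agrees near each image point with a local inverse, so the
image is open and the inverse smooth. -/
theorem exists_openPartialHomeomorph_of_injOn {V : Type*} [NormedAddCommGroup V] [NormedSpace ℝ V]
    [FiniteDimensional ℝ V] {M N : Type*} [TopologicalSpace M] [ChartedSpace V M]
    [TopologicalSpace N] [ChartedSpace V N] [IsManifold 𝓘(ℝ, V) ∞ M] [IsManifold 𝓘(ℝ, V) ∞ N]
    [Nonempty M] {ψ : M → N} {W : Set M} (hW : IsOpen W)
    (hψ : ∀ x ∈ W, ContMDiffAt 𝓘(ℝ, V) 𝓘(ℝ, V) ∞ ψ x)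
    (hd : ∀ x ∈ W, Function.Injective (mfderiv 𝓘(ℝ, V) 𝓘(ℝ, V) ψ x)) (hinj : InjOn ψ W) :
    ∃ Ψ : OpenPartialHomeomorph M N, Ψ.source = W ∧ ⇑Ψ = ψ ∧
      ∀ z ∈ Ψ.target, ContMDiffAt 𝓘(ℝ, V) 𝓘(ℝ, V) ∞ Ψ.symm z := by
  set e := hinj.toPartialEquiv ψ W
  have hloc : ∀ z ∈ e.target, e.target ∈ 𝓝 z ∧ ContMDiffAt 𝓘(ℝ, V) 𝓘(ℝ, V) ∞ e.symm z := by
    intro z hz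
    obtain ⟨x, hx, rfl⟩ : z ∈ ψ '' W := hz
    obtain ⟨Ψ, h1, h2, h3, h4⟩ := exists_openPartialHomeomorph_of_injective_mfderiv hW hψ hx (hd x hx)
    have htar : Ψ.target ∈ 𝓝 (ψ x) :=
      Ψ.open_target.mem_nhds (by rw [← h3 h1]; exact Ψ.map_source h1)
    have hval {z : N} (hz : z ∈ Ψ.target) : ψ (Ψ.symm z) = z := by
      rw [← h3 (Ψ.map_target hz), Ψ.right_inv hz]
    refine ⟨Filter.mem_of_superset htar fun z hz ↦ ⟨Ψ.symm z, h2 (Ψ.map_target hz), hval hz⟩,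
      (h4 _ (mem_of_mem_nhds htar)).congr_of_eventuallyEq ?_⟩
    filter_upwards [htar] with z hz
    have h5 := e.left_inv (x := Ψ.symm z) (h2 (Ψ.map_target hz))
    change e.symm (ψ (Ψ.symm z)) = Ψ.symm z at h5
    rwa [hval hz] at h5
  exact ⟨{ e with
    open_source := hW
    open_target := isOpen_iff_mem_nhds.2 fun z hz ↦ (hloc z hz).1
    continuousOn_toFun := fun x hx ↦ (hψ x hx).continuousAt.continuousWithinAt
    continuousOn_invFun := fun z hz ↦ (hloc z hz).2.continuousAt.continuousWithinAt },
    rfl, rfl, fun z hz ↦ (hloc z hz).2⟩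

end GlobalInverse

/-! ### The theorem. -/

theorem mainTheorem8
    {M₀ M₁ S₀ S₁ : Type*}
    [TopologicalSpace M₀] [T2Space M₀] [SecondCountableTopology M₀]
    [ChartedSpace (EuclideanSpace ℝ (Fin 3)) M₀] [IsManifold (𝓡 3) ∞ M₀]
    [TopologicalSpace M₁] [T2Space M₁] [SecondCountableTopology M₁]
    [ChartedSpace (EuclideanSpace ℝ (Fin 3)) M₁] [IsManifold (𝓡 3) ∞ M₁]
    [TopologicalSpace S₀] [CompactSpace S₀] [Nonempty S₀]
    [ChartedSpace (EuclideanSpace ℝ (Fin 2)) S₀] [IsManifold (𝓡 2) ∞ S₀]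
    [TopologicalSpace S₁] [CompactSpace S₁]
    [ChartedSpace (EuclideanSpace ℝ (Fin 2)) S₁] [IsManifold (𝓡 2) ∞ S₁]
    (α₀ : OneForm M₀) (hα₀ : IsContactForm α₀)
    (α₁ : OneForm M₁) (hα₁ : IsContactForm α₁)
    (ι₀ : S₀ → M₀) (hι₀ : IsSmoothEmbedding (𝓡 2) (𝓡 3) ∞ ι₀)
    (ι₁ : S₁ → M₁) (hι₁ : IsSmoothEmbedding (𝓡 2) (𝓡 3) ∞ ι₁)
    (φ : S₀ ≃ₘ^∞⟮𝓡 2, 𝓡 2⟯ S₁)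
    (hφ : PreservesOrientedCharFoliation α₀ ι₀ α₁ ι₁ φ) :
    ∃ ψ : OpenPartialHomeomorph M₀ M₁,
      range ι₀ ⊆ ψ.source ∧ range ι₁ ⊆ ψ.target ∧
      IsContactomorphism α₀ α₁ ψ ∧
      ∀ q : S₀, ψ (ι₀ q) = ι₁ (φ q) := by
  have hι₁φ : Function.Injective (ι₁ ∘ φ) := hι₁.isEmbedding.injective.comp φ.injective
  have : Nonempty M₀ := ‹Nonempty S₀›.map ι₀
  have : Nonempty M₁ := ‹Nonempty S₀›.map (ι₁ ∘ φ)
  obtain ⟨ψ, hψ⟩ := exists_isContactExtensionAt hι₀.isEmbedding.continuous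
    (hφ.nonempty_surfaceCharts hα₀ hα₁ hι₀ hι₁)
  have hψι (q : S₀) : ψ (ι₀ q) = ι₁ (φ q) := (hψ q).self_of_nhds.2.2.2 q rfl
  set O : Set M₀ := {x | IsContactExtensionAt α₀ ι₀ α₁ (ι₁ ∘ φ) ψ x}
  have hO : IsOpen O := isOpen_iff_mem_nhds.2 fun x hx ↦ eventually_eventually_nhds.2 hx
  have hOs : ∀ x ∈ O, ContMDiffAt (𝓡 3) (𝓡 3) ∞ ψ x := fun x hx ↦ hx.self_of_nhds.1
  have hOd : ∀ x ∈ O, Function.Injective (mfderiv (𝓡 3) (𝓡 3) ψ x) :=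
    fun x hx ↦ hx.self_of_nhds.2.1
  have hιO : range ι₀ ⊆ O := range_subset_iff.2 hψ
  -- A continuous map that is injective on a compact set and locally injective at each of its points
  -- is injective on a neighbourhood of the set.
  obtain ⟨t, ht, hιt, hinj⟩ := InjOn.exists_isOpen_superset (f := ψ) (s := range ι₀)
    (by
      rintro _ ⟨q, rfl⟩ _ ⟨q', rfl⟩ h
      rw [hψι, hψι] at h
      rw [hι₁φ h])
    (isCompact_range hι₀.isEmbedding.continuous) (fun x hx ↦ (hOs x (hιO hx)).continuousAt)
    (fun x hx ↦ by
      obtain ⟨Ψ, h1, -, h3, -⟩ := exists_openPartialHomeomorph_of_injective_mfderiv hO hOs (hιO hx)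
        (hOd x (hιO hx))
      exact ⟨Ψ.source, Ψ.open_source.mem_nhds h1, h3.injOn_iff.1 Ψ.injOn⟩)
  obtain ⟨Ψ, hΨs, hΨψ, hΨ'⟩ := exists_openPartialHomeomorph_of_injOn (ht.inter hO)
    (fun x hx ↦ hOs x hx.2) (fun x hx ↦ hOd x hx.2) (hinj.mono inter_subset_left)
  have hsrc : range ι₀ ⊆ Ψ.source := by
    rw [hΨs]
    exact subset_inter hιt hιO
  have hΨsm : ContMDiffOn (𝓡 3) (𝓡 3) ∞ Ψ Ψ.source := by
    rw [hΨψ, hΨs]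
    exact fun x hx ↦ (hOs x hx.2).contMDiffWithinAt
  have hΨsm' : ContMDiffOn (𝓡 3) (𝓡 3) ∞ Ψ.symm Ψ.target := fun z hz ↦ (hΨ' z hz).contMDiffWithinAt
  have hΨd : Ψ.MDifferentiable (𝓡 3) (𝓡 3) :=
    ⟨hΨsm.mdifferentiableOn (by simp), hΨsm'.mdifferentiableOn (by simp)⟩
  refine ⟨Ψ, hsrc, ?_, ⟨hΨsm, hΨsm', fun x hx ↦ ?_⟩, fun q ↦ by rw [hΨψ, hψι]⟩
  · rintro _ ⟨q, rfl⟩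
    obtain ⟨q, rfl⟩ : ∃ q', φ q' = q := φ.surjective q
    rw [← hψι, ← hΨψ]
    exact Ψ.map_source (hsrc (mem_range_self q))
  -- Together with surjectivity of the differential, the equivalence of kernels gives equality of
  -- planes, not just inclusion.
  · have hker (v : TangentSpace (𝓡 3) x) :
        α₀ x v = 0 ↔ α₁ (Ψ x) (mfderiv (𝓡 3) (𝓡 3) Ψ x v) = 0 := by
      have hxO : x ∈ O := (hΨs ▸ hx : x ∈ t ∩ O).2
      rw [α₁.apply_mfderiv_congr (Filter.EventuallyEq.of_eq hΨψ)]
      exact hxO.self_of_nhds.2.2.1 v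
    ext w
    constructor
    · rintro ⟨v, hv, rfl⟩
      exact (hker v).1 hv
    · intro hw
      obtain ⟨v, rfl⟩ := hΨd.mfderiv_surjective hx w
      exact ⟨v, (hker v).2 hw, rfl⟩
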